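/- **2D PDE limit for $p>-1$.** Let $u:\mathbb R^2\to\mathbb R$ be $C^\infty$, let $x_0\in\mathbb R^2$, and let $p\in(-1,\infty)\setminus\{0\}$. For $\varrho>0$ let $D_\varrho(x_0)$ be the closed Euclidean disc of radius $\varrho$ around $x_0$, and let $\operatorname{mean}_p\{u(x)\mid x\in D_\varrho(x_0)\}$ denote the order-$p$ mean of the values of $u$ on the disc, i.e. the set of minimisers over $\mu\in\mathbb R$ of $$\operatorname{sgn}(p)\,\frac{1}{|D_\varrho(x_0)|}\int_{D_\varrho(x_0)}|\mu-u(x)|^p\,dx\in[-\infty,\infty],$$ where $0^p=\infty$ if $p<0$. Where $\nabla u(x_0)\neq0$ put $\eta=\nabla u(x_0)/|\nabla u(x_0)|$, let $\xi$ be a unit vector orthogonal to $\eta$, and write $u_{\eta\eta}$, $u_{\xi\xi}$ for the second derivatives of $u$ in directions $\eta$, $\xi$. Let $\tau=\varrho^2/(2p+4)$. 1. (Regular points.) If $|\nabla u(x_0)|>0$, then for all sufficiently small $\varrho>0$ the minimiser $\mu_\varrho$ exists and is unique, and for $\varrho\to0$ $$\mu_\varrho-u(x_0)=\frac{\varrho^2}{2(p+2)}\bigl(u_{\xi\xi}(x_0)+(p-1)\,u_{\eta\eta}(x_0)\bigr)+\mathcal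 O\bigl(\varrho^{(\min\{p,0\}+5)/2}\bigr).$$ That is, one filtering step approximates an explicit time step of size $\tau$ of the PDE $u_t=u_{\xi\xi}+(p-1)u_{\eta\eta}$: $$\frac{\mu_\varrho-u(x_0)}{\tau}=u_{\xi\xi}(x_0)+(p-1)u_{\eta\eta}(x_0)+\mathcal O\bigl(\varrho^{(\min\{p,0\}+1)/2}\bigr).$$ 2. (Extrema.) If $x_0$ is a local minimum (maximum) of $u$, then for all sufficiently small $\varrho>0$ every order-$p$ mean $\mu$ of $u$ on $D_\varrho(x_0)$ satisfies $\mu-u(x_0)\ge0$ ($\le0$). 3. (Critical points with semidefinite Hessian.) If $\nabla u(x_0)=0$ and the Hessian $D^2u(x_0)$ is positive (negative) semidefinite, then the filtering step approximates an evolution with $u_t\ge0$ ($u_t\le0$): for every $\varepsilon>0$ and all sufficiently small $\varrho>0$, every order-$p$ mean $\mu$ of $u$ on $D_\varrho(x_0)$ satisfies $(\mu-u(x_0))/\tau\ge-\varepsilon$ ($\le\varepsilon$). -/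

import Mathlib

open MeasureTheory
open scoped ENNReal ContDiff

noncomputable section

/-- The Euclidean plane. -/
abbrev Plane : Type := EuclideanSpace ℝ (Fin 2)

/-- The energy `sgn(p) * ∫ |μ - z| ^ p dν(z)` whose minimisers are the order-`p` means of the
distribution `ν` on the real line; for `ν` with density `γ` it is
`∫ γ(z) sgn(p) |μ - z| ^ p dz`. The integral is taken with values in `[0, ∞]`, and for `p < 0`
the penaliser has its pole at `z = μ`: there `|μ - z| ^ p = ∞`. -/
def orderMeanEnergy (p : ℝ) (ν : Measure ℝ) (μ : ℝ) : EReal :=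
  ((Real.sign p : ℝ) : EReal) * ((∫⁻ z, ENNReal.ofReal |μ - z| ^ p ∂ν : ℝ≥0∞) : EReal)

/-- The order-`p` mean of the distribution `ν`, as the set of all minimisers
(`argmin`) of the energy. -/
def orderMean (p : ℝ) (ν : Measure ℝ) : Set ℝ :=
  {μ | ∀ m : ℝ, orderMeanEnergy p ν μ ≤ orderMeanEnergy p ν m}

/-- The distribution of the values of `u` in the closed disc of radius `ϱ` around `x`: the law of
`u(Z)` for a point `Z` distributed uniformly in the disc. -/
def discLaw (u : Plane → ℝ) (x : Plane) (ϱ : ℝ) : Measure ℝ :=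
  (ProbabilityTheory.cond volume (Metric.closedBall x ϱ)).map u

/-- One step of order-`p` mean filtering at `x` with a disc-shaped window of radius `ϱ`. -/
def discMean (p : ℝ) (u : Plane → ℝ) (x : Plane) (ϱ : ℝ) : Set ℝ :=
  orderMean p (discLaw u x ϱ)

/-- The Hessian of `u` at `x` as a quadratic form; for a unit vector `v` it is the second
derivative of `u` at `x` in direction `v`. -/
def hessianForm (u : Plane → ℝ) (x v : Plane) : ℝ :=
  fderiv ℝ (fderiv ℝ u) x v v

/-- The unit vector `η` in the direction of the positive gradient
(meaningful where the gradient does not vanish). -/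
def gradientDir (u : Plane → ℝ) (x : Plane) : Plane :=
  ‖gradient u x‖⁻¹ • gradient u x

/-- The unit vector `ξ` in level-line direction: `η` rotated by a right angle. -/
def levelDir (u : Plane → ℝ) (x : Plane) : Plane :=
  !₂[-(gradientDir u x 1), gradientDir u x 0]

/-- The right-hand side `u_ξξ + (p - 1) u_ηη` of the evolution equation. -/
def smootherRHS (p : ℝ) (u : Plane → ℝ) (x : Plane) : ℝ :=
  hessianForm u x (levelDir u x) + (p - 1) * hessianForm u x (gradientDir u x)

/-- The time step size `τ = ϱ² / (2p + 4)`. -/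
def timeStep (p ϱ : ℝ) : ℝ := ϱ ^ 2 / (2 * p + 4)

end

section

open Set Filter Topology

/-! Regular points are handled by rescaling. In the orthonormal frame `(η, ξ)`, with `g` the
gradient norm, u(x₀ + ϱ(sη + vξ)) = u(x₀) + ϱ g W((s,v),ϱ), where W is jointly smooth, W(·,0) = s,
and its first ε-derivative at 0 is a quadratic form αs² + βsv + γv² (`exists_normalized_expansion`).
By homogeneity of the penaliser, the order-p mean corresponds to the extremum in m of E(m,ε) = ∫ |m
- W(y,ε)|^p over the unit disc, at ε = ϱ and m = (μ - u(x₀))/(ϱg).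

The penaliser is singular, yet E is smooth near (0,0) for every p > -1 (`exists_contDiffOn_energy`).
The values of W near 0 have a density that is smooth in the value and in ε, and convolving a smooth
compactly supported function with the locally integrable |x|^p gives a smooth function. Values away
from 0 never meet the singularity. The density is obtained on each curve s ↦ (s, t√(1-s²)); these
curves sweep out the disc over a product domain in (s,t), so the disc's boundary causes no loss of
smoothness.

The Taylor coefficients of E at the origin come from `exists_energy_expansion`. Formal
differentiation under the integral is not available at order p, so the computation starts at order
p+2, whose second m-derivative is (p+2)(p+1)E. For ε = 0, an integration by parts gives a
differential equation for the potential of the semicircle law (`moment_relation_unitDisc`), whence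
E_m = 0 and E_mm = p(p+2)E at the origin. The ε-derivative at order p+2 is a combination of moments,
and two m-derivatives of it give the mixed coefficient -p((p-1)α + γ)E.

Thus pE is strictly convex in m near 0 for either sign of p. Its minimiser there is εc + O(ε²) with
c = ((p-1)α + γ)/(p+2). Values of m away from 0 are excluded uniformly: at ε = 0 by a rearrangement
inequality, and for small ε by comparison with a clamped, uniformly continuous penaliser
(`exists_unique_extremum`). Undoing the scaling gives an error O(ϱ³), better than the stated rate.

The other claims use only comparison: a candidate lying strictly beyond a bound for u on the disc is
strictly farther from every value than the bound itself (`notMem_orderMean`). At extrema the bound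
is u(x₀); at critical points with semidefinite Hessian, Taylor's formula gives u(x₀) up to an
arbitrarily small multiple of ϱ². -/

/-! ### Smooth dependence on parameters -/

theorem IsCompact.exists_contDiff_cutoff {G : Type*} [NormedAddCommGroup G] [NormedSpace ℝ G]
    [FiniteDimensional ℝ G] {K U : Set G} (hK : IsCompact K) (hU : IsOpen U) (hKU : K ⊆ U) :
    ∃ φ : G → ℝ, ContDiff ℝ ∞ φ ∧ HasCompactSupport φ ∧ tsupport φ ⊆ U ∧
      (∀ x ∈ K, φ x = 1) ∧ ∀ x, φ x ∈ Icc (0 : ℝ) 1 := by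
  obtain ⟨K', hK', h1, h2⟩ := exists_compact_between hK hU hKU
  obtain ⟨f, hf1, hf0, hf⟩ := exists_contMDiffMap_one_nhds_of_subset_interior
    (modelWithCornersSelf ℝ G) (n := (⊤ : ℕ∞)) hK.isClosed h1
  have hts : tsupport f ⊆ K' := by
    refine closure_minimal ?_ hK'.isClosed
    intro x hx
    by_contra h
    exact hx (hf0 x h)
  refine ⟨f, f.contMDiff.contDiff, ?_, hts.trans h2, fun x hx => ?_, hf⟩
  · exact hK'.of_isClosed_subset (isClosed_tsupport _) hts
  · exact hf1.self_of_nhdsSet x hx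

/-- A smooth function on `s × U` times a cutoff supported in `U` is smooth on `s × univ`. -/
theorem ContDiffOn.cutoff_mul {P G : Type*} [NormedAddCommGroup P] [NormedSpace ℝ P]
    [NormedAddCommGroup G] [NormedSpace ℝ G] {φ : G → ℝ} {U : Set G} {s : Set P}
    {f : P × G → ℝ} (hs : IsOpen s) (hU : IsOpen U) (hφ : ContDiff ℝ ∞ φ) (hφU : tsupport φ ⊆ U)
    (hf : ContDiffOn ℝ ∞ f (s ×ˢ U)) :
    ContDiffOn ℝ ∞ (fun q : P × G => φ q.2 * f q) (s ×ˢ univ) := by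
  rintro ⟨p, x⟩ ⟨hp, -⟩
  apply ContDiffAt.contDiffWithinAt
  by_cases hx : x ∈ tsupport φ
  · exact (hφ.comp contDiff_snd).contDiffAt.mul
      (hf.contDiffAt ((hs.prod hU).mem_nhds ⟨hp, hφU hx⟩))
  · have : ∀ᶠ q : P × G in 𝓝 (p, x), φ q.2 * f q = 0 := by
      have h1 : ∀ᶠ y in 𝓝 x, y ∉ tsupport φ := (isClosed_tsupport φ).isOpen_compl.mem_nhds hx
      have h2 := continuousAt_snd (p := (p, x)) |>.eventually h1
      filter_upwards [h2] with q hq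
      rw [image_eq_zero_of_notMem_tsupport hq, zero_mul]
    exact (contDiffAt_const (c := (0 : ℝ))).congr_of_eventuallyEq this

/-- Integrals of jointly smooth functions over a compact set depend smoothly on the parameter. -/
theorem ContDiffOn.setIntegral_of_isCompact {P G : Type*} [NormedAddCommGroup P] [NormedSpace ℝ P]
    [NormedAddCommGroup G] [NormedSpace ℝ G] [FiniteDimensional ℝ G] [MeasurableSpace G]
    [BorelSpace G] {μ : Measure G} [IsLocallyFiniteMeasure μ] {K U : Set G} {s : Set P}
    {f : P × G → ℝ} (hs : IsOpen s) (hK : IsCompact K) (hU : IsOpen U) (hKU : K ⊆ U)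
    (hf : ContDiffOn ℝ ∞ f (s ×ˢ U)) :
    ContDiffOn ℝ ∞ (fun p => ∫ x in K, f (p, x) ∂μ) s := by
  obtain ⟨φ, hφ, hφc, hφU, hφ1, -⟩ := hK.exists_contDiff_cutoff hU hKU
  -- The integral over `K` is the convolution at 0 of the indicator of `K` with the reflected
  -- integrand; hence the sign changes. The rough factor need only be locally integrable.
  have hg := (ContDiffOn.cutoff_mul hs hU hφ hφU hf).comp
    (g := fun q : P × G => φ q.2 * f q) (f := fun q : P × G => (q.1, -q.2))
    (s := s ×ˢ univ) (by fun_prop) (fun q hq => ⟨hq.1, mem_univ _⟩)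
  have hind : LocallyIntegrable (K.indicator (fun _ => (1 : ℝ))) μ :=
    (locallyIntegrable_const 1).indicator hK.measurableSet
  have := contDiffOn_convolution_right_with_param_comp (n := ⊤) (μ := μ)
    (ContinuousLinearMap.mul ℝ ℝ) (v := fun _ : P => (0 : G)) contDiffOn_const
    (g := fun p x => φ (-x) * f (p, -x)) (k := -tsupport φ) hs hφc.isCompact.neg
    (fun p x _ hx => by
      have : -x ∉ tsupport φ := by simpa using hx
      simp [image_eq_zero_of_notMem_tsupport this]) hind hg
  refine this.congr fun p hp => ?_
  rw [convolution_def, ← integral_indicator hK.measurableSet]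
  refine integral_congr_ae (Eventually.of_forall fun x => ?_)
  by_cases hx : x ∈ K
  · simp [hx, hφ1 x hx]
  · simp [hx]

/-- Hadamard's lemma with parameters. -/
theorem ContDiffOn.exists_hadamard {E : Type*} [NormedAddCommGroup E] [NormedSpace ℝ E]
    {N : Set E} {J : Set ℝ} (hN : IsOpen N) (hJ : IsOpen J) (hJc : Convex ℝ J) (hJ0 : (0 : ℝ) ∈ J)
    {f : E × ℝ → ℝ} (hf : ContDiffOn ℝ ∞ f (N ×ˢ J)) :
    ∃ f₁ : E × ℝ → ℝ, ContDiffOn ℝ ∞ f₁ (N ×ˢ J) ∧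
      (∀ x ∈ N, ∀ ε ∈ J, f (x, ε) = f (x, 0) + ε * f₁ (x, ε)) ∧
      ∀ x ∈ N, HasDerivAt (fun ε => f (x, ε)) (f₁ (x, 0)) 0 := by
  have hO : IsOpen (N ×ˢ J) := hN.prod hJ
  let D : E × ℝ → ℝ := fun q => fderiv ℝ f q (0, 1)
  have hD : ContDiffOn ℝ ∞ D (N ×ˢ J) :=
    (hf.fderiv_of_isOpen hO (m := ∞) (by simp)).clm_apply contDiffOn_const
  have hder : ∀ x ∈ N, ∀ ε ∈ J, HasDerivAt (fun ε => f (x, ε)) (D (x, ε)) ε := by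
    intro x hx ε hε
    have h1 : HasFDerivAt f (fderiv ℝ f (x, ε)) (x, ε) :=
      ((hf.contDiffAt (hO.mem_nhds ⟨hx, hε⟩)).differentiableAt (by simp)).hasFDerivAt
    have h2 : HasDerivAt (fun ε : ℝ => (x, ε)) ((0 : E), (1 : ℝ)) ε :=
      (hasDerivAt_const ε x).prodMk (hasDerivAt_id ε)
    exact h1.comp_hasDerivAt ε h2
  have hmem : ∀ ε ∈ J, ∀ θ ∈ Icc (0 : ℝ) 1, θ * ε ∈ J := fun ε hε θ hθ => by
    have := hJc.starConvex hJ0 |>.smul_mem hε hθ.1 hθ.2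
    simpa using this
  -- The difference quotient is the average of the ε-derivative along the segment from 0 to ε, which
  -- stays smooth at ε = 0.
  let f₁ : E × ℝ → ℝ := fun q => ∫ θ in Icc (0 : ℝ) 1, D (q.1, θ * q.2)
  have hval : ∀ x, f₁ (x, 0) = D (x, 0) := fun x => by simp [f₁]
  refine ⟨f₁, ?_, ?_, fun x hx => by rw [hval]; exact hder x hx 0 hJ0⟩
  · intro q hq
    obtain ⟨x, ε⟩ := q
    have hopen : IsOpen {r : (E × ℝ) × ℝ | r.1.1 ∈ N ∧ r.2 * r.1.2 ∈ J} :=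
      (hN.preimage (by fun_prop)).inter (hJ.preimage (f := fun r : (E × ℝ) × ℝ => r.2 * r.1.2)
        (by fun_prop))
    -- The integrand is smooth only where θε lies in `J`; the tube lemma supplies a product
    -- neighbourhood of the point and of all θ in [0,1] inside that region.
    obtain ⟨V, U, hV, hU, hqV, hKU, hsub⟩ := generalized_tube_lemma
      (isCompact_singleton (x := (x, ε))) (isCompact_Icc (a := (0 : ℝ)) (b := 1)) hopen
      (by rintro ⟨r, θ⟩ ⟨hr, hθ⟩
          rw [mem_singleton_iff] at hr
          subst hr
          exact ⟨hq.1, hmem ε hq.2 θ hθ⟩)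
    have h := ContDiffOn.setIntegral_of_isCompact (μ := volume) hV isCompact_Icc hU hKU
      (f := fun r : (E × ℝ) × ℝ => D (r.1.1, r.2 * r.1.2))
      (hD.comp (by fun_prop) (fun r hr => hsub hr))
    exact (h.contDiffAt (hV.mem_nhds (hqV rfl))).contDiffWithinAt
  · intro x hx ε hε
    have hc : ContinuousOn (fun θ : ℝ => D (x, θ * ε)) (Icc 0 1) :=
      hD.continuousOn.comp (by fun_prop) (fun θ hθ => ⟨hx, hmem ε hε θ hθ⟩)
    have hd : ∀ θ ∈ uIcc (0 : ℝ) 1, HasDerivAt (fun θ => f (x, θ * ε)) (D (x, θ * ε) * ε) θ := by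
      intro θ hθ
      rw [uIcc_of_le zero_le_one] at hθ
      exact (hder x hx _ (hmem ε hε θ hθ)).comp θ (by simpa using (hasDerivAt_id θ).mul_const ε)
    have := intervalIntegral.integral_eq_sub_of_hasDerivAt hd
      ((hc.mul continuousOn_const).intervalIntegrable_of_Icc zero_le_one)
    rw [intervalIntegral.integral_mul_const, intervalIntegral.integral_of_le zero_le_one,
      ← integral_Icc_eq_integral_Ioc] at this
    simp only [zero_mul, one_mul] at this
    simp only [f₁]
    linarith

/-- A function solving an equation uniquely inherits its smoothness. -/
theorem ContDiffOn.of_unique_implicit {P : Type*} [NormedAddCommGroup P] [NormedSpace ℝ P]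
    [CompleteSpace P] {F : P × ℝ → ℝ} {N : Set P} {I : Set ℝ} (hN : IsOpen N) (hI : IsOpen I)
    (hF : ContDiffOn ℝ ∞ F (N ×ˢ I)) (hF' : ∀ q ∈ N, ∀ s ∈ I, deriv (fun s => F (q, s)) s ≠ 0)
    {a : P → ℝ} (ha : ∀ q ∈ N, a q ∈ I) (haF : ∀ q ∈ N, F (q, a q) = 0)
    (hun : ∀ q ∈ N, ∀ s ∈ I, F (q, s) = 0 → s = a q) : ContDiffOn ℝ ∞ a N := by
  intro q hq
  have hmem : N ×ˢ I ∈ 𝓝 (q, a q) := (hN.prod hI).mem_nhds ⟨hq, ha q hq⟩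
  have cdf : ContDiffAt ℝ ∞ F (q, a q) := hF.contDiffAt hmem
  have hfd := (cdf.differentiableAt (by simp)).hasFDerivAt
  have hder : HasDerivAt (fun s => F (q, s)) (fderiv ℝ F (q, a q) (0, 1)) (a q) :=
    hfd.comp_hasDerivAt (a q) ((hasDerivAt_const (a q) q).prodMk (hasDerivAt_id (a q)))
  have hne : fderiv ℝ F (q, a q) (0, 1) ≠ 0 := by
    rw [← hder.deriv]; exact hF' q hq _ (ha q hq)
  have hinv : (fderiv ℝ F (q, a q) ∘L .inr ℝ P ℝ).IsInvertible := by
    refine ⟨ContinuousLinearEquiv.unitsEquivAut ℝ (Units.mk0 _ hne), ?_⟩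
    ext
    simp
  have h1 := cdf.contDiffAt_implicitFunction (by simp) hinv
  have h2 := cdf.eventually_apply_implicitFunction (by simp) hinv
  have h3 := cdf.implicitFunction_apply_self (by simp) hinv
  have h4 : ∀ᶠ x in 𝓝 q, cdf.implicitFunction (by simp) hinv x ∈ I := by
    have := h1.continuousAt
    refine this (hI.mem_nhds ?_)
    rw [h3]; exact ha q hq
  refine (h1.congr_of_eventuallyEq ?_).contDiffWithinAt
  filter_upwards [h2, h4, hN.mem_nhds hq] with x hx2 hx4 hxN
  refine (hun x hxN _ hx4 ?_).symm
  rw [hx2, haF q hq]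

/-! ### The unit disc and the singular penaliser -/

/-- The closed unit disc in coordinates. -/
def unitDisc : Set (ℝ × ℝ) := {y | y.1 ^ 2 + y.2 ^ 2 ≤ 1}

/-- The singular penaliser `|x| ^ p`, with value `∞` at its pole. -/
noncomputable def penalty (p x : ℝ) : ℝ≥0∞ := ENNReal.ofReal |x| ^ p

theorem measurable_penalty (p : ℝ) : Measurable (penalty p) := by
  unfold penalty; fun_prop

theorem penalty_of_ne {p x : ℝ} (hx : x ≠ 0) : penalty p x = ENNReal.ofReal (|x| ^ p) :=
  ENNReal.ofReal_rpow_of_pos (abs_pos.2 hx)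

theorem isClosed_unitDisc : IsClosed unitDisc :=
  isClosed_le (by fun_prop) continuous_const

theorem unitDisc_subset : unitDisc ⊆ Icc (-1) 1 ×ˢ Icc (-1) 1 := by
  rintro ⟨s, v⟩ h
  simp only [unitDisc, mem_ofPred_eq] at h
  refine ⟨⟨?_, ?_⟩, ⟨?_, ?_⟩⟩ <;> simp only <;> nlinarith [sq_nonneg s, sq_nonneg v]

theorem isCompact_unitDisc : IsCompact unitDisc :=
  (isCompact_Icc.prod isCompact_Icc).of_isClosed_subset isClosed_unitDisc unitDisc_subset

theorem mem_unitDisc_iff {s v : ℝ} :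
    (s, v) ∈ unitDisc ↔ s ∈ Icc (-1 : ℝ) 1 ∧ v ∈ Icc (-√(1 - s ^ 2)) √(1 - s ^ 2) := by
  constructor
  · intro h
    refine ⟨(unitDisc_subset h).1, ?_⟩
    simp only [unitDisc, mem_ofPred_eq] at h
    exact abs_le.1 (Real.abs_le_sqrt (by linarith))
  · rintro ⟨⟨h1, h2⟩, h⟩
    have h3 : 0 ≤ 1 - s ^ 2 := by nlinarith
    have := Real.sq_sqrt h3
    have h4 := sq_le_sq' h.1 h.2
    simp only [unitDisc, mem_ofPred_eq]
    linarith

theorem lintegral_unitDisc {F : ℝ × ℝ → ℝ≥0∞} (hF : Measurable F) :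
    ∫⁻ y in unitDisc, F y =
      ∫⁻ s in Icc (-1 : ℝ) 1, ∫⁻ v in Icc (-√(1 - s ^ 2)) √(1 - s ^ 2), F (s, v) := by
  rw [← lintegral_indicator isClosed_unitDisc.measurableSet, Measure.volume_eq_prod,
    lintegral_prod _ (hF.indicator isClosed_unitDisc.measurableSet).aemeasurable,
    ← lintegral_indicator measurableSet_Icc]
  refine lintegral_congr fun s => ?_
  by_cases hs : s ∈ Icc (-1 : ℝ) 1
  · rw [indicator_of_mem hs, ← lintegral_indicator measurableSet_Icc]
    refine lintegral_congr fun v => ?_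
    simp only [indicator, mem_unitDisc_iff, hs, true_and]
  · rw [indicator_of_notMem hs]
    simp [indicator, mem_unitDisc_iff, hs]

/-- Integration over the disc along the half ellipses `s ↦ (s, t √(1 - s ^ 2))`. -/
theorem lintegral_unitDisc_elliptic {F : ℝ × ℝ → ℝ≥0∞} (hF : Measurable F) :
    ∫⁻ y in unitDisc, F y = ∫⁻ t in Icc (-1 : ℝ) 1, ∫⁻ s in Icc (-1 : ℝ) 1,
      ENNReal.ofReal √(1 - s ^ 2) * F (s, t * √(1 - s ^ 2)) := by
  rw [lintegral_unitDisc hF, lintegral_lintegral_swap]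
  swap
  · exact (Measurable.aemeasurable (by fun_prop))
  refine lintegral_congr fun s => ?_
  have hk : 0 ≤ √(1 - s ^ 2) := Real.sqrt_nonneg _
  rw [lintegral_const_mul _ (by fun_prop)]
  rcases hk.eq_or_lt with h0 | h0
  · simp [← h0]
  · have himg : (fun t : ℝ => t * √(1 - s ^ 2)) '' Icc (-1) 1
        = Icc (-√(1 - s ^ 2)) √(1 - s ^ 2) := by
      rw [image_mul_right_Icc (by norm_num) hk]; simp
    have := lintegral_image_eq_lintegral_abs_deriv_mul (s := Icc (-1 : ℝ) 1) measurableSet_Icc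
      (f := fun t : ℝ => t * √(1 - s ^ 2)) (f' := fun _ => √(1 - s ^ 2))
      (fun t _ => by simpa using ((hasDerivAt_id t).mul_const √(1 - s ^ 2)).hasDerivWithinAt)
      (fun a _ b _ h => mul_right_cancel₀ h0.ne' h) (fun v => F (s, v))
    rw [himg] at this
    rw [this, abs_of_nonneg hk, lintegral_const_mul _ (by fun_prop)]

theorem intervalIntegrable_abs_rpow {p : ℝ} (hp : -1 < p) (a b : ℝ) :
    IntervalIntegrable (fun x : ℝ => |x| ^ p) volume a b := by
  have h0 : ∀ c : ℝ, 0 ≤ c → IntervalIntegrable (fun x : ℝ => |x| ^ p) volume 0 c := fun c hc =>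
    (intervalIntegral.intervalIntegrable_rpow' (a := 0) (b := c) hp).congr (fun x hx => by
      rw [uIoc_of_le hc] at hx
      rw [abs_of_pos hx.1])
  have h1 : ∀ c : ℝ, IntervalIntegrable (fun x : ℝ => |x| ^ p) volume 0 c := fun c => by
    rcases le_total 0 c with hc | hc
    · exact h0 c hc
    · simpa using (h0 (-c) (by linarith)).comp_sub_left 0
  exact (h1 a).symm.trans (h1 b)

theorem locallyIntegrable_abs_sub_rpow {p : ℝ} (hp : -1 < p) (m : ℝ) :
    LocallyIntegrable (fun x : ℝ => |m - x| ^ p) := by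
  intro x
  refine ⟨Icc (x - 1) (x + 1), Icc_mem_nhds (by linarith) (by linarith), ?_⟩
  rw [← intervalIntegrable_iff_integrableOn_Icc_of_le (by linarith)]
  simpa using (intervalIntegrable_abs_rpow hp (m - (x - 1)) (m - (x + 1))).comp_sub_left m

/-! ### Perturbations of the first coordinate: smooth density and smooth energy -/

/-- Strict inequalities at parameter `0` persist, uniformly over compact sets. -/
theorem IsCompact.eventually_forall_lt {X : Type*} [TopologicalSpace X] {K O : Set X}
    {J : Set ℝ} {g : X × ℝ → ℝ} {c : ℝ} (hK : IsCompact K) (hO : IsOpen O) (hJ : IsOpen J)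
    (hJ0 : (0 : ℝ) ∈ J) (hKO : K ⊆ O) (hg : ContinuousOn g (O ×ˢ J))
    (h : ∀ x ∈ K, g (x, 0) < c) : ∀ᶠ ε in 𝓝 (0 : ℝ), ∀ x ∈ K, g (x, ε) < c := by
  refine hK.eventually_forall_of_forall_eventually (P := fun ε x => g (x, ε) < c) fun x hx => ?_
  have h1 : ContinuousAt g (x, 0) := hg.continuousAt ((hO.prod hJ).mem_nhds ⟨hKO hx, hJ0⟩)
  have h2 := h1.eventually_lt continuousAt_const (h x hx)
  have h3 : Tendsto (fun z : ℝ × X => (z.2, z.1)) (𝓝 (0, x)) (𝓝 (x, 0)) :=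
    continuous_swap.tendsto _
  exact h3.eventually h2

/-- The endpoints s = ±1 must be left out, since the square root is not smooth there; only values
near 0, hence s near 0, will be needed. -/
theorem contDiffOn_slice {W : (ℝ × ℝ) × ℝ → ℝ} (hW : ContDiff ℝ ∞ W) :
    ContDiffOn ℝ ∞ (fun r : (ℝ × ℝ) × ℝ => W ((r.1.1, r.1.2 * √(1 - r.1.1 ^ 2)), r.2))
      ((Ioo (-1) 1 ×ˢ univ) ×ˢ univ) := by
  refine hW.comp_contDiffOn ?_
  have : ContDiffOn ℝ ∞ (fun r : (ℝ × ℝ) × ℝ => √(1 - r.1.1 ^ 2))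
      ((Ioo (-1) 1 ×ˢ univ) ×ˢ univ) := by
    refine ContDiffOn.sqrt (by fun_prop) ?_
    rintro ⟨⟨s, t⟩, ε⟩ ⟨⟨⟨h1, h2⟩, -⟩, -⟩
    simp only at h1 h2 ⊢
    nlinarith
  fun_prop

theorem ContDiffOn.hasDerivAt_fst {f : (ℝ × ℝ) × ℝ → ℝ} {O : Set ((ℝ × ℝ) × ℝ)} (hO : IsOpen O)
    (hf : ContDiffOn ℝ ∞ f O) {s t ε : ℝ} (h : ((s, t), ε) ∈ O) :
    HasDerivAt (fun s => f ((s, t), ε)) (fderiv ℝ f ((s, t), ε) ((1, 0), 0)) s := by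
  have h1 := ((hf.contDiffAt (hO.mem_nhds h)).differentiableAt (by simp)).hasFDerivAt
  exact h1.comp_hasDerivAt s
    (((hasDerivAt_id s).prodMk (hasDerivAt_const s t)).prodMk (hasDerivAt_const s ε))

theorem ContDiffOn.contDiffOn_deriv_fst {f : (ℝ × ℝ) × ℝ → ℝ} {O : Set ((ℝ × ℝ) × ℝ)}
    (hO : IsOpen O) (hf : ContDiffOn ℝ ∞ f O) :
    ContDiffOn ℝ ∞ (fun r : (ℝ × ℝ) × ℝ => deriv (fun s => f ((s, r.1.2), r.2)) r.1.1) O := by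
  have h : ContDiffOn ℝ ∞ (fun r => fderiv ℝ f r ((1, 0), 0)) O :=
    (hf.fderiv_of_isOpen hO (m := ∞) (by simp)).clm_apply contDiffOn_const
  refine h.congr ?_
  rintro ⟨⟨s, t⟩, ε⟩ hr
  exact (hf.hasDerivAt_fst hO hr).deriv

/-- At ε = 0 the three quantities are 0, 1 and 1, so compactness suffices. The first two bounds
localise and invert W along the half ellipses, with |t| ≤ 2 leaving an open margin around [-1,1];
the third bounds the density of the values along horizontal lines. -/
theorem exists_perturbation_bounds {W : (ℝ × ℝ) × ℝ → ℝ} (hW : ContDiff ℝ ∞ W)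
    (hW0 : ∀ y, W (y, 0) = y.1) : ∃ ε₁ > 0, ∀ ε, |ε| < ε₁ →
      (∀ s v, |s| ≤ 1 → |v| ≤ 2 → |W ((s, v), ε) - s| < 1 / 8) ∧
      (∀ s t, |s| ≤ 5 / 8 → |t| ≤ 2 → 1 / 2 < deriv (fun s => W ((s, t * √(1 - s ^ 2)), ε)) s) ∧
      (∀ s v, |s| ≤ 1 → |v| ≤ 1 → 1 / 2 < deriv (fun s => W ((s, v), ε)) s) := by
  have h1 := IsCompact.eventually_forall_lt (K := Icc (-1 : ℝ) 1 ×ˢ Icc (-2 : ℝ) 2) (c := 1 / 8)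
    (isCompact_Icc.prod isCompact_Icc) isOpen_univ isOpen_univ (mem_univ _) (subset_univ _)
    (g := fun r => |W r - r.1.1|) (by have := hW.continuous; fun_prop) (by simp [hW0])
  have hO : IsOpen ((Ioo (-1 : ℝ) 1 ×ˢ (univ : Set ℝ)) ×ˢ (univ : Set ℝ)) :=
    (isOpen_Ioo.prod isOpen_univ).prod isOpen_univ
  have h2 := IsCompact.eventually_forall_lt (K := Icc (-(5 / 8) : ℝ) (5 / 8) ×ˢ Icc (-2 : ℝ) 2)
    (c := - (1 / 2)) (isCompact_Icc.prod isCompact_Icc) (isOpen_Ioo.prod isOpen_univ) isOpen_univ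
    (mem_univ _) (prod_mono (Icc_subset_Ioo (by norm_num) (by norm_num)) (subset_univ _))
    (g := fun r => - deriv (fun s => W ((s, r.1.2 * √(1 - s ^ 2)), r.2)) r.1.1)
    ((contDiffOn_slice hW).contDiffOn_deriv_fst hO).continuousOn.neg (by simp [hW0]; norm_num)
  have h3 := IsCompact.eventually_forall_lt (K := Icc (-1 : ℝ) 1 ×ˢ Icc (-1 : ℝ) 1)
    (c := - (1 / 2)) (isCompact_Icc.prod isCompact_Icc) isOpen_univ isOpen_univ
    (mem_univ _) (subset_univ _)
    (g := fun r => - deriv (fun s => W ((s, r.1.2), r.2)) r.1.1)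
    (by
      rw [univ_prod_univ]
      exact (hW.contDiffOn.contDiffOn_deriv_fst isOpen_univ).continuousOn.neg)
    (by simp [hW0]; norm_num)
  obtain ⟨ε₁, hε₁, h⟩ := Metric.eventually_nhds_iff.1 (h1.and (h2.and h3))
  refine ⟨ε₁, hε₁, fun ε hε => ?_⟩
  obtain ⟨h1, h2, h3⟩ := h (y := ε) (by simpa using hε)
  refine ⟨fun s v hs hv => h1 (s, v) ⟨abs_le.1 hs, abs_le.1 hv⟩, fun s t hs ht => ?_,
    fun s v hs hv => ?_⟩
  · have := h2 (s, t) ⟨abs_le.1 hs, abs_le.1 ht⟩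
    simp only at this
    linarith
  · have := h3 (s, v) ⟨abs_le.1 hs, abs_le.1 hv⟩
    simp only at this
    linarith

/-- Change of variables along half ellipses: the values of the perturbation near `0` have a smooth
density on each half ellipse, smooth also in the ellipse and in the perturbation parameter. -/
theorem exists_slice_density {W : (ℝ × ℝ) × ℝ → ℝ} (hW : ContDiff ℝ ∞ W)
    {ε₁ : ℝ} (hb : ∀ ε, |ε| < ε₁ →
      (∀ s v, |s| ≤ 1 → |v| ≤ 2 → |W ((s, v), ε) - s| < 1 / 8) ∧
      (∀ s t, |s| ≤ 5 / 8 → |t| ≤ 2 →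
        1 / 2 < deriv (fun s => W ((s, t * √(1 - s ^ 2)), ε)) s)) :
    ∃ r : (ℝ × ℝ) × ℝ → ℝ,
      ContDiffOn ℝ ∞ r ((Ioo (-(1 / 2)) (1 / 2) ×ˢ Ioo (-ε₁) ε₁) ×ˢ Ioo (-2) 2) ∧
      (∀ z ∈ Ioo (-(1 / 2) : ℝ) (1 / 2), ∀ ε ∈ Ioo (-ε₁) ε₁, ∀ t ∈ Ioo (-2 : ℝ) 2,
        0 ≤ r ((z, ε), t)) ∧
      ∀ ε ∈ Ioo (-ε₁) ε₁, ∀ t ∈ Icc (-1 : ℝ) 1, ∀ G : ℝ → ℝ≥0∞,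
        (∀ z, z ∉ Ioo (-(1 / 2)) (1 / 2) → G z = 0) →
        ∫⁻ s in Icc (-1 : ℝ) 1, ENNReal.ofReal √(1 - s ^ 2) * G (W ((s, t * √(1 - s ^ 2)), ε))
          = ∫⁻ z in Ioo (-(1 / 2)) (1 / 2), ENNReal.ofReal (r ((z, ε), t)) * G z := by
  set f : (ℝ × ℝ) × ℝ → ℝ := fun r => W ((r.1.1, r.1.2 * √(1 - r.1.1 ^ 2)), r.2) with hfdef
  set D : (ℝ × ℝ) × ℝ → ℝ := fun r => deriv (fun s => f ((s, r.1.2), r.2)) r.1.1 with hDdef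
  -- 5/8 = 1/2 + 1/8: as W differs from s by less than 1/8, every value in (-1/2, 1/2) is attained,
  -- and only at parameters in this interval.
  set I : Set ℝ := Ioo (-(5 / 8)) (5 / 8) with hIdef
  set N : Set ((ℝ × ℝ) × ℝ) := (Ioo (-(1 / 2)) (1 / 2) ×ˢ Ioo (-ε₁) ε₁) ×ˢ Ioo (-2) 2 with hNdef
  have hO : IsOpen ((Ioo (-1 : ℝ) 1 ×ˢ (univ : Set ℝ)) ×ˢ (univ : Set ℝ)) :=
    (isOpen_Ioo.prod isOpen_univ).prod isOpen_univ
  have hf : ContDiffOn ℝ ∞ f ((Ioo (-1) 1 ×ˢ univ) ×ˢ univ) := contDiffOn_slice hW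
  have hD : ContDiffOn ℝ ∞ D ((Ioo (-1) 1 ×ˢ univ) ×ˢ univ) := hf.contDiffOn_deriv_fst hO
  have hIsub : ∀ s ∈ I, s ∈ Ioo (-1 : ℝ) 1 := fun s hs => ⟨by linarith [hs.1], by linarith [hs.2]⟩
  have hder : ∀ s ∈ Ioo (-1 : ℝ) 1, ∀ t ε, HasDerivAt (fun s => f ((s, t), ε)) (D ((s, t), ε)) s :=
    fun s hs t ε =>
      (hf.hasDerivAt_fst hO ⟨⟨hs, mem_univ t⟩, mem_univ ε⟩).differentiableAt.hasDerivAt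
  have hk1 : ∀ s : ℝ, √(1 - s ^ 2) ≤ 1 := fun s => by
    exact Real.sqrt_le_iff.2 ⟨zero_le_one, by nlinarith [sq_nonneg s]⟩
  have hclose : ∀ s ∈ Icc (-1 : ℝ) 1, ∀ t ∈ Ioo (-2 : ℝ) 2, ∀ ε ∈ Ioo (-ε₁) ε₁,
      |f ((s, t), ε) - s| < 1 / 8 := fun s hs t ht ε hε => by
    refine (hb ε (abs_lt.2 hε)).1 s _ (abs_le.2 hs) ?_
    rw [abs_mul, abs_of_nonneg (Real.sqrt_nonneg _)]
    calc |t| * √(1 - s ^ 2) ≤ 2 * 1 :=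
          mul_le_mul (abs_lt.2 ht).le (hk1 s) (Real.sqrt_nonneg _) (by norm_num)
      _ = 2 := by norm_num
  have hDpos : ∀ s ∈ I, ∀ t ∈ Ioo (-2 : ℝ) 2, ∀ ε ∈ Ioo (-ε₁) ε₁, 1 / 2 < D ((s, t), ε) :=
    fun s hs t ht ε hε => (hb ε (abs_lt.2 hε)).2 s t (abs_lt.2 hs).le (abs_lt.2 ht).le
  have hmono : ∀ t ∈ Ioo (-2 : ℝ) 2, ∀ ε ∈ Ioo (-ε₁) ε₁,
      StrictMonoOn (fun s => f ((s, t), ε)) I := fun t ht ε hε => by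
    refine strictMonoOn_of_deriv_pos (convex_Ioo _ _)
      (fun s hs => (hder s (hIsub s hs) t ε).continuousAt.continuousWithinAt) fun s hs => ?_
    rw [interior_Ioo] at hs
    linarith [hDpos s hs t ht ε hε]
  have hex : ∀ q : (ℝ × ℝ) × ℝ, ∃ s : ℝ, q ∈ N → s ∈ I ∧ f ((s, q.2), q.1.2) = q.1.1 := by
    rintro ⟨⟨z, ε⟩, t⟩
    by_cases hq : ((z, ε), t) ∈ N
    · obtain ⟨⟨hz, hε⟩, ht⟩ := hq
      have hz1 := hz.1
      have hz2 := hz.2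
      have hl := abs_lt.1 (hclose (-(5 / 8)) (by norm_num) t ht ε hε)
      have hr := abs_lt.1 (hclose (5 / 8) (by norm_num) t ht ε hε)
      have := intermediate_value_Ioo (f := fun s => f ((s, t), ε)) (a := -(5 / 8)) (b := 5 / 8)
        (by norm_num) (fun s hs => (hder s ⟨by linarith [hs.1], by linarith [hs.2]⟩ t
          ε).continuousAt.continuousWithinAt)
      obtain ⟨s, hs, hsz⟩ := this (show z ∈ _ from ⟨by linarith, by linarith⟩)
      exact ⟨s, fun _ => ⟨hs, hsz⟩⟩
    · exact ⟨0, fun h => absurd h hq⟩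
  choose a ha using hex
  have hN : IsOpen N := (isOpen_Ioo.prod isOpen_Ioo).prod isOpen_Ioo
  have hac : ContDiffOn ℝ ∞ a N := by
    refine ContDiffOn.of_unique_implicit (I := I)
      (F := fun q => f ((q.2, q.1.2), q.1.1.2) - q.1.1.1) hN isOpen_Ioo ?_ ?_
      (fun q hq => (ha q hq).1) (fun q hq => sub_eq_zero.2 (ha q hq).2) ?_
    · refine (hf.comp (by fun_prop) ?_).sub (by fun_prop)
      rintro ⟨q, s⟩ ⟨hq, hs⟩
      exact ⟨⟨hIsub s hs, mem_univ _⟩, mem_univ _⟩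
    · rintro ⟨⟨z, ε⟩, t⟩ ⟨⟨hz, hε⟩, ht⟩ s hs
      rw [((hder s (hIsub s hs) t ε).sub_const z).deriv]
      linarith [hDpos s hs t ht ε hε]
    · rintro ⟨⟨z, ε⟩, t⟩ hq s hs h
      refine (hmono t hq.2 ε hq.1.2).injOn hs (ha _ hq).1 ?_
      exact (sub_eq_zero.1 h).trans (ha _ hq).2.symm
  -- The density is the Jacobian √(1-s²) of the elliptic coordinates divided by the speed of the
  -- value, both taken at the unique preimage `a q`.
  refine ⟨fun q => √(1 - a q ^ 2) / D ((a q, q.2), q.1.2), ?_, ?_, ?_⟩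
  · refine ContDiffOn.div (ContDiffOn.sqrt (by fun_prop) ?_) (hD.comp (by fun_prop) ?_) ?_
    · intro q hq
      have := hIsub _ (ha q hq).1
      have h1 := this.1
      have h2 := this.2
      nlinarith
    · intro q hq
      exact ⟨⟨hIsub _ (ha q hq).1, mem_univ _⟩, mem_univ _⟩
    · rintro ⟨⟨z, ε⟩, t⟩ hq
      linarith [hDpos _ (ha _ hq).1 t hq.2 ε hq.1.2]
  · intro z hz ε hε t ht
    have := hDpos _ (ha ((z, ε), t) ⟨⟨hz, hε⟩, ht⟩).1 t ht ε hε
    exact div_nonneg (Real.sqrt_nonneg _) (by simp only; linarith)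
  · intro ε hε t ht G hG
    have ht2 : t ∈ Ioo (-2 : ℝ) 2 := ⟨by linarith [ht.1], by linarith [ht.2]⟩
    have hcv := lintegral_image_eq_lintegral_abs_deriv_mul (s := I) measurableSet_Ioo
      (f := fun s => f ((s, t), ε)) (f' := fun s => D ((s, t), ε))
      (fun s hs => (hder s (hIsub s hs) t ε).hasDerivWithinAt) (hmono t ht2 ε hε).injOn
      (fun z => ENNReal.ofReal (√(1 - a ((z, ε), t) ^ 2) / D ((a ((z, ε), t), t), ε)) * G z)
    have hmeasI : MeasurableSet ((fun s => f ((s, t), ε)) '' I) :=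
      (isPreconnected_Ioo.image _ (fun s hs =>
        (hder s (hIsub s hs) t ε).continuousAt.continuousWithinAt)).ordConnected.measurableSet
    have hL : ∫⁻ s in Icc (-1 : ℝ) 1, ENNReal.ofReal √(1 - s ^ 2) * G (f ((s, t), ε))
        = ∫⁻ s in I, ENNReal.ofReal |D ((s, t), ε)| *
          (ENNReal.ofReal (√(1 - a ((f ((s, t), ε), ε), t) ^ 2) /
            D ((a ((f ((s, t), ε), ε), t), t), ε)) * G (f ((s, t), ε))) := by
      rw [← lintegral_indicator measurableSet_Icc, ← lintegral_indicator measurableSet_Ioo]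
      refine lintegral_congr fun s => ?_
      by_cases hs : s ∈ I
      · rw [indicator_of_mem hs, indicator_of_mem (Ioo_subset_Icc_self (hIsub s hs))]
        by_cases hz : f ((s, t), ε) ∈ Ioo (-(1 / 2)) (1 / 2)
        · have hq : ((f ((s, t), ε), ε), t) ∈ N := ⟨⟨hz, hε⟩, ht2⟩
          have has : a ((f ((s, t), ε), ε), t) = s :=
            (hmono t ht2 ε hε).injOn (ha _ hq).1 hs (ha _ hq).2
          have hp := hDpos s hs t ht2 ε hε
          rw [has, ← mul_assoc, ← ENNReal.ofReal_mul (abs_nonneg _), abs_of_pos (by linarith),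
            mul_div_cancel₀ _ (by linarith)]
        · rw [hG _ hz]; simp
      · rw [indicator_of_notMem hs]
        by_cases hs1 : s ∈ Icc (-1 : ℝ) 1
        · rw [indicator_of_mem hs1, hG, mul_zero]
          intro hz
          have h1 := abs_lt.1 (hclose s hs1 t ht2 ε hε)
          exact hs ⟨by linarith [hz.1], by linarith [hz.2]⟩
        · rw [indicator_of_notMem hs1]
    rw [hL, ← hcv, ← lintegral_indicator hmeasI, ← lintegral_indicator measurableSet_Ioo]
    refine lintegral_congr fun z => ?_
    by_cases hz : z ∈ Ioo (-(1 / 2) : ℝ) (1 / 2)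
    · have hq : ((z, ε), t) ∈ N := ⟨⟨hz, hε⟩, ht2⟩
      have h : z ∈ (fun s => f ((s, t), ε)) '' I := ⟨_, (ha _ hq).1, (ha _ hq).2⟩
      rw [indicator_of_mem hz, indicator_of_mem h]
    · rw [indicator_of_notMem hz]
      by_cases h : z ∈ (fun s => f ((s, t), ε)) '' I
      · rw [indicator_of_mem h, hG z hz, mul_zero]
      · rw [indicator_of_notMem h]

/-- The contribution to the energy of the values near `0` is smooth, since their density is. -/
theorem exists_contDiffOn_energy_near {W : (ℝ × ℝ) × ℝ → ℝ} (hW : ContDiff ℝ ∞ W)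
    {ε₁ : ℝ} (hb : ∀ ε, |ε| < ε₁ →
      (∀ s v, |s| ≤ 1 → |v| ≤ 2 → |W ((s, v), ε) - s| < 1 / 8) ∧
      (∀ s t, |s| ≤ 5 / 8 → |t| ≤ 2 →
        1 / 2 < deriv (fun s => W ((s, t * √(1 - s ^ 2)), ε)) s))
    {χ : ℝ → ℝ} (hχ : ContDiff ℝ ∞ χ) (hχc : HasCompactSupport χ)
    (hχs : tsupport χ ⊆ Ioo (-(1 / 4)) (1 / 4)) (hχ0 : ∀ x, 0 ≤ χ x) {p : ℝ} (hp : -1 < p) :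
    ∃ E : ℝ × ℝ → ℝ, ContDiffOn ℝ ∞ E (univ ×ˢ Ioo (-ε₁) ε₁) ∧
      ∀ m, ∀ ε ∈ Ioo (-ε₁) ε₁, 0 ≤ E (m, ε) ∧
        ∫⁻ y in unitDisc, ENNReal.ofReal (χ (W (y, ε))) * penalty p (m - W (y, ε)) =
          ENNReal.ofReal (E (m, ε)) := by
  obtain ⟨r, hr, hr0, hrint⟩ := exists_slice_density hW hb
  set Z : Set ℝ := Ioo (-(1 / 2)) (1 / 2) with hZ
  have hsZ : tsupport χ ⊆ Z := hχs.trans (Ioo_subset_Ioo (by norm_num) (by norm_num))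
  have hχZ : ∀ z, z ∉ Z → χ z = 0 := fun z hz =>
    image_eq_zero_of_notMem_tsupport fun h => hz (hsZ h)
  have hKU : Icc (-1 : ℝ) 1 ⊆ Ioo (-2) 2 := Icc_subset_Ioo (by norm_num) (by norm_num)
  set R : ℝ × ℝ → ℝ := fun q => ∫ t in Icc (-1 : ℝ) 1, r (q, t) with hRdef
  have hR : ContDiffOn ℝ ∞ R (Z ×ˢ Ioo (-ε₁) ε₁) :=
    ContDiffOn.setIntegral_of_isCompact (isOpen_Ioo.prod isOpen_Ioo) isCompact_Icc isOpen_Ioo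
      hKU hr
  have hR0 : ∀ z ∈ Z, ∀ ε ∈ Ioo (-ε₁) ε₁, 0 ≤ R (z, ε) := fun z hz ε hε =>
    setIntegral_nonneg measurableSet_Icc fun t ht => hr0 z hz ε hε t (hKU ht)
  have hg : ContDiffOn ℝ ∞ (fun q : ℝ × ℝ => χ q.2 * R (q.2, q.1)) (Ioo (-ε₁) ε₁ ×ˢ univ) :=
    ContDiffOn.cutoff_mul (f := fun q : ℝ × ℝ => R (q.2, q.1)) isOpen_Ioo isOpen_Ioo hχ hsZ
      (hR.comp (by fun_prop) fun q hq => ⟨hq.2, hq.1⟩)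
  -- All smoothness falls on the density χR; the kernel |x|^p enters only through local
  -- integrability, which is where p > -1 is used.
  have hconv := contDiffOn_convolution_right_with_param (n := ⊤) (μ := volume)
    (ContinuousLinearMap.mul ℝ ℝ) (g := fun ε z => χ z * R (z, ε)) (k := tsupport χ) isOpen_Ioo
    hχc.isCompact (fun ε z _ hz => by simp [image_eq_zero_of_notMem_tsupport hz])
    (by simpa using locallyIntegrable_abs_sub_rpow hp 0) hg
  have hE : ∀ m, ∀ ε, convolution (fun x : ℝ => |x| ^ p) (fun z => χ z * R (z, ε))
      (ContinuousLinearMap.mul ℝ ℝ) volume m = ∫ z, |m - z| ^ p * (χ z * R (z, ε)) := fun m ε => by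
    rw [convolution_def, ← integral_sub_left_eq_self _ _ m]
    simp
  have hpos : ∀ z, ∀ ε ∈ Ioo (-ε₁) ε₁, 0 ≤ χ z * R (z, ε) := fun z ε hε => by
    by_cases hz : z ∈ Z
    · exact mul_nonneg (hχ0 z) (hR0 z hz ε hε)
    · simp [hχZ z hz]
  refine ⟨fun q => ∫ z, |q.1 - z| ^ p * (χ z * R (z, q.2)), ?_, fun m ε hε => ⟨?_, ?_⟩⟩
  · have := hconv.comp (f := fun q : ℝ × ℝ => (q.2, q.1)) (s := univ ×ˢ Ioo (-ε₁) ε₁)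
      (by fun_prop) fun q hq => ⟨hq.2, hq.1⟩
    exact this.congr fun q _ => (hE q.1 q.2).symm
  · exact integral_nonneg fun z => mul_nonneg (Real.rpow_nonneg (abs_nonneg _) _) (hpos z ε hε)
  · have hWm : Measurable fun y => W (y, ε) := (hW.continuous.comp (by fun_prop)).measurable
    have hF : Measurable fun y => ENNReal.ofReal (χ (W (y, ε))) * penalty p (m - W (y, ε)) :=
      (hχ.continuous.measurable.comp hWm).ennreal_ofReal.mul
        ((measurable_penalty p).comp (hWm.const_sub m))
    have hpm := measurable_penalty p
    have hχm : Measurable χ := hχ.continuous.measurable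
    have hcr : ContinuousOn (fun x : ℝ × ℝ => r ((x.2, ε), x.1)) (Icc (-1) 1 ×ˢ Z) :=
      hr.continuousOn.comp (by fun_prop) fun x hx => ⟨⟨hx.2, hε⟩, hKU hx.1⟩
    have hint : Integrable fun z => |m - z| ^ p * (χ z * R (z, ε)) := by
      have h1 : Continuous fun z => χ z * R (z, ε) := by
        have := hg.continuousOn.comp (f := fun z : ℝ => (ε, z)) (s := univ) (by fun_prop)
          fun z _ => ⟨hε, mem_univ _⟩
        exact continuousOn_univ.1 this
      have h2 : HasCompactSupport fun z => χ z * R (z, ε) := hχc.mul_right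
      exact (locallyIntegrable_abs_sub_rpow hp m).integrable_smul_right_of_hasCompactSupport h1 h2
    calc ∫⁻ y in unitDisc, ENNReal.ofReal (χ (W (y, ε))) * penalty p (m - W (y, ε))
        = ∫⁻ t in Icc (-1 : ℝ) 1, ∫⁻ z in Z,
            ENNReal.ofReal (r ((z, ε), t)) * (ENNReal.ofReal (χ z) * penalty p (m - z)) := by
          rw [lintegral_unitDisc_elliptic hF]
          refine setLIntegral_congr_fun measurableSet_Icc fun t ht => ?_
          exact hrint ε hε t ht (fun z => ENNReal.ofReal (χ z) * penalty p (m - z))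
            fun z hz => by simp [hχZ z hz]
      _ = ∫⁻ z in Z, ∫⁻ t in Icc (-1 : ℝ) 1,
            ENNReal.ofReal (r ((z, ε), t)) * (ENNReal.ofReal (χ z) * penalty p (m - z)) := by
          refine lintegral_lintegral_swap ?_
          rw [Measure.prod_restrict]
          refine AEMeasurable.mul ?_ (Measurable.aemeasurable (by fun_prop))
          exact (hcr.aemeasurable (measurableSet_Icc.prod measurableSet_Ioo)).ennreal_ofReal
      _ = ∫⁻ z in Z, ENNReal.ofReal (|m - z| ^ p * (χ z * R (z, ε))) := by
          refine lintegral_congr_ae ?_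
          have hne : ∀ᵐ z ∂(volume.restrict Z), z ≠ m :=
            ae_restrict_of_ae (by simp [ae_iff])
          filter_upwards [hne, ae_restrict_mem measurableSet_Ioo] with z hzm hz
          have hcz : ContinuousOn (fun t : ℝ => r ((z, ε), t)) (Icc (-1) 1) :=
            hr.continuousOn.comp (by fun_prop) fun x hx => ⟨⟨hz, hε⟩, hKU hx⟩
          rw [lintegral_mul_const'' _ (hcz.aemeasurable measurableSet_Icc).ennreal_ofReal,
            ← ofReal_integral_eq_lintegral_ofReal (hcz.integrableOn_compact isCompact_Icc)
              ((ae_restrict_mem measurableSet_Icc).mono fun t ht => hr0 z hz ε hε t (hKU ht)),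
            penalty_of_ne (sub_ne_zero.2 hzm.symm), ← ENNReal.ofReal_mul (hχ0 z),
            ← ENNReal.ofReal_mul (hR0 z hz ε hε)]
          congr 1
          simp only [hRdef]
          ring
      _ = ∫⁻ z, ENNReal.ofReal (|m - z| ^ p * (χ z * R (z, ε))) := by
          rw [← lintegral_indicator measurableSet_Ioo]
          refine lintegral_congr fun z => ?_
          by_cases hz : z ∈ Z
          · rw [indicator_of_mem hz]
          · rw [indicator_of_notMem hz, hχZ z hz]; simp
      _ = ENNReal.ofReal (∫ z, |m - z| ^ p * (χ z * R (z, ε))) := by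
          rw [ofReal_integral_eq_lintegral_ofReal hint (Eventually.of_forall fun z =>
            mul_nonneg (Real.rpow_nonneg (abs_nonneg _) _) (hpos z ε hε))]

/-- The contribution to the energy of the values away from `0` is smooth. -/
theorem exists_contDiffOn_energy_far {W : (ℝ × ℝ) × ℝ → ℝ} (hW : ContDiff ℝ ∞ W)
    {χ : ℝ → ℝ} (hχ : ContDiff ℝ ∞ χ) (hχ1 : ∀ x ∈ Icc (-(1 / 8) : ℝ) (1 / 8), χ x = 1)
    (hχle : ∀ x, χ x ≤ 1) (p : ℝ) :
    ∃ E : ℝ × ℝ → ℝ, ContDiffOn ℝ ∞ E (Ioo (-(1 / 8)) (1 / 8) ×ˢ univ) ∧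
      ∀ m ∈ Ioo (-(1 / 8) : ℝ) (1 / 8), ∀ ε, 0 ≤ E (m, ε) ∧
        ∫⁻ y in unitDisc, ENNReal.ofReal (1 - χ (W (y, ε))) * penalty p (m - W (y, ε)) =
          ENNReal.ofReal (E (m, ε)) := by
  have hΛ : ContDiffOn ℝ ∞ (fun q : ℝ × ℝ => (1 - χ q.2) * |q.1 - q.2| ^ p)
      (Ioo (-(1 / 8)) (1 / 8) ×ˢ univ) := by
    rintro ⟨m, x⟩ ⟨hm, -⟩
    apply ContDiffAt.contDiffWithinAt
    -- At the singularity x = m lies in (-1/8, 1/8), where 1 - χ vanishes identically; off the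
    -- singularity the power is smooth.
    by_cases hx : m - x = 0
    · have hO : IsOpen {q : ℝ × ℝ | q.2 ∈ Ioo (-(1 / 8) : ℝ) (1 / 8)} :=
        isOpen_Ioo.preimage continuous_snd
      have hmx : x = m := by linarith
      refine (contDiffAt_const (c := (0 : ℝ))).congr_of_eventuallyEq ?_
      filter_upwards [hO.mem_nhds (show (m, x) ∈ _ by rw [hmx]; exact hm)] with q hq
      rw [hχ1 _ (Ioo_subset_Icc_self hq)]
      simp
    · have habs : ContDiffAt ℝ ∞ (fun q : ℝ × ℝ => |q.1 - q.2|) (m, x) :=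
        (contDiffAt_abs hx).comp (m, x) (f := fun q : ℝ × ℝ => q.1 - q.2) (by fun_prop)
      refine ContDiffAt.mul ?_ (habs.rpow_const_of_ne (abs_ne_zero.2 hx))
      exact (contDiff_const.sub (hχ.comp contDiff_snd)).contDiffAt
  have hint : ContDiffOn ℝ ∞ (fun q : (ℝ × ℝ) × (ℝ × ℝ) =>
      (1 - χ (W (q.2, q.1.2))) * |q.1.1 - W (q.2, q.1.2)| ^ p)
      ((Ioo (-(1 / 8)) (1 / 8) ×ˢ univ) ×ˢ univ) := by
    refine hΛ.comp (f := fun q : (ℝ × ℝ) × (ℝ × ℝ) => (q.1.1, W (q.2, q.1.2))) ?_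
      fun q hq => ⟨hq.1.1, mem_univ _⟩
    exact (contDiff_fst.fst.prodMk (hW.comp (by fun_prop))).contDiffOn
  refine ⟨fun q => ∫ y in unitDisc, (1 - χ (W (y, q.2))) * |q.1 - W (y, q.2)| ^ p,
    ContDiffOn.setIntegral_of_isCompact (isOpen_Ioo.prod isOpen_univ) isCompact_unitDisc
      isOpen_univ (subset_univ _) hint, fun m hm ε => ?_⟩
  have hnn : ∀ y, 0 ≤ (1 - χ (W (y, ε))) * |m - W (y, ε)| ^ p := fun y =>
    mul_nonneg (sub_nonneg.2 (hχle _)) (Real.rpow_nonneg (abs_nonneg _) _)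
  refine ⟨integral_nonneg hnn, ?_⟩
  have hc : Continuous fun y : ℝ × ℝ => (1 - χ (W (y, ε))) * |m - W (y, ε)| ^ p := by
    have := hint.continuousOn.comp (f := fun y : ℝ × ℝ => ((m, ε), y)) (s := univ) (by fun_prop)
      fun z _ => ⟨⟨hm, mem_univ _⟩, mem_univ _⟩
    exact continuousOn_univ.1 this
  rw [ofReal_integral_eq_lintegral_ofReal (hc.continuousOn.integrableOn_compact
    isCompact_unitDisc) (Eventually.of_forall hnn)]
  refine lintegral_congr fun y => ?_
  by_cases hy : m - W (y, ε) = 0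
  · have : W (y, ε) = m := by linarith
    rw [this, hχ1 m (Ioo_subset_Icc_self hm)]
    simp
  · rw [penalty_of_ne hy, ENNReal.ofReal_mul (sub_nonneg.2 (hχle _))]

/-- For all `p > -1` at once, the order-`p` energy is a smooth function of the value `m` and of the
perturbation parameter near `(0, 0)`. -/
theorem exists_contDiffOn_energy {W : (ℝ × ℝ) × ℝ → ℝ} (hW : ContDiff ℝ ∞ W)
    (hW0 : ∀ y, W (y, 0) = y.1) : ∃ δ > 0, ∀ p : ℝ, -1 < p → ∃ E : ℝ × ℝ → ℝ,
      ContDiffOn ℝ ∞ E (Ioo (-δ) δ ×ˢ Ioo (-δ) δ) ∧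
      ∀ m ∈ Ioo (-δ) δ, ∀ ε ∈ Ioo (-δ) δ, 0 ≤ E (m, ε) ∧
        ∫⁻ y in unitDisc, penalty p (m - W (y, ε)) = ENNReal.ofReal (E (m, ε)) := by
  obtain ⟨ε₁, hε₁, hb⟩ := exists_perturbation_bounds hW hW0
  obtain ⟨χ, hχ, hχc, hχs, hχ1, hχ01⟩ := (isCompact_Icc (a := (-(1 / 8) : ℝ))
    (b := 1 / 8)).exists_contDiff_cutoff (isOpen_Ioo (a := -(1 / 4)) (b := 1 / 4))
    (Icc_subset_Ioo (by norm_num) (by norm_num))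
  refine ⟨min (1 / 8) ε₁, lt_min (by norm_num) hε₁, fun p hp => ?_⟩
  obtain ⟨E₁, hE₁, h₁⟩ := exists_contDiffOn_energy_near hW
    (fun ε hε => ⟨(hb ε hε).1, (hb ε hε).2.1⟩) hχ hχc hχs (fun x => (hχ01 x).1) hp
  obtain ⟨E₂, hE₂, h₂⟩ := exists_contDiffOn_energy_far hW hχ hχ1 (fun x => (hχ01 x).2) p
  have hs1 : Ioo (-(min (1 / 8) ε₁)) (min (1 / 8) ε₁) ⊆ Ioo (-(1 / 8)) (1 / 8) :=
    Ioo_subset_Ioo (neg_le_neg (min_le_left _ _)) (min_le_left _ _)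
  have hs2 : Ioo (-(min (1 / 8) ε₁)) (min (1 / 8) ε₁) ⊆ Ioo (-ε₁) ε₁ :=
    Ioo_subset_Ioo (neg_le_neg (min_le_right _ _)) (min_le_right _ _)
  refine ⟨fun q => E₁ q + E₂ q, (hE₁.mono (prod_mono (subset_univ _) hs2)).add
    (hE₂.mono (prod_mono hs1 (subset_univ _))), fun m hm ε hε => ?_⟩
  obtain ⟨h1, h1'⟩ := h₁ m ε (hs2 hε)
  obtain ⟨h2, h2'⟩ := h₂ m (hs1 hm) ε
  refine ⟨add_nonneg h1 h2, ?_⟩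
  have hWm : Measurable fun y => W (y, ε) := (hW.continuous.comp (by fun_prop)).measurable
  have hpm : Measurable fun y => penalty p (m - W (y, ε)) :=
    (measurable_penalty p).comp (hWm.const_sub m)
  have hχm : Measurable fun y => χ (W (y, ε)) := hχ.continuous.measurable.comp hWm
  have hm : Measurable fun y => ENNReal.ofReal (χ (W (y, ε))) * penalty p (m - W (y, ε)) :=
    hχm.ennreal_ofReal.mul hpm
  rw [ENNReal.ofReal_add h1 h2, ← h1', ← h2', ← lintegral_add_left hm]
  refine lintegral_congr fun y => ?_
  rw [← add_mul, ← ENNReal.ofReal_add (hχ01 _).1 (sub_nonneg.2 (hχ01 _).2)]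
  simp

/-! ### Differentiating moments with a singular kernel -/

/-- For p < 0 the real power is 0 at its pole while the penaliser is ∞. A finite energy forces the
set of poles to be null, so the two conventions agree almost everywhere. -/
theorem integrable_abs_rpow_of_lintegral_penalty {Ω : Type*} [MeasurableSpace Ω] {μ : Measure Ω}
    {w : Ω → ℝ} (hw : Measurable w) {p c m : ℝ} (hc : 0 ≤ c)
    (h : ∫⁻ y, penalty p (m - w y) ∂μ = ENNReal.ofReal c) :
    Integrable (fun y => |m - w y| ^ p) μ ∧ ∫ y, |m - w y| ^ p ∂μ = c := by
  have hm : Measurable fun y => penalty p (m - w y) := (measurable_penalty p).comp (hw.const_sub m)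
  have hlt : ∀ᵐ y ∂μ, penalty p (m - w y) < ⊤ := by
    refine ae_lt_top hm ?_
    rw [h]; exact ENNReal.ofReal_ne_top
  have hae : ∀ᵐ y ∂μ, penalty p (m - w y) = ENNReal.ofReal (|m - w y| ^ p) := by
    filter_upwards [hlt] with y hy
    by_cases h0 : m - w y = 0
    · rcases lt_or_ge p 0 with hp | hp
      · simp [penalty, h0, ENNReal.zero_rpow_of_neg hp] at hy
      · exact ENNReal.ofReal_rpow_of_nonneg (abs_nonneg _) hp
    · exact penalty_of_ne h0
  have hnn : ∀ y, 0 ≤ |m - w y| ^ p := fun y => Real.rpow_nonneg (abs_nonneg _) _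
  rw [lintegral_congr_ae hae] at h
  have hint : Integrable (fun y => |m - w y| ^ p) μ := by
    refine ⟨Measurable.aestronglyMeasurable (by fun_prop), ?_⟩
    rw [hasFiniteIntegral_iff_ofReal (Eventually.of_forall hnn), h]
    exact ENNReal.ofReal_lt_top
  refine ⟨hint, ?_⟩
  rw [← ofReal_integral_eq_lintegral_ofReal hint (Eventually.of_forall hnn)] at h
  exact (ENNReal.ofReal_eq_ofReal_iff (integral_nonneg hnn) hc).1 h

theorem integral_abs_rpow {p : ℝ} (hp : -1 < p) (x : ℝ) :
    ∫ t in (0 : ℝ)..x, |t| ^ p = |x| ^ p * x / (p + 1) := by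
  have key : ∀ c : ℝ, 0 ≤ c → ∫ t in (0 : ℝ)..c, |t| ^ p = |c| ^ p * c / (p + 1) := by
    intro c hc
    have h1 : ∫ t in (0 : ℝ)..c, |t| ^ p = ∫ t in (0 : ℝ)..c, t ^ p := by
      refine intervalIntegral.integral_congr_ae (Eventually.of_forall fun t ht => ?_)
      rw [uIoc_of_le hc] at ht
      rw [abs_of_pos ht.1]
    rw [h1, integral_rpow (Or.inl hp), Real.zero_rpow (by linarith), sub_zero, abs_of_nonneg hc]
    rcases hc.eq_or_lt with h | h
    · simp [← h, Real.zero_rpow (show p + 1 ≠ 0 by linarith)]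
    · rw [Real.rpow_add_one h.ne']
  rcases le_total 0 x with hx | hx
  · exact key x hx
  · have h2 := key (-x) (by linarith)
    have h3 := intervalIntegral.integral_comp_neg (a := 0) (b := x) (fun t : ℝ => |t| ^ p)
    simp only [abs_neg, neg_zero] at h3
    rw [h3, intervalIntegral.integral_symm, h2, abs_neg]
    ring

/-- For negative p, continuity at 0 follows because this is, up to a factor, the primitive of a
locally integrable function. -/
theorem continuous_abs_rpow_mul_self {p : ℝ} (hp : -1 < p) :
    Continuous fun x : ℝ => |x| ^ p * x := by
  have h1 : (fun x : ℝ => |x| ^ p * x) = fun x => (p + 1) * ∫ t in (0 : ℝ)..x, |t| ^ p := by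
    ext x
    rw [integral_abs_rpow hp, mul_div_cancel₀]
    linarith
  rw [h1]
  exact continuous_const.mul (intervalIntegral.continuous_primitive
    (fun a b => intervalIntegrable_abs_rpow hp a b) 0)

theorem hasDerivAt_abs_rpow_mul_self {p x : ℝ} (hp : -1 < p) (hx : x ≠ 0) :
    HasDerivAt (fun x : ℝ => |x| ^ p * x) ((p + 1) * |x| ^ p) x := by
  have h1 : (fun x : ℝ => |x| ^ p * x) = fun x => (p + 1) * ∫ t in (0 : ℝ)..x, |t| ^ p := by
    ext x
    rw [integral_abs_rpow hp, mul_div_cancel₀]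
    linarith
  rw [h1]
  refine HasDerivAt.const_mul _ ?_
  refine intervalIntegral.integral_hasDerivAt_right (intervalIntegrable_abs_rpow hp 0 x) ?_ ?_
  · exact (Measurable.stronglyMeasurable (by fun_prop)).stronglyMeasurableAtFilter
  · exact continuousAt_id.abs.rpow_const (Or.inl (abs_ne_zero.2 hx))

theorem abs_abs_rpow_mul_self_le {p x b : ℝ} (hp : -1 < p) (hx : |x| ≤ b) :
    |(|x| ^ p * x)| ≤ b ^ (p + 1) := by
  rw [abs_mul, abs_of_nonneg (Real.rpow_nonneg (abs_nonneg x) p)]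
  rcases eq_or_ne x 0 with h | h
  · simp only [h, abs_zero, mul_zero]
    exact Real.rpow_nonneg ((abs_nonneg x).trans hx) _
  · rw [← Real.rpow_add_one (abs_ne_zero.2 h)]
    exact Real.rpow_le_rpow (abs_nonneg _) hx (by linarith)

section Moments

variable {Ω : Type*} [MeasurableSpace Ω] {μ : Measure Ω} [IsFiniteMeasure μ] {w : Ω → ℝ}

theorem integrable_abs_rpow_mul_self (hw : Measurable w) {b : ℝ} (hb : ∀ᵐ y ∂μ, |w y| ≤ b)
    {p : ℝ} (hp : -1 < p) (m : ℝ) : Integrable (fun y => |m - w y| ^ p * (m - w y)) μ := by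
  refine Integrable.of_bound (Measurable.aestronglyMeasurable (by fun_prop))
    ((|m| + b) ^ (p + 1)) ?_
  filter_upwards [hb] with y hy
  exact abs_abs_rpow_mul_self_le hp ((abs_sub _ _).trans (by linarith))

theorem integrable_abs_rpow_of_nonneg (hw : Measurable w) {b : ℝ} (hb : ∀ᵐ y ∂μ, |w y| ≤ b)
    {q : ℝ} (hq : 0 ≤ q) (m : ℝ) : Integrable (fun y => |m - w y| ^ q) μ := by
  refine Integrable.of_bound (Measurable.aestronglyMeasurable (by fun_prop)) ((|m| + b) ^ q) ?_
  filter_upwards [hb] with y hy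
  rw [Real.norm_of_nonneg (Real.rpow_nonneg (abs_nonneg _) _)]
  exact Real.rpow_le_rpow (abs_nonneg _) ((abs_sub _ _).trans (by linarith)) hq

/-- The order p+2 exceeds 1, so the differentiated integrand is locally bounded in m and dominated
convergence applies. -/
theorem hasDerivAt_integral_abs_rpow (hw : Measurable w) {b : ℝ} (hb : ∀ᵐ y ∂μ, |w y| ≤ b)
    {p : ℝ} (hp : -1 < p) (m : ℝ) :
    HasDerivAt (fun m => ∫ y, |m - w y| ^ (p + 2) ∂μ)
      ((p + 2) * ∫ y, |m - w y| ^ p * (m - w y) ∂μ) m := by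
  rw [← integral_const_mul]
  have hp2 : 0 ≤ p + 2 := by linarith
  refine (hasDerivAt_integral_of_dominated_loc_of_deriv_le (s := Metric.ball m 1)
    (Metric.ball_mem_nhds m one_pos) (F := fun m y => |m - w y| ^ (p + 2))
    (F' := fun m y => (p + 2) * (|m - w y| ^ p * (m - w y)))
    (bound := fun _ => (p + 2) * (|m| + 1 + b) ^ (p + 1)) ?_
    (integrable_abs_rpow_of_nonneg hw hb hp2 m) ?_ ?_ (integrable_const _) ?_).2
  · exact Eventually.of_forall fun x => Measurable.aestronglyMeasurable (by fun_prop)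
  · exact Measurable.aestronglyMeasurable (by fun_prop)
  · filter_upwards [hb] with y hy x hx
    rw [Metric.mem_ball, Real.dist_eq] at hx
    rw [norm_mul, Real.norm_of_nonneg hp2]
    refine mul_le_mul_of_nonneg_left (abs_abs_rpow_mul_self_le hp ?_) hp2
    have h1 := abs_sub x (w y)
    have h2 := abs_sub_abs_le_abs_sub x m
    linarith
  · refine Eventually.of_forall fun y x _ => ?_
    have := (hasDerivAt_abs_rpow (x - w y) (p := p + 2) (by linarith)).comp x
      ((hasDerivAt_id x).sub_const (w y))
    convert! this using 1
    simp only [mul_one, add_sub_cancel_right]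
    ring

/-- Domination is unavailable here, because for p < 0 the differentiated kernel is unbounded.
Instead the increment is written as an integral in t, Fubini exchanges it with the y-integral, and
continuity of the resulting potential `U` makes the fundamental theorem applicable. -/
theorem hasDerivAt_integral_abs_rpow_mul_self (hw : Measurable w) {b : ℝ}
    (hb : ∀ᵐ y ∂μ, |w y| ≤ b) {p : ℝ} (hp : -1 < p) {J : Set ℝ} (hJ : IsOpen J)
    (hJc : J.OrdConnected) {U : ℝ → ℝ} (hU : ContinuousOn U J)
    (hUint : ∀ m ∈ J, Integrable (fun y => |m - w y| ^ p) μ ∧ ∫ y, |m - w y| ^ p ∂μ = U m)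
    {m₀ : ℝ} (hm₀ : m₀ ∈ J) :
    HasDerivAt (fun m => ∫ y, |m - w y| ^ p * (m - w y) ∂μ) ((p + 1) * U m₀) m₀ := by
  have hp1 : p + 1 ≠ 0 := by linarith
  have hftc : ∀ m y, |m - w y| ^ p * (m - w y) - |m₀ - w y| ^ p * (m₀ - w y)
      = (p + 1) * ∫ t in m₀..m, |t - w y| ^ p := fun m y => by
    have h1 := intervalIntegral.integral_interval_sub_left
      (intervalIntegrable_abs_rpow hp 0 (m - w y)) (intervalIntegrable_abs_rpow hp 0 (m₀ - w y))
    rw [intervalIntegral.integral_comp_sub_right (fun t => |t| ^ p), ← h1, integral_abs_rpow hp,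
      integral_abs_rpow hp]
    field_simp
  have hUi : ∀ m ∈ J, IntervalIntegrable U volume m₀ m := fun m hm =>
    (hU.mono (hJc.uIcc_subset hm₀ hm)).intervalIntegrable
  have hdiff : ∀ m ∈ J, ∫ y, |m - w y| ^ p * (m - w y) ∂μ
      = (∫ y, |m₀ - w y| ^ p * (m₀ - w y) ∂μ) + (p + 1) * ∫ t in m₀..m, U t := by
    intro m hm
    have hsub : ∀ t ∈ uIoc m₀ m, t ∈ J := fun t ht =>
      hJc.uIcc_subset hm₀ hm (uIoc_subset_uIcc ht)
    have hmeas : Measurable fun z : ℝ × Ω => |z.1 - w z.2| ^ p := by fun_prop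
    have hprod : Integrable (fun z : ℝ × Ω => |z.1 - w z.2| ^ p)
        ((volume.restrict (uIoc m₀ m)).prod μ) := by
      rw [integrable_prod_iff hmeas.aestronglyMeasurable]
      constructor
      · filter_upwards [ae_restrict_mem measurableSet_uIoc] with t ht using (hUint t (hsub t ht)).1
      · refine (intervalIntegrable_iff.1 (hUi m hm)).congr ?_
        filter_upwards [ae_restrict_mem measurableSet_uIoc] with t ht
        rw [← (hUint t (hsub t ht)).2]
        refine integral_congr_ae (Eventually.of_forall fun y => ?_)
        exact (Real.norm_of_nonneg (Real.rpow_nonneg (abs_nonneg _) _)).symm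
    have hswap : ∫ t in m₀..m, ∫ y, |t - w y| ^ p ∂μ = ∫ y, (∫ t in m₀..m, |t - w y| ^ p) ∂μ :=
      intervalIntegral_integral_swap hprod
    have hUeq : ∫ t in m₀..m, U t = ∫ t in m₀..m, ∫ y, |t - w y| ^ p ∂μ :=
      intervalIntegral.integral_congr_ae (Eventually.of_forall fun t ht =>
        (hUint t (hsub t ht)).2.symm)
    rw [hUeq, hswap, ← integral_const_mul, ← sub_eq_iff_eq_add',
      ← integral_sub (integrable_abs_rpow_mul_self hw hb hp m)
        (integrable_abs_rpow_mul_self hw hb hp m₀)]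
    exact integral_congr_ae (Eventually.of_forall fun y => hftc m y)
  have hFTC : HasDerivAt (fun m => (∫ y, |m₀ - w y| ^ p * (m₀ - w y) ∂μ)
      + (p + 1) * ∫ t in m₀..m, U t) ((p + 1) * U m₀) m₀ := by
    refine ((intervalIntegral.integral_hasDerivAt_right (hUi m₀ hm₀) ?_
      (hU.continuousAt (hJ.mem_nhds hm₀))).const_mul (p + 1)).const_add _
    exact hU.stronglyMeasurableAtFilter hJ m₀ hm₀
  refine hFTC.congr_of_eventuallyEq ?_
  filter_upwards [hJ.mem_nhds hm₀] with m hm using hdiff m hm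

end Moments

/-! ### Moments of the disc and the differential equation of the semicircle potential -/

theorem integral_linearCombination₃ {Ω : Type*} [MeasurableSpace Ω] {μ : Measure Ω}
    {f g h : Ω → ℝ} (hf : Integrable f μ) (hg : Integrable g μ) (hh : Integrable h μ)
    (a b c : ℝ) : Integrable (fun y => a * f y + b * g y + c * h y) μ ∧
      ∫ y, a * f y + b * g y + c * h y ∂μ
        = a * (∫ y, f y ∂μ) + b * (∫ y, g y ∂μ) + c * ∫ y, h y ∂μ := by
  have h1 : Integrable (fun y => a * f y + b * g y) μ := (hf.const_mul a).add (hg.const_mul b)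
  refine ⟨h1.add (hh.const_mul c), ?_⟩
  rw [integral_add h1 (hh.const_mul c), integral_add (hf.const_mul a) (hg.const_mul b),
    integral_const_mul, integral_const_mul, integral_const_mul]

instance isFiniteMeasure_restrict_unitDisc :
    IsFiniteMeasure ((volume : Measure (ℝ × ℝ)).restrict unitDisc) :=
  ⟨by simpa using isCompact_unitDisc.measure_lt_top⟩

theorem ae_abs_fst_le_one_unitDisc :
    ∀ᵐ y ∂((volume : Measure (ℝ × ℝ)).restrict unitDisc), |y.1| ≤ 1 := by
  filter_upwards [ae_restrict_mem isClosed_unitDisc.measurableSet] with y hy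
  exact abs_le.2 (unitDisc_subset hy).1

theorem setIntegral_unitDisc {H : ℝ × ℝ → ℝ} (hH : IntegrableOn H unitDisc) :
    ∫ y in unitDisc, H y =
      ∫ s in (-1 : ℝ)..1, ∫ v in (-√(1 - s ^ 2))..√(1 - s ^ 2), H (s, v) := by
  have hm := isClosed_unitDisc.measurableSet
  rw [← integral_indicator hm, Measure.volume_eq_prod, integral_prod]
  swap
  · rw [← Measure.volume_eq_prod]; exact hH.integrable_indicator hm
  rw [intervalIntegral.integral_of_le (by norm_num), ← integral_Icc_eq_integral_Ioc,
    ← integral_indicator measurableSet_Icc]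
  refine integral_congr_ae (Eventually.of_forall fun s => ?_)
  simp only
  by_cases hs : s ∈ Icc (-1 : ℝ) 1
  · have hk : 0 ≤ √(1 - s ^ 2) := Real.sqrt_nonneg _
    rw [indicator_of_mem hs, intervalIntegral.integral_of_le (by linarith),
      ← integral_Icc_eq_integral_Ioc, ← integral_indicator measurableSet_Icc]
    refine integral_congr_ae (Eventually.of_forall fun v => ?_)
    simp only [indicator, mem_unitDisc_iff, hs, true_and]
  · rw [indicator_of_notMem hs]
    simp [indicator, mem_unitDisc_iff, hs]

theorem setIntegral_unitDisc_fst {F : ℝ → ℝ} (hF : IntegrableOn (fun y => F y.1) unitDisc) :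
    ∫ y in unitDisc, F y.1 = ∫ s in (-1 : ℝ)..1, F s * (2 * √(1 - s ^ 2)) := by
  rw [setIntegral_unitDisc hF]
  refine intervalIntegral.integral_congr fun s _ => ?_
  simp only [intervalIntegral.integral_const, smul_eq_mul]
  ring

theorem integrableOn_unitDisc_of_continuous {H : ℝ × ℝ → ℝ} (hH : Continuous H) :
    IntegrableOn H unitDisc :=
  hH.continuousOn.integrableOn_compact isCompact_unitDisc

/-- On the vertical chord of half-length k = √(1-s²), the average of v² is k²/3. This is how the
second coordinate is eliminated from the quadratic moments. -/
theorem setIntegral_unitDisc_mul_snd_sq {F : ℝ → ℝ} (hF : Continuous F) :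
    3 * ∫ y in unitDisc, F y.1 * y.2 ^ 2 = ∫ y in unitDisc, F y.1 * (1 - y.1 ^ 2) := by
  rw [setIntegral_unitDisc (integrableOn_unitDisc_of_continuous (by fun_prop)),
    setIntegral_unitDisc_fst (F := fun s => F s * (1 - s ^ 2))
      (integrableOn_unitDisc_of_continuous (by fun_prop)),
    ← intervalIntegral.integral_const_mul]
  refine intervalIntegral.integral_congr fun s hs => ?_
  rw [uIcc_of_le (by norm_num)] at hs
  have h3 : 0 ≤ 1 - s ^ 2 := by nlinarith [hs.1, hs.2]
  have h4 := Real.sq_sqrt h3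
  simp only [intervalIntegral.integral_const_mul, integral_pow]
  push_cast
  linear_combination (2 * F s * √(1 - s ^ 2)) * h4

theorem setIntegral_unitDisc_mul_fst_mul_snd {F : ℝ → ℝ} (hF : Continuous F) :
    ∫ y in unitDisc, F y.1 * (y.1 * y.2) = 0 := by
  rw [setIntegral_unitDisc (integrableOn_unitDisc_of_continuous (by fun_prop))]
  have : ∀ s k : ℝ, ∫ v in -k..k, F s * (s * v) = 0 := fun s k => by
    rw [intervalIntegral.integral_const_mul, intervalIntegral.integral_const_mul, integral_id]
    ring
  simp only [this, intervalIntegral.integral_zero]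

theorem setIntegral_unitDisc_abs_rpow_mul_self {p : ℝ} :
    ∫ y in unitDisc, |0 - y.1| ^ p * (0 - y.1) = 0 := by
  have h := integral_neg_eq_self
    (unitDisc.indicator fun y : ℝ × ℝ => |0 - y.1| ^ p * (0 - y.1)) volume
  have hsymm : ∀ y : ℝ × ℝ, -y ∈ unitDisc ↔ y ∈ unitDisc := fun y => by simp [unitDisc]
  have h2 : (fun y : ℝ × ℝ => unitDisc.indicator (fun y : ℝ × ℝ => |0 - y.1| ^ p * (0 - y.1)) (-y))
      = fun y => - unitDisc.indicator (fun y : ℝ × ℝ => |0 - y.1| ^ p * (0 - y.1)) y := by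
    ext y
    simp only [indicator, hsymm]
    by_cases hy : y ∈ unitDisc
    · simp [hy, (hsymm y).2 hy]
    · simp [hy, mt (hsymm y).1 hy]
  rw [h2, integral_neg, integral_indicator isClosed_unitDisc.measurableSet] at h
  linarith

theorem abs_rpow_add_two {p : ℝ} (hp : -1 < p) (x : ℝ) : |x| ^ (p + 2) = |x| ^ p * x ^ 2 := by
  rcases eq_or_ne x 0 with h | h
  · simp [h, Real.zero_rpow (show p + 2 ≠ 0 by linarith)]
  · rw [Real.rpow_add (abs_pos.2 h), Real.rpow_two, sq_abs]

theorem continuous_abs_sub_rpow_mul_self {p : ℝ} (hp : -1 < p) (m : ℝ) :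
    Continuous fun s => |m - s| ^ p * (m - s) :=
  (continuous_abs_rpow_mul_self hp).comp (continuous_const.sub continuous_id)

/-- Integration by parts against the derivative of `(1 - s ^ 2) ^ (3 / 2)`. -/
theorem integral_abs_rpow_semicircle {p : ℝ} (hp : -1 < p) (m : ℝ) :
    ∫ s in (-1 : ℝ)..1, (p + 1) * (|m - s| ^ p * (1 - s ^ 2) * (2 * √(1 - s ^ 2)))
      + 3 * (|m - s| ^ p * (m - s) * s * (2 * √(1 - s ^ 2))) = 0 := by
  have hc := continuous_abs_sub_rpow_mul_self hp m
  have hi : IntervalIntegrable (fun s => |m - s| ^ p) volume (-1) 1 := by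
    simpa using (intervalIntegrable_abs_rpow hp (m - (-1)) (m - 1)).comp_sub_left m
  -- The antiderivative vanishes at s = ±1 and is continuous everywhere; only at s = m may it fail
  -- to be differentiable, so that point is excepted.
  have h := integral_eq_of_hasDerivAt_off_countable
    (fun s => -2 * (|m - s| ^ p * (m - s) * √(1 - s ^ 2) ^ 3))
    (fun s => (p + 1) * (|m - s| ^ p * (1 - s ^ 2) * (2 * √(1 - s ^ 2)))
      + 3 * (|m - s| ^ p * (m - s) * s * (2 * √(1 - s ^ 2)))) (a := -1) (b := 1)
    (countable_singleton m) ?_ ?_ ?_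
  · rw [h]; simp
  · refine Continuous.continuousOn ?_
    have : Continuous fun s : ℝ => √(1 - s ^ 2) ^ 3 := by fun_prop
    exact continuous_const.mul (hc.mul this)
  · rintro s ⟨hs, hsm⟩
    rw [min_eq_left (by norm_num), max_eq_right (by norm_num)] at hs
    have h1 : 0 < 1 - s ^ 2 := by nlinarith [hs.1, hs.2]
    have hk := Real.sqrt_pos.2 h1
    have hk2 := Real.sq_sqrt h1.le
    have hx : m - s ≠ 0 := sub_ne_zero.2 (fun h => hsm h.symm)
    have hd1 : HasDerivAt (fun s => |m - s| ^ p * (m - s)) ((p + 1) * |m - s| ^ p * (-1)) s :=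
      (hasDerivAt_abs_rpow_mul_self hp hx).comp s ((hasDerivAt_id s).const_sub m)
    have hd2 : HasDerivAt (fun s : ℝ => 1 - s ^ 2) (-(2 * s)) s := by
      simpa using (hasDerivAt_pow 2 s).const_sub 1
    have hd3 := ((hd1.mul ((hd2.sqrt h1.ne').pow 3)).const_mul (-2))
    refine hd3.congr_deriv ?_
    simp only [Pi.pow_apply, Nat.cast_ofNat, Nat.add_one_sub_one]
    generalize √(1 - s ^ 2) = k at hk hk2
    rw [← hk2]
    field_simp
    ring
  · refine IntervalIntegrable.add ?_ (Continuous.intervalIntegrable ?_ _ _)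
    · refine IntervalIntegrable.const_mul ?_ _
      have : Continuous fun s : ℝ => (1 - s ^ 2) * (2 * √(1 - s ^ 2)) := by fun_prop
      simpa only [mul_assoc] using hi.mul_continuousOn this.continuousOn
    · have : Continuous fun s : ℝ => 2 * √(1 - s ^ 2) := by fun_prop
      exact continuous_const.mul ((hc.mul continuous_id).mul this)

/-- The differential equation for the potential of the semicircle law, in terms of moments. -/
theorem moment_relation_unitDisc {p m : ℝ} (hp : -1 < p)
    (hi : IntegrableOn (fun y : ℝ × ℝ => |m - y.1| ^ p) unitDisc) :
    (p + 1) * (1 - m ^ 2) * (∫ y in unitDisc, |m - y.1| ^ p)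
      = (p + 4) * (∫ y in unitDisc, |m - y.1| ^ (p + 2))
        - (2 * p + 5) * m * ∫ y in unitDisc, |m - y.1| ^ p * (m - y.1) := by
  have hM := integrable_abs_rpow_mul_self (μ := (volume : Measure (ℝ × ℝ)).restrict unitDisc)
    measurable_fst ae_abs_fst_le_one_unitDisc hp m
  have hT := integrable_abs_rpow_of_nonneg (μ := (volume : Measure (ℝ × ℝ)).restrict unitDisc)
    measurable_fst ae_abs_fst_le_one_unitDisc (q := p + 2) (by linarith) m
  -- Re-expanding the polynomial weights in powers of m - s turns the integration by parts into a
  -- relation between moments of orders p, p+1 and p+2.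
  have e1 : ∀ y : ℝ × ℝ, |m - y.1| ^ p * (1 - y.1 ^ 2) = (1 - m ^ 2) * |m - y.1| ^ p
      + 2 * m * (|m - y.1| ^ p * (m - y.1)) + (-1) * |m - y.1| ^ (p + 2) := fun y => by
    rw [abs_rpow_add_two hp]; ring
  have e2 : ∀ y : ℝ × ℝ, |m - y.1| ^ p * (m - y.1) * y.1
      = m * (|m - y.1| ^ p * (m - y.1)) + (-1) * |m - y.1| ^ (p + 2)
        + 0 * |m - y.1| ^ (p + 2) := fun y => by
    rw [abs_rpow_add_two hp]; ring
  have hi' : Integrable (fun y : ℝ × ℝ => |m - y.1| ^ p)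
    ((volume : Measure (ℝ × ℝ)).restrict unitDisc) := hi
  have i1 : IntegrableOn (fun y : ℝ × ℝ => |m - y.1| ^ p * (1 - y.1 ^ 2)) unitDisc := by
    simp only [e1]
    exact (integral_linearCombination₃ hi' hM hT _ _ _).1
  have i2 : IntegrableOn (fun y : ℝ × ℝ => |m - y.1| ^ p * (m - y.1) * y.1) unitDisc := by
    simp only [e2]
    exact (integral_linearCombination₃ hM hT hT _ _ _).1
  have s1 := setIntegral_unitDisc_fst (F := fun s => |m - s| ^ p * (1 - s ^ 2)) i1
  have s2 := setIntegral_unitDisc_fst (F := fun s => |m - s| ^ p * (m - s) * s) i2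
  have hi3 : IntervalIntegrable (fun s => |m - s| ^ p) volume (-1) 1 := by
    simpa using (intervalIntegrable_abs_rpow hp (m - (-1)) (m - 1)).comp_sub_left m
  have hc := continuous_abs_sub_rpow_mul_self hp m
  have j1 : IntervalIntegrable (fun s => |m - s| ^ p * (1 - s ^ 2) * (2 * √(1 - s ^ 2)))
      volume (-1) 1 := by
    have : Continuous fun s : ℝ => (1 - s ^ 2) * (2 * √(1 - s ^ 2)) := by fun_prop
    simpa only [mul_assoc] using hi3.mul_continuousOn this.continuousOn
  have j2 : IntervalIntegrable (fun s => |m - s| ^ p * (m - s) * s * (2 * √(1 - s ^ 2)))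
      volume (-1) 1 := by
    have h : Continuous fun s : ℝ => 2 * √(1 - s ^ 2) := by fun_prop
    exact Continuous.intervalIntegrable ((hc.mul continuous_id).mul h) _ _
  have key := integral_abs_rpow_semicircle hp m
  rw [intervalIntegral.integral_add (j1.const_mul _) (j2.const_mul _),
    intervalIntegral.integral_const_mul, intervalIntegral.integral_const_mul, ← s1, ← s2] at key
  simp only [e1, e2] at key
  rw [(integral_linearCombination₃ hi' hM hT _ _ _).2,
    (integral_linearCombination₃ hM hT hT _ _ _).2] at key
  linarith

/-- The quadratic moments of the penaliser derivative over the disc. -/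
theorem quadratic_moment_unitDisc {p : ℝ} (hp : -1 < p) (m α β γ : ℝ) :
    ∫ y in unitDisc, |m - y.1| ^ p * (m - y.1) *
        (α * y.1 ^ 2 + β * (y.1 * y.2) + γ * y.2 ^ 2)
      = (α - γ / 3) * (m ^ 2 * (∫ y in unitDisc, |m - y.1| ^ p * (m - y.1))
          - 2 * m * (∫ y in unitDisc, |m - y.1| ^ (p + 2))
          + ∫ y in unitDisc, |m - y.1| ^ (p + 2) * (m - y.1))
        + γ / 3 * ∫ y in unitDisc, |m - y.1| ^ p * (m - y.1) := by
  have hc : Continuous fun s => |m - s| ^ p * (m - s) :=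
    continuous_abs_sub_rpow_mul_self hp m
  have hc2 : Continuous fun s => |m - s| ^ (p + 2) * (m - s) :=
    continuous_abs_sub_rpow_mul_self (by linarith) m
  have hcT : Continuous fun s : ℝ => |m - s| ^ (p + 2) :=
    (continuous_const.sub continuous_id).abs.rpow_const fun _ => Or.inr (by linarith)
  have hsq := setIntegral_unitDisc_mul_snd_sq hc
  have hmix := setIntegral_unitDisc_mul_fst_mul_snd hc
  have i0 : IntegrableOn (fun y : ℝ × ℝ => |m - y.1| ^ p * (m - y.1)) unitDisc :=
    integrableOn_unitDisc_of_continuous (hc.comp continuous_fst)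
  have iT : IntegrableOn (fun y : ℝ × ℝ => |m - y.1| ^ (p + 2)) unitDisc :=
    integrableOn_unitDisc_of_continuous (hcT.comp continuous_fst)
  have iM : IntegrableOn (fun y : ℝ × ℝ => |m - y.1| ^ (p + 2) * (m - y.1)) unitDisc :=
    integrableOn_unitDisc_of_continuous (hc2.comp continuous_fst)
  have i1 : IntegrableOn (fun y : ℝ × ℝ => |m - y.1| ^ p * (m - y.1) * y.1 ^ 2) unitDisc :=
    integrableOn_unitDisc_of_continuous ((hc.comp continuous_fst).mul (by fun_prop))
  have i2 : IntegrableOn (fun y : ℝ × ℝ => |m - y.1| ^ p * (m - y.1) * (y.1 * y.2)) unitDisc :=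
    integrableOn_unitDisc_of_continuous ((hc.comp continuous_fst).mul (by fun_prop))
  have i3 : IntegrableOn (fun y : ℝ × ℝ => |m - y.1| ^ p * (m - y.1) * y.2 ^ 2) unitDisc :=
    integrableOn_unitDisc_of_continuous ((hc.comp continuous_fst).mul (by fun_prop))
  have e : ∀ y : ℝ × ℝ, |m - y.1| ^ p * (m - y.1) *
      (α * y.1 ^ 2 + β * (y.1 * y.2) + γ * y.2 ^ 2)
      = α * (|m - y.1| ^ p * (m - y.1) * y.1 ^ 2) + β * (|m - y.1| ^ p * (m - y.1) * (y.1 * y.2))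
        + γ * (|m - y.1| ^ p * (m - y.1) * y.2 ^ 2) := fun y => by ring
  have e1 : ∀ y : ℝ × ℝ, |m - y.1| ^ p * (m - y.1) * y.1 ^ 2
      = m ^ 2 * (|m - y.1| ^ p * (m - y.1)) + (-(2 * m)) * |m - y.1| ^ (p + 2)
        + 1 * (|m - y.1| ^ (p + 2) * (m - y.1)) := fun y => by
    rw [abs_rpow_add_two hp]; ring
  have h1 : ∫ y in unitDisc, |m - y.1| ^ p * (m - y.1) * y.1 ^ 2
      = m ^ 2 * (∫ y in unitDisc, |m - y.1| ^ p * (m - y.1))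
          - 2 * m * (∫ y in unitDisc, |m - y.1| ^ (p + 2))
          + ∫ y in unitDisc, |m - y.1| ^ (p + 2) * (m - y.1) := by
    simp only [e1]
    rw [(integral_linearCombination₃ i0 iT iM _ _ _).2]
    ring
  have h2 : ∫ y in unitDisc, |m - y.1| ^ p * (m - y.1) * (1 - y.1 ^ 2)
      = (∫ y in unitDisc, |m - y.1| ^ p * (m - y.1))
        - ∫ y in unitDisc, |m - y.1| ^ p * (m - y.1) * y.1 ^ 2 := by
    rw [← integral_sub i0 i1]
    refine integral_congr_ae (Eventually.of_forall fun y => ?_)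
    simp only
    ring
  simp only [e]
  rw [(integral_linearCombination₃ i1 i2 i3 _ _ _).2, hmix, ← h1]
  rw [h2] at hsq
  linear_combination (γ / 3) * hsq

/-! ### Taylor coefficients of the energy at the origin -/

/-- The partial derivative in the first variable. -/
noncomputable def partialFst (f : ℝ × ℝ → ℝ) : ℝ × ℝ → ℝ := fun q => fderiv ℝ f q (1, 0)

theorem ContDiffOn.partialFst {f : ℝ × ℝ → ℝ} {O : Set (ℝ × ℝ)} (hO : IsOpen O)
    (hf : ContDiffOn ℝ ∞ f O) : ContDiffOn ℝ ∞ (partialFst f) O :=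
  (hf.fderiv_of_isOpen hO (m := ∞) (by simp)).clm_apply contDiffOn_const

theorem ContDiffOn.hasDerivAt_partialFst {f : ℝ × ℝ → ℝ} {O : Set (ℝ × ℝ)} (hO : IsOpen O)
    (hf : ContDiffOn ℝ ∞ f O) {m ε : ℝ} (h : (m, ε) ∈ O) :
    HasDerivAt (fun m => f (m, ε)) (_root_.partialFst f (m, ε)) m := by
  have h1 := ((hf.contDiffAt (hO.mem_nhds h)).differentiableAt (by simp)).hasFDerivAt
  exact h1.comp_hasDerivAt m ((hasDerivAt_id m).prodMk (hasDerivAt_const m ε))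

theorem lintegral_penalty_fst_pos (p m : ℝ) : 0 < ∫⁻ y in unitDisc, penalty p (m - y.1) := by
  have hm : Measurable fun y : ℝ × ℝ => penalty p (m - y.1) :=
    (measurable_penalty p).comp (by fun_prop)
  have hO : IsOpen ({y : ℝ × ℝ | y.1 ^ 2 + y.2 ^ 2 < 1} ∩ {y : ℝ × ℝ | m - y.1 ≠ 0}) :=
    (isOpen_lt (by fun_prop) continuous_const).inter (isOpen_ne_fun (by fun_prop) (by fun_prop))
  have hne : ({y : ℝ × ℝ | y.1 ^ 2 + y.2 ^ 2 < 1} ∩ {y : ℝ × ℝ | m - y.1 ≠ 0}).Nonempty := by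
    by_cases h : m = 0
    · exact ⟨(1 / 2, 0), by norm_num [h]⟩
    · exact ⟨(0, 0), by simp [h]⟩
  rw [lintegral_pos_iff_support hm, Measure.restrict_apply (measurableSet_support hm)]
  refine lt_of_lt_of_le (hO.measure_pos volume hne) (measure_mono fun y hy => ⟨?_,
    show y.1 ^ 2 + y.2 ^ 2 ≤ 1 from le_of_lt hy.1⟩)
  rw [Function.mem_support, penalty_of_ne hy.2]
  exact (ENNReal.ofReal_pos.2 (Real.rpow_pos_of_pos (abs_pos.2 hy.2) _)).ne'

/-- First order dependence of an energy of order above `1` on the perturbation. -/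
theorem hasDerivAt_energy_perturbation {W : (ℝ × ℝ) × ℝ → ℝ} (hW : ContDiff ℝ ∞ W)
    (hW0 : ∀ y, W (y, 0) = y.1) {p : ℝ} (hp : -1 < p) {ψ : ℝ × ℝ → ℝ}
    (hW1 : ∀ y, HasDerivAt (fun ε => W (y, ε)) (ψ y) 0) (m : ℝ) :
    HasDerivAt (fun ε => ∫ y in unitDisc, |m - W (y, ε)| ^ (p + 2))
      (-((p + 2) * ∫ y in unitDisc, |m - y.1| ^ p * (m - y.1) * ψ y)) 0 := by
  set D : (ℝ × ℝ) × ℝ → ℝ := fun r => fderiv ℝ W r ((0, 0), 1) with hD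
  have hDc : Continuous D := (hW.continuous_fderiv (by simp)).clm_apply continuous_const
  have hder : ∀ y ε, HasDerivAt (fun ε => W (y, ε)) (D (y, ε)) ε := fun y ε => by
    have h1 := (hW.differentiable (by simp) (y, ε)).hasFDerivAt
    exact h1.comp_hasDerivAt ε ((hasDerivAt_const ε y).prodMk (hasDerivAt_id ε))
  have hDψ : ∀ y, D (y, 0) = ψ y := fun y => (hder y 0).unique (hW1 y)
  have hWc := hW.continuous
  have hP := continuous_abs_rpow_mul_self hp
  have hF : Continuous fun r : (ℝ × ℝ) × ℝ =>
      -((p + 2) * (|m - W r| ^ p * (m - W r) * D r)) :=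
    (continuous_const.mul ((hP.comp (continuous_const.sub hWc)).mul hDc)).neg
  obtain ⟨b, hb⟩ := (isCompact_unitDisc.prod (isCompact_Icc (a := (-1 : ℝ)) (b := 1)))
    |>.exists_bound_of_continuousOn
    hF.continuousOn
  have hF0 : ∀ ε, Continuous fun y => |m - W (y, ε)| ^ (p + 2) := fun ε =>
    Continuous.rpow_const (by fun_prop) fun _ => Or.inr (by linarith)
  have h := (hasDerivAt_integral_of_dominated_loc_of_deriv_le (s := Ioo (-1 : ℝ) 1)
    (μ := volume.restrict unitDisc) (x₀ := 0)
    (F := fun ε y => |m - W (y, ε)| ^ (p + 2))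
    (F' := fun ε y => -((p + 2) * (|m - W (y, ε)| ^ p * (m - W (y, ε)) * D (y, ε))))
    (Ioo_mem_nhds (by norm_num) (by norm_num)) (bound := fun _ => b)
    (Eventually.of_forall fun ε => (hF0 ε).aestronglyMeasurable)
    (integrableOn_unitDisc_of_continuous (hF0 0))
    (hF.comp (by fun_prop : Continuous fun y : ℝ × ℝ => (y, (0 : ℝ)))).aestronglyMeasurable
    ((ae_restrict_mem isClosed_unitDisc.measurableSet).mono fun y hy ε hε =>
      hb (y, ε) ⟨hy, Ioo_subset_Icc_self hε⟩) (integrable_const _)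
    (Eventually.of_forall fun y ε _ => by
      have h1 := (hasDerivAt_abs_rpow (m - W (y, ε)) (p := p + 2) (by linarith)).comp ε
        ((hder y ε).const_sub m)
      refine h1.congr_deriv ?_
      rw [add_sub_cancel_right]
      ring)).2
  refine h.congr_deriv ?_
  simp only [hW0, hDψ]
  rw [integral_neg, integral_const_mul]

/-- The energy near `(0, 0)` to first order in the perturbation. -/
theorem exists_energy_expansion {W : (ℝ × ℝ) × ℝ → ℝ} (hW : ContDiff ℝ ∞ W)
    (hW0 : ∀ y, W (y, 0) = y.1) {α β γ : ℝ}
    (hW1 : ∀ y : ℝ × ℝ, HasDerivAt (fun ε => W (y, ε))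
      (α * y.1 ^ 2 + β * (y.1 * y.2) + γ * y.2 ^ 2) 0) {p : ℝ} (hp : -1 < p) :
    ∃ δ > 0, ∃ E B : ℝ × ℝ → ℝ, ContDiffOn ℝ ∞ E (Ioo (-δ) δ ×ˢ Ioo (-δ) δ) ∧
      ContDiffOn ℝ ∞ B (Ioo (-δ) δ ×ˢ Ioo (-δ) δ) ∧
      (∀ m ∈ Ioo (-δ) δ, ∀ ε ∈ Ioo (-δ) δ, 0 ≤ E (m, ε) ∧
        ∫⁻ y in unitDisc, penalty p (m - W (y, ε)) = ENNReal.ofReal (E (m, ε))) ∧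
      (∀ m ∈ Ioo (-δ) δ, ∀ ε ∈ Ioo (-δ) δ, E (m, ε) = E (m, 0) + ε * B (m, ε)) ∧
      0 < E (0, 0) ∧ partialFst E (0, 0) = 0 ∧
      partialFst (partialFst E) (0, 0) = p * (p + 2) * E (0, 0) ∧
      partialFst B (0, 0) = -(p * ((p - 1) * α + γ) * E (0, 0)) := by
  obtain ⟨δ, hδ, hall⟩ := exists_contDiffOn_energy hW hW0
  obtain ⟨E, hEs, hE⟩ := hall p hp
  -- `δ` does not depend on the order, so both energies live on the same square. `A` is
  -- differentiated in place of `E`: twice in m it returns (p+2)(p+1)`E`.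
  obtain ⟨A, hAs, hA⟩ := hall (p + 2) (by linarith)
  set J : Set ℝ := Ioo (-δ) δ with hJ
  have hJo : IsOpen J := isOpen_Ioo
  have hO : IsOpen (J ×ˢ J) := hJo.prod hJo
  have h0 : (0 : ℝ) ∈ J := ⟨by linarith, hδ⟩
  have hWm : ∀ ε, Measurable fun y => W (y, ε) := fun ε =>
    (hW.continuous.comp (by fun_prop)).measurable
  have hWb : ∀ ε, ∃ b, ∀ᵐ y ∂(volume.restrict unitDisc), |W (y, ε)| ≤ b := fun ε => by
    obtain ⟨b, hb⟩ := isCompact_unitDisc.exists_bound_of_continuousOn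
      (hW.continuous.comp (by fun_prop : Continuous fun y : ℝ × ℝ => (y, ε))).continuousOn
    exact ⟨b, (ae_restrict_mem isClosed_unitDisc.measurableSet).mono hb⟩
  have hEi : ∀ ε ∈ J, ∀ m ∈ J,
      Integrable (fun y => |m - W (y, ε)| ^ p) (volume.restrict unitDisc) ∧
        ∫ y in unitDisc, |m - W (y, ε)| ^ p = E (m, ε) := fun ε hε m hm =>
    integrable_abs_rpow_of_lintegral_penalty (hWm ε) (hE m hm ε hε).1 (hE m hm ε hε).2
  have hAi : ∀ ε ∈ J, ∀ m ∈ J,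
      Integrable (fun y => |m - W (y, ε)| ^ (p + 2)) (volume.restrict unitDisc) ∧
        ∫ y in unitDisc, |m - W (y, ε)| ^ (p + 2) = A (m, ε) := fun ε hε m hm =>
    integrable_abs_rpow_of_lintegral_penalty (hWm ε) (hA m hm ε hε).1 (hA m hm ε hε).2
  have hslice : ∀ {f : ℝ × ℝ → ℝ}, ContDiffOn ℝ ∞ f (J ×ˢ J) → ∀ ε ∈ J,
      ContinuousOn (fun m => f (m, ε)) J := fun hf ε hε =>
    hf.continuousOn.comp (by fun_prop) fun m hm => ⟨hm, hε⟩
  -- the first moments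
  set M : ℝ → ℝ → ℝ := fun ε m => ∫ y in unitDisc, |m - W (y, ε)| ^ p * (m - W (y, ε)) with hM
  have hA' : ∀ ε ∈ J, ∀ m ∈ J, HasDerivAt (fun m => A (m, ε)) ((p + 2) * M ε m) m := by
    intro ε hε m hm
    obtain ⟨b, hb⟩ := hWb ε
    refine (hasDerivAt_integral_abs_rpow (hWm ε) hb hp m).congr_of_eventuallyEq ?_
    filter_upwards [hJo.mem_nhds hm] with x hx using (hAi ε hε x hx).2.symm
  have hM' : ∀ ε ∈ J, ∀ m ∈ J, HasDerivAt (M ε) ((p + 1) * E (m, ε)) m := by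
    intro ε hε m hm
    obtain ⟨b, hb⟩ := hWb ε
    exact hasDerivAt_integral_abs_rpow_mul_self (hWm ε) hb hp hJo ordConnected_Ioo
      (hslice hEs ε hε) (hEi ε hε) hm
  set M₂ : ℝ → ℝ := fun m => ∫ y in unitDisc, |m - y.1| ^ (p + 2) * (m - y.1) with hM₂
  have hM₂' : ∀ m ∈ J, HasDerivAt M₂ ((p + 3) * A (m, 0)) m := by
    intro m hm
    have := hasDerivAt_integral_abs_rpow_mul_self (μ := volume.restrict unitDisc)
      measurable_fst ae_abs_fst_le_one_unitDisc (p := p + 2) (by linarith) hJo ordConnected_Ioo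
      (hslice hAs 0 h0) (by simpa only [hW0] using hAi 0 h0) hm
    refine this.congr_deriv ?_
    ring
  have hM0 : M 0 0 = 0 := by
    simp only [hM, hW0]
    exact setIntegral_unitDisc_abs_rpow_mul_self
  -- the unperturbed energy
  have hE' : ∀ m ∈ J, ∀ ε ∈ J, HasDerivAt (fun m => E (m, ε)) (partialFst E (m, ε)) m :=
    fun m hm ε hε => hEs.hasDerivAt_partialFst hO ⟨hm, hε⟩
  have hEs' := hEs.partialFst hO
  have hE'' : ∀ m ∈ J, ∀ ε ∈ J, HasDerivAt (fun m => partialFst E (m, ε))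
      (partialFst (partialFst E) (m, ε)) m :=
    fun m hm ε hε => hEs'.hasDerivAt_partialFst hO ⟨hm, hε⟩
  have hode : ∀ m ∈ J, (p + 1) * (1 - m ^ 2) * E (m, 0)
      = (p + 4) * A (m, 0) - (2 * p + 5) * m * M 0 m := fun m hm => by
    rw [← (hEi 0 h0 m hm).2, ← (hAi 0 h0 m hm).2]
    simp only [hM, hW0]
    exact moment_relation_unitDisc hp (by simpa only [hW0, IntegrableOn] using (hEi 0 h0 m hm).1)
  have hone : ∀ m : ℝ, HasDerivAt (fun m : ℝ => 1 - m ^ 2) (-(2 * m)) m := fun m => by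
    simpa using (hasDerivAt_pow 2 m).const_sub 1
  -- Differentiating the relation once leaves a common factor p+1, since (p+4)(p+2) - (2p+5) =
  -- (p+1)(p+3). A second differentiation at 0 gives (p+3)(p+1) - (2p+3) = p(p+2).
  have hode' : ∀ m ∈ J, (1 - m ^ 2) * partialFst E (m, 0)
      = (p + 3) * M 0 m - (2 * p + 3) * (m * E (m, 0)) := fun m hm => by
    have h1 := ((hone m).const_mul (p + 1)).mul (hE' m hm 0 h0)
    have h2 := ((hA' 0 h0 m hm).const_mul (p + 4)).sub
      (((hasDerivAt_id m).const_mul (2 * p + 5)).mul (hM' 0 h0 m hm))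
    have h3 := h1.unique (h2.congr_of_eventuallyEq
      (by filter_upwards [hJo.mem_nhds hm] with x hx using hode x hx))
    have hp1 : p + 1 ≠ 0 := by linarith
    refine mul_left_cancel₀ hp1 ?_
    simp only [id] at h3
    linear_combination h3
  have hE0' : partialFst E (0, 0) = 0 := by
    have := hode' 0 h0
    rw [hM0] at this
    simpa using this
  have hE0'' : partialFst (partialFst E) (0, 0) = p * (p + 2) * E (0, 0) := by
    have h1 := (hone 0).mul (hE'' 0 h0 0 h0)
    have h2 := ((hM' 0 h0 0 h0).const_mul (p + 3)).sub
      (((hasDerivAt_id (0 : ℝ)).mul (hE' 0 h0 0 h0)).const_mul (2 * p + 3))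
    have h3 := h1.unique (h2.congr_of_eventuallyEq
      (by filter_upwards [hJo.mem_nhds h0] with x hx using hode' x hx))
    simp only [id] at h3
    linear_combination h3
  -- the first order term in the perturbation
  obtain ⟨A₁, hA₁s, hA₁, hA₁0⟩ := hAs.exists_hadamard hJo hJo (convex_Ioo _ _) h0
  have hA₁' : ∀ m ∈ J, ∀ ε ∈ J, HasDerivAt (fun m => A₁ (m, ε)) (partialFst A₁ (m, ε)) m :=
    fun m hm ε hε => hA₁s.hasDerivAt_partialFst hO ⟨hm, hε⟩
  have hA₁s' := hA₁s.partialFst hO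
  have hA₁'' : ∀ m ∈ J, ∀ ε ∈ J, HasDerivAt (fun m => partialFst A₁ (m, ε))
      (partialFst (partialFst A₁) (m, ε)) m :=
    fun m hm ε hε => hA₁s'.hasDerivAt_partialFst hO ⟨hm, hε⟩
  have hA₁s'' := hA₁s'.partialFst hO
  have hexp1 : ∀ m ∈ J, ∀ ε ∈ J,
      (p + 2) * M ε m = (p + 2) * M 0 m + ε * partialFst A₁ (m, ε) := fun m hm ε hε =>
    (hA' ε hε m hm).unique
      (((hA' 0 h0 m hm).add ((hA₁' m hm ε hε).const_mul ε)).congr_of_eventuallyEq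
      (by filter_upwards [hJo.mem_nhds hm] with x hx using hA₁ x hx ε hε))
  have hexp2 : ∀ m ∈ J, ∀ ε ∈ J, (p + 2) * ((p + 1) * E (m, ε))
      = (p + 2) * ((p + 1) * E (m, 0)) + ε * partialFst (partialFst A₁) (m, ε) :=
    fun m hm ε hε => ((hM' ε hε m hm).const_mul (p + 2)).unique
      ((((hM' 0 h0 m hm).const_mul (p + 2)).add
        ((hA₁'' m hm ε hε).const_mul ε)).congr_of_eventuallyEq
      (by filter_upwards [hJo.mem_nhds hm] with x hx using hexp1 x hx ε hε))
  have hp1 : p + 1 ≠ 0 := by linarith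
  have hp2 : p + 2 ≠ 0 := by linarith
  have hA₁v : ∀ m ∈ J, A₁ (m, 0) = -((p + 2) * ((α - γ / 3) *
      (m ^ 2 * M 0 m - 2 * m * A (m, 0) + M₂ m) + γ / 3 * M 0 m)) := fun m hm => by
    have h1 := hasDerivAt_energy_perturbation hW hW0 hp hW1 m
    rw [quadratic_moment_unitDisc hp] at h1
    have h2 := (hA₁0 m hm).unique (h1.congr_of_eventuallyEq
      (by filter_upwards [hJo.mem_nhds h0] with ε hε using (hAi ε hε m hm).2.symm))
    rw [h2, ← (hAi 0 h0 m hm).2]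
    simp only [hM, hM₂, hW0]
  have hA₁v' : ∀ m ∈ J, partialFst A₁ (m, 0) = -((p + 2) * (p + 1) * ((α - γ / 3) *
      (A (m, 0) - 2 * (m * M 0 m) + m ^ 2 * E (m, 0)) + γ / 3 * E (m, 0))) := fun m hm => by
    have h1 := ((((((hasDerivAt_pow 2 m).mul (hM' 0 h0 m hm)).sub
      (((hasDerivAt_id m).const_mul 2).mul (hA' 0 h0 m hm))).add (hM₂' m hm)).const_mul
        (α - γ / 3)).add ((hM' 0 h0 m hm).const_mul (γ / 3))).const_mul (p + 2) |>.neg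
    have h2 := (hA₁' m hm 0 h0).unique (h1.congr_of_eventuallyEq
      (by filter_upwards [hJo.mem_nhds hm] with x hx using hA₁v x hx))
    rw [h2]
    simp only [id]
    push_cast
    ring
  have hA₁v'' : ∀ m ∈ J, partialFst (partialFst A₁) (m, 0) = -((p + 2) * (p + 1) *
      ((α - γ / 3) * (p * M 0 m - 2 * p * (m * E (m, 0)) + m ^ 2 * partialFst E (m, 0))
        + γ / 3 * partialFst E (m, 0))) := fun m hm => by
    have h1 := (((((hA' 0 h0 m hm).sub (((hasDerivAt_id m).mul (hM' 0 h0 m hm)).const_mul 2)).add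
      ((hasDerivAt_pow 2 m).mul (hE' m hm 0 h0))).const_mul (α - γ / 3)).add
        ((hE' m hm 0 h0).const_mul (γ / 3))).const_mul ((p + 2) * (p + 1)) |>.neg
    have h2 := (hA₁'' m hm 0 h0).unique (h1.congr_of_eventuallyEq
      (by filter_upwards [hJo.mem_nhds hm] with x hx using hA₁v' x hx))
    rw [h2]
    simp only [id]
    push_cast
    ring
  -- Two m-derivatives of the Hadamard remainder of `A` give the remainder of `E`, without
  -- differentiating the singular integrand in ε.
  refine ⟨δ, hδ, E, fun q => ((p + 2) * (p + 1))⁻¹ * partialFst (partialFst A₁) q, hEs,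
    contDiffOn_const.mul hA₁s'', hE, fun m hm ε hε => ?_, ?_, hE0', hE0'', ?_⟩
  · have := hexp2 m hm ε hε
    field_simp
    linear_combination this
  · have h1 := lintegral_penalty_fst_pos p 0
    have h2 := (hE 0 h0 0 h0).2
    simp only [hW0] at h2
    rw [h2] at h1
    exact ENNReal.ofReal_pos.1 h1
  · have hBs := (contDiffOn_const (c := ((p + 2) * (p + 1))⁻¹)).mul hA₁s''
    have h1 := hBs.hasDerivAt_partialFst hO (m := 0) (ε := 0) ⟨h0, h0⟩
    have h2 := ((((((hM' 0 h0 0 h0).const_mul p).sub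
      (((hasDerivAt_id (0 : ℝ)).mul (hE' 0 h0 0 h0)).const_mul (2 * p))).add
      ((hasDerivAt_pow 2 (0 : ℝ)).mul (hE'' 0 h0 0 h0))).const_mul (α - γ / 3)).add
        ((hE'' 0 h0 0 h0).const_mul (γ / 3))).neg
    have h3 := h1.unique (h2.congr_of_eventuallyEq
      (by
        filter_upwards [hJo.mem_nhds h0] with x hx
        rw [hA₁v'' x hx]
        simp only [Pi.add_apply, Pi.sub_apply, Pi.mul_apply, Pi.neg_apply, id]
        field_simp))
    refine h3.trans ?_
    simp only [id, hE0', hE0'']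
    push_cast
    ring

/-! ### Uniform exclusion of large deviations -/

/-- Averages over translated discs of a function increasing in `|x|` increase with the size of the
translation. -/
theorem setIntegral_unitDisc_mono_of_abs_le {h : ℝ → ℝ} (hc : Continuous h)
    (hmono : ∀ x y, |x| ≤ |y| → h x ≤ h y) {m m' : ℝ} (hm : |m| ≤ |m'|) :
    ∫ y in unitDisc, h (m - y.1) ≤ ∫ y in unitDisc, h (m' - y.1) := by
  set k : ℝ → ℝ := fun s => 2 * √(1 - s ^ 2) with hk
  have hkc : Continuous k := by fun_prop
  have hk0 : ∀ s, s ∉ Icc (-1 : ℝ) 1 → k s = 0 := fun s hs => by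
    have : 1 - s ^ 2 ≤ 0 := by
      by_contra! h1
      exact hs (abs_le.1 ((sq_le_one_iff_abs_le_one s).1 (by linarith)))
    simp [hk, Real.sqrt_eq_zero_of_nonpos this]
  have hks : HasCompactSupport k := HasCompactSupport.intro isCompact_Icc hk0
  have hint : ∀ (f : ℝ → ℝ) (a : ℝ), Continuous f → Integrable fun x => f x * k (a - x) :=
    fun f a hf => by
      have h1 : HasCompactSupport fun x => k (a - x) := hks.comp_homeomorph (Homeomorph.subLeft a)
      exact (hf.mul (by fun_prop)).integrable_of_hasCompactSupport h1.mul_left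
  have hrep : ∀ a, ∫ y in unitDisc, h (a - y.1) = ∫ x, h x * k (a - x) := fun a => by
    rw [setIntegral_unitDisc_fst (F := fun s => h (a - s))
      (integrableOn_unitDisc_of_continuous (by fun_prop)),
      intervalIntegral.integral_of_le (by norm_num), ← integral_Icc_eq_integral_Ioc,
      ← integral_sub_left_eq_self _ volume a, setIntegral_eq_integral_of_forall_compl_eq_zero]
    · simp [hk]
    · intro s hs
      have := hk0 s hs
      simp only [hk] at this
      rw [this, mul_zero]
  have hrefl : ∀ a b, a + b = m + m' →
      ∫ x, h x * k (a - x) = ∫ x, h (m + m' - x) * k (b - x) := fun a b hab => by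
    rw [← integral_sub_left_eq_self _ volume (m + m')]
    refine integral_congr_ae (Eventually.of_forall fun x => ?_)
    have : k (a - (m + m' - x)) = k (b - x) := by
      simp only [hk]
      congr 3
      have : a - (m + m' - x) = -(b - x) := by linarith
      rw [this]; ring
    simp only [this]
  have hc' : Continuous fun x => h (m + m' - x) := by fun_prop
  -- The reflection x ↦ m + m' - x exchanges the two centres, so this integral is twice the desired
  -- difference. Its integrand is a product of two factors of equal sign: one compares |x| with its
  -- reflection, the other compares the distances to the two centres.
  have hkey : 0 ≤ ∫ x, (h x * k (m' - x) - h x * k (m - x))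
      + (h (m + m' - x) * k (m - x) - h (m + m' - x) * k (m' - x)) := by
    refine integral_nonneg fun x => ?_
    have hfac : (h x * k (m' - x) - h x * k (m - x))
      + (h (m + m' - x) * k (m - x) - h (m + m' - x) * k (m' - x))
      = (h x - h (m + m' - x)) * (k (m' - x) - k (m - x)) := by ring
    rw [Pi.zero_apply, hfac]
    have hkm : ∀ a b : ℝ, a ^ 2 ≤ b ^ 2 → k b ≤ k a := fun a b hab =>
      mul_le_mul_of_nonneg_left (Real.sqrt_le_sqrt (by linarith)) (by norm_num)
    have hm2 : m ^ 2 ≤ m' ^ 2 := sq_le_sq.2 hm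
    have hab : 0 ≤ (x ^ 2 - (m + m' - x) ^ 2) * ((m - x) ^ 2 - (m' - x) ^ 2) := by
      have : (x ^ 2 - (m + m' - x) ^ 2) * ((m - x) ^ 2 - (m' - x) ^ 2)
        = (m' ^ 2 - m ^ 2) * (2 * x - m - m') ^ 2 := by ring
      rw [this]
      exact mul_nonneg (by linarith) (sq_nonneg _)
    rcases lt_trichotomy (x ^ 2) ((m + m' - x) ^ 2) with h1 | h1 | h1
    · have h2 : (m - x) ^ 2 ≤ (m' - x) ^ 2 := by nlinarith
      exact mul_nonneg_of_nonpos_of_nonpos (sub_nonpos.2 (hmono _ _ (sq_le_sq.1 h1.le)))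
        (sub_nonpos.2 (hkm _ _ h2))
    · rw [le_antisymm (hmono _ _ (sq_le_sq.1 h1.le)) (hmono _ _ (sq_le_sq.1 h1.ge)), sub_self,
        zero_mul]
    · have h2 : (m' - x) ^ 2 ≤ (m - x) ^ 2 := by nlinarith
      exact mul_nonneg (sub_nonneg.2 (hmono _ _ (sq_le_sq.1 h1.le))) (sub_nonneg.2 (hkm _ _ h2))
  have i1 : Integrable fun x => h x * k (m' - x) - h x * k (m - x) :=
    (hint h m' hc).sub (hint h m hc)
  have i2 : Integrable fun x => h (m + m' - x) * k (m - x) - h (m + m' - x) * k (m' - x) :=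
    (hint _ m hc').sub (hint _ m' hc')
  rw [integral_add i1 i2, integral_sub (hint h m' hc) (hint h m hc),
    integral_sub (hint _ m hc') (hint _ m' hc'), ← hrefl m' m (by ring), ← hrefl m m' (by ring),
    ← hrep, ← hrep] at hkey
  linarith

/-- The penaliser with its argument clamped to `[κ, 3]`. -/
noncomputable def clampedPenalty (p κ x : ℝ) : ℝ := (max κ (min |x| 3)) ^ p

theorem uniformContinuous_clampedPenalty {p κ : ℝ} (hκ3 : κ ≤ 3)
    (hκ : 0 < κ ∨ 0 ≤ p) : UniformContinuous (clampedPenalty p κ) := by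
  have h1 : UniformContinuousOn (fun t : ℝ => t ^ p) (Icc κ 3) := by
    refine isCompact_Icc.uniformContinuousOn_of_continuous ?_
    refine continuousOn_id.rpow_const fun t ht => ?_
    rcases hκ with h | h
    · exact Or.inl (by have := ht.1; simp only [id]; linarith)
    · exact Or.inr h
  have h2 : UniformContinuous fun x : ℝ => max κ (min |x| 3) := by
    have : LipschitzWith 1 fun x : ℝ => max κ (min |x| 3) :=
      ((lipschitzWith_one_norm (E := ℝ)).min_const 3).const_max κ
    exact this.uniformContinuous
  rw [← uniformContinuousOn_univ] at h2 ⊢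
  exact h1.comp h2 fun x _ => ⟨le_max_left _ _, max_le hκ3 (min_le_right _ _)⟩

/-- Under a small perturbation the clamped energies converge uniformly in `m`. -/
theorem eventually_abs_setIntegral_sub_le {W : (ℝ × ℝ) × ℝ → ℝ} (hW : Continuous W)
    (hW0 : ∀ y, W (y, 0) = y.1) {h : ℝ → ℝ} (hu : UniformContinuous h) {d : ℝ} (hd : 0 < d) :
    ∀ᶠ ε in 𝓝 (0 : ℝ), ∀ m,
      |(∫ y in unitDisc, h (m - W (y, ε))) - ∫ y in unitDisc, h (m - y.1)| ≤ d := by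
  set V : ℝ := (volume : Measure (ℝ × ℝ)).real unitDisc with hV
  have hV0 : 0 ≤ V := measureReal_nonneg
  obtain ⟨ρ, hρ, hh⟩ := Metric.uniformContinuous_iff.1 hu (d / (V + 1)) (by positivity)
  have hev := IsCompact.eventually_forall_lt (K := unitDisc) (c := ρ) isCompact_unitDisc
    isOpen_univ isOpen_univ (mem_univ _) (subset_univ _) (g := fun r => |r.1.1 - W r|)
    (by fun_prop) (by simp [hW0, hρ])
  filter_upwards [hev] with ε hε m
  have hc := hu.continuous
  rw [← integral_sub (integrableOn_unitDisc_of_continuous (by fun_prop))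
    (integrableOn_unitDisc_of_continuous (by fun_prop))]
  have := norm_setIntegral_le_of_norm_le_const (μ := volume) (C := d / (V + 1))
    isCompact_unitDisc.measure_lt_top
    (f := fun y => h (m - W (y, ε)) - h (m - y.1)) fun y hy => by
      have := hh (a := m - W (y, ε)) (b := m - y.1) (by
        rw [Real.dist_eq]
        have := hε y hy
        rwa [show m - W (y, ε) - (m - y.1) = y.1 - W (y, ε) by ring])
      exact this.le
  refine this.trans ?_
  rw [← hV, div_mul_eq_mul_div, div_le_iff₀ (by linarith)]
  nlinarith

/-- For `p > 0` large deviations have uniformly large energy. -/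
theorem eventually_le_lintegral_penalty {W : (ℝ × ℝ) × ℝ → ℝ} (hW : Continuous W)
    (hW0 : ∀ y, W (y, 0) = y.1) {p : ℝ} (hp : 0 < p) {m₁ c : ℝ} (hm₁ : 0 ≤ m₁) (hm₁2 : m₁ ≤ 2)
    (hc : c < ∫ y in unitDisc, |m₁ - y.1| ^ p) :
    ∀ᶠ ε in 𝓝 (0 : ℝ), ∀ m, m₁ ≤ |m| →
      ENNReal.ofReal c ≤ ∫⁻ y in unitDisc, penalty p (m - W (y, ε)) := by
  -- The upper clamp makes the penaliser uniformly continuous and bounds the energy from below. It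
  -- is inactive at `m₁`, since |m₁ - s| ≤ 3 when 0 ≤ m₁ ≤ 2 and |s| ≤ 1.
  set h := clampedPenalty p 0 with hh
  have hu : UniformContinuous h :=
    uniformContinuous_clampedPenalty (by norm_num) (Or.inr hp.le)
  have hcl : ∀ x : ℝ, max 0 (min |x| 3) = min |x| 3 := fun x =>
    max_eq_right (le_min (abs_nonneg x) (by norm_num))
  have hle : ∀ x, h x ≤ |x| ^ p := fun x => by
    simp only [hh, clampedPenalty, hcl]
    exact Real.rpow_le_rpow (le_min (abs_nonneg x) (by norm_num)) (min_le_left _ _) hp.le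
  have hnn : ∀ x, 0 ≤ h x := fun x => Real.rpow_nonneg (le_max_left _ _) _
  have hmono : ∀ x y, |x| ≤ |y| → h x ≤ h y := fun x y hxy => by
    simp only [hh, clampedPenalty, hcl]
    exact Real.rpow_le_rpow (le_min (abs_nonneg x) (by norm_num)) (min_le_min_right _ hxy) hp.le
  have heq : ∫ y in unitDisc, h (m₁ - y.1) = ∫ y in unitDisc, |m₁ - y.1| ^ p := by
    refine setIntegral_congr_fun isClosed_unitDisc.measurableSet fun y hy => ?_
    have h1 := (unitDisc_subset hy).1
    have : |m₁ - y.1| ≤ 3 := abs_le.2 ⟨by linarith [h1.2], by linarith [h1.1]⟩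
    simp only [hh, clampedPenalty, min_eq_left this, max_eq_right (abs_nonneg (m₁ - y.1))]
  filter_upwards [eventually_abs_setIntegral_sub_le hW hW0 hu (sub_pos.2 hc)] with ε hε m hm
  have hcont := hu.continuous
  have h1 := (abs_le.1 (hε m)).1
  have h2 := setIntegral_unitDisc_mono_of_abs_le hcont hmono (m := m₁) (m' := m)
    (by rwa [abs_of_nonneg hm₁])
  rw [heq] at h2
  calc ENNReal.ofReal c ≤ ENNReal.ofReal (∫ y in unitDisc, h (m - W (y, ε))) :=
        ENNReal.ofReal_le_ofReal (by linarith)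
    _ = ∫⁻ y in unitDisc, ENNReal.ofReal (h (m - W (y, ε))) :=
        ofReal_integral_eq_lintegral_ofReal (integrableOn_unitDisc_of_continuous (by fun_prop))
          (Eventually.of_forall fun y => hnn _)
    _ ≤ ∫⁻ y in unitDisc, penalty p (m - W (y, ε)) := lintegral_mono fun y => by
        rw [penalty, ENNReal.ofReal_rpow_of_nonneg (abs_nonneg _) hp.le]
        exact ENNReal.ofReal_le_ofReal (hle _)

/-- Values of a perturbation of the first coordinate have density at most `4` on the disc. -/
theorem lintegral_unitDisc_comp_le {W : (ℝ × ℝ) × ℝ → ℝ} (hW : ContDiff ℝ ∞ W) {ε : ℝ}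
    (hd : ∀ s v, |s| ≤ 1 → |v| ≤ 1 → 1 / 2 < deriv (fun s => W ((s, v), ε)) s)
    {G : ℝ → ℝ≥0∞} (hG : Measurable G) : ∫⁻ y in unitDisc, G (W (y, ε)) ≤ 4 * ∫⁻ z, G z := by
  have hWm : Measurable fun y => W (y, ε) := (hW.continuous.comp (by fun_prop)).measurable
  have hGW : Measurable fun y => G (W (y, ε)) := hG.comp hWm
  have hder : ∀ s v, HasDerivAt (fun s => W ((s, v), ε)) (deriv (fun s => W ((s, v), ε)) s) s :=
    fun s v => (hW.contDiffOn.hasDerivAt_fst isOpen_univ (mem_univ _)).differentiableAt.hasDerivAt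
  -- One factor 2 is the reciprocal of the slope bound 1/2; the other, below, is the length of the
  -- range of v.
  have hslice : ∀ v ∈ Icc (-1 : ℝ) 1,
      ∫⁻ s in Icc (-1 : ℝ) 1, G (W ((s, v), ε)) ≤ 2 * ∫⁻ z, G z := fun v hv => by
    have hinj : InjOn (fun s => W ((s, v), ε)) (Icc (-1) 1) := by
      refine (strictMonoOn_of_deriv_pos (convex_Icc _ _)
        (fun s _ => (hder s v).continuousAt.continuousWithinAt) fun s hs => ?_).injOn
      have := hd s v (abs_le.2 (interior_subset (s := Icc (-1 : ℝ) 1) hs)) (abs_le.2 hv)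
      linarith
    have hcv := lintegral_image_eq_lintegral_abs_deriv_mul measurableSet_Icc
      (fun s _ => (hder s v).hasDerivWithinAt) hinj G
    calc ∫⁻ s in Icc (-1 : ℝ) 1, G (W ((s, v), ε))
        ≤ ∫⁻ s in Icc (-1 : ℝ) 1,
            2 * (ENNReal.ofReal |deriv (fun s => W ((s, v), ε)) s| * G (W ((s, v), ε))) := by
          refine setLIntegral_mono' measurableSet_Icc fun s hs => ?_
          have h1 := hd s v (abs_le.2 hs) (abs_le.2 hv)
          have h2 : (1 : ℝ≥0∞) ≤ 2 * ENNReal.ofReal |deriv (fun s => W ((s, v), ε)) s| := by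
            rw [← ENNReal.ofReal_ofNat, ← ENNReal.ofReal_mul (by norm_num), ← ENNReal.ofReal_one]
            refine ENNReal.ofReal_le_ofReal ?_
            rw [abs_of_pos (by linarith)]
            linarith
          rw [← mul_assoc]
          exact le_mul_of_one_le_left' h2
      _ = 2 * ∫⁻ z in (fun s => W ((s, v), ε)) '' Icc (-1) 1, G z := by
          rw [lintegral_const_mul' _ _ (by norm_num), hcv]
      _ ≤ 2 * ∫⁻ z, G z := by gcongr; exact Measure.restrict_le_self
  calc ∫⁻ y in unitDisc, G (W (y, ε))
      ≤ ∫⁻ y in Icc (-1 : ℝ) 1 ×ˢ Icc (-1 : ℝ) 1, G (W (y, ε)) :=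
        lintegral_mono_set unitDisc_subset
    _ = ∫⁻ v in Icc (-1 : ℝ) 1, ∫⁻ s in Icc (-1 : ℝ) 1, G (W ((s, v), ε)) := by
        rw [Measure.volume_eq_prod, ← Measure.prod_restrict, lintegral_prod_symm' _ hGW]
    _ ≤ ∫⁻ v in Icc (-1 : ℝ) 1, 2 * ∫⁻ z, G z := setLIntegral_mono' measurableSet_Icc hslice
    _ = 4 * ∫⁻ z, G z := by
        rw [setLIntegral_const, Real.volume_Icc]
        norm_num
        ring

/-- The penaliser has little mass near its pole. -/
theorem exists_lintegral_indicator_penalty_lt {p : ℝ} (hp : -1 < p) {d : ℝ≥0∞} (hd : d ≠ 0) :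
    ∃ κ > 0, κ ≤ 1 ∧ ∫⁻ z, (Ioo (-κ) κ).indicator (penalty p) z < d := by
  have hfin : ∫⁻ z in Icc (-1 : ℝ) 1, penalty p z ≠ ⊤ := by
    have h1 : IntegrableOn (fun z : ℝ => |z| ^ p) (Icc (-1) 1) := by
      rw [← intervalIntegrable_iff_integrableOn_Icc_of_le (by norm_num)]
      exact intervalIntegrable_abs_rpow hp _ _
    have h2 : ∫⁻ z in Icc (-1 : ℝ) 1, penalty p z
        = ∫⁻ z in Icc (-1 : ℝ) 1, ENNReal.ofReal (|z| ^ p) := by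
      refine lintegral_congr_ae (ae_restrict_of_ae ?_)
      have : ∀ᵐ z : ℝ, z ≠ 0 := by simp [ae_iff]
      filter_upwards [this] with z hz using penalty_of_ne hz
    rw [h2]
    exact h1.lintegral_lt_top.ne
  obtain ⟨η, hη, h⟩ := exists_pos_setLIntegral_lt_of_measure_lt hfin hd
  have hlim : Tendsto (fun κ : ℝ => ENNReal.ofReal (κ - -κ)) (𝓝[>] 0) (𝓝 0) := by
    have : ContinuousAt (fun κ : ℝ => ENNReal.ofReal (κ - -κ)) 0 :=
      (ENNReal.continuous_ofReal.comp
        (by fun_prop : Continuous fun κ : ℝ => κ - -κ)).continuousAt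
    have h2 := this.tendsto
    simp only [neg_zero, sub_zero, ENNReal.ofReal_zero] at h2
    exact h2.mono_left nhdsWithin_le_nhds
  obtain ⟨κ, hκη, hκ1, hκ0⟩ := ((hlim.eventually_lt_const hη).and
    ((eventually_nhdsWithin_of_eventually_nhds (eventually_le_nhds one_pos)).and
      self_mem_nhdsWithin)).exists
  refine ⟨κ, hκ0, hκ1, ?_⟩
  have hsub : Ioo (-κ) κ ⊆ Icc (-1) 1 :=
    Ioo_subset_Icc_self.trans (Icc_subset_Icc (by linarith) hκ1)
  rw [lintegral_indicator measurableSet_Ioo]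
  have := h (Ioo (-κ) κ) (lt_of_le_of_lt (Measure.restrict_apply_le _ _)
    (by rwa [Real.volume_Ioo]))
  rwa [Measure.restrict_restrict measurableSet_Ioo, inter_eq_left.2 hsub] at this

/-- For `p < 0` large deviations have uniformly small potential. -/
theorem eventually_lintegral_penalty_le {W : (ℝ × ℝ) × ℝ → ℝ} (hW : ContDiff ℝ ∞ W)
    (hW0 : ∀ y, W (y, 0) = y.1) {p : ℝ} (hp : -1 < p) (hp0 : p < 0) {m₁ c : ℝ} (hm₁ : 0 ≤ m₁)
    (hm₁2 : m₁ ≤ 2) (hi : IntegrableOn (fun y : ℝ × ℝ => |m₁ - y.1| ^ p) unitDisc)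
    (hc : ∫ y in unitDisc, |m₁ - y.1| ^ p < c) :
    ∀ᶠ ε in 𝓝 (0 : ℝ), ∀ m, m₁ ≤ |m| →
      ∫⁻ y in unitDisc, penalty p (m - W (y, ε)) ≤ ENNReal.ofReal c := by
  obtain ⟨ε₁, hε₁, hb⟩ := exists_perturbation_bounds hW hW0
  -- Half of the gap pays for the perturbation of the clamped energy. The other half pays for the
  -- pole, whose mass must be below d/4 because the values of W have density at most 4.
  set d : ℝ := (c - ∫ y in unitDisc, |m₁ - y.1| ^ p) / 2 with hdef
  have hd : 0 < d := half_pos (sub_pos.2 hc)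
  obtain ⟨κ, hκ, hκ1, hκd⟩ := exists_lintegral_indicator_penalty_lt hp
    (d := ENNReal.ofReal (d / 4)) (by simpa using hd)
  set h := clampedPenalty p κ with hh
  have hu : UniformContinuous h :=
    uniformContinuous_clampedPenalty (by linarith) (Or.inl hκ)
  have hcont := hu.continuous
  have hpos : ∀ x : ℝ, 0 < max κ (min |x| 3) := fun x => lt_of_lt_of_le hκ (le_max_left _ _)
  have hnn : ∀ x, 0 ≤ h x := fun x => Real.rpow_nonneg (hpos x).le _
  have hanti : ∀ x y, |x| ≤ |y| → -h x ≤ -h y := fun x y hxy =>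
    neg_le_neg (Real.rpow_le_rpow_of_nonpos (hpos x)
      (max_le_max_left _ (min_le_min_right _ hxy)) hp0.le)
  have hle : ∀ x, κ ≤ |x| → |x| ^ p ≤ h x := fun x hx => by
    refine Real.rpow_le_rpow_of_nonpos (hpos x) (max_le hx (min_le_left _ _)) hp0.le
  have hbound : ∫ y in unitDisc, h (m₁ - y.1) ≤ ∫ y in unitDisc, |m₁ - y.1| ^ p := by
    refine integral_mono_ae (integrableOn_unitDisc_of_continuous (by fun_prop)) hi ?_
    have hne : ∀ᵐ y : ℝ × ℝ, y.1 ≠ m₁ := by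
      have h1 : ∀ᵐ s : ℝ, s ≠ m₁ := by simp [ae_iff]
      exact Measure.quasiMeasurePreserving_fst.ae h1
    filter_upwards [ae_restrict_of_ae hne, ae_restrict_mem isClosed_unitDisc.measurableSet]
      with y hy1 hy
    have h1 := (unitDisc_subset hy).1
    have h3 : |m₁ - y.1| ≤ 3 := abs_le.2 ⟨by linarith [h1.2], by linarith [h1.1]⟩
    refine Real.rpow_le_rpow_of_nonpos (abs_pos.2 (sub_ne_zero.2 hy1.symm)) ?_ hp0.le
    rw [min_eq_left h3]
    exact le_max_right _ _
  have hsplit : ∀ x, penalty p x ≤ ENNReal.ofReal (h x) + (Ioo (-κ) κ).indicator (penalty p) x := by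
    intro x
    by_cases hx : x ∈ Ioo (-κ) κ
    · rw [indicator_of_mem hx]; exact le_add_self
    · have hx' : κ ≤ |x| := by
        by_contra! h1
        exact hx (abs_lt.1 h1)
      rw [indicator_of_notMem hx, add_zero, penalty_of_ne (abs_pos.1 (by linarith))]
      exact ENNReal.ofReal_le_ofReal (hle x hx')
  have hball : ∀ᶠ ε in 𝓝 (0 : ℝ), |ε| < ε₁ := by
    filter_upwards [Metric.ball_mem_nhds (0 : ℝ) hε₁] with ε hε
    simpa using hε
  filter_upwards [eventually_abs_setIntegral_sub_le hW.continuous hW0 hu hd, hball]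
    with ε hε hε1 m hm
  have hWc : Continuous fun y => W (y, ε) := hW.continuous.comp (by fun_prop)
  have h1 := (abs_le.1 (hε m)).2
  have h2 := setIntegral_unitDisc_mono_of_abs_le (h := fun x => -h x) hcont.neg hanti (m := m₁)
    (m' := m) (by rwa [abs_of_nonneg hm₁])
  rw [integral_neg, integral_neg] at h2
  have hG : Measurable fun z => (Ioo (-κ) κ).indicator (penalty p) (m - z) :=
    ((measurable_penalty p).indicator measurableSet_Ioo).comp (by fun_prop)
  have h3 := lintegral_unitDisc_comp_le hW (hb ε hε1).2.2 hG
  rw [lintegral_sub_left_eq_self (μ := volume)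
    (fun z => (Ioo (-κ) κ).indicator (penalty p) z) m] at h3
  have h4 : (4 : ℝ≥0∞) * ENNReal.ofReal (d / 4) = ENNReal.ofReal d := by
    rw [← ENNReal.ofReal_ofNat, ← ENNReal.ofReal_mul (by norm_num)]
    congr 1
    ring
  calc ∫⁻ y in unitDisc, penalty p (m - W (y, ε))
      ≤ ∫⁻ y in unitDisc, (ENNReal.ofReal (h (m - W (y, ε)))
          + (Ioo (-κ) κ).indicator (penalty p) (m - W (y, ε))) := lintegral_mono fun y => hsplit _
    _ = ENNReal.ofReal (∫ y in unitDisc, h (m - W (y, ε)))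
          + ∫⁻ y in unitDisc, (Ioo (-κ) κ).indicator (penalty p) (m - W (y, ε)) := by
        have hGW : Measurable fun y => (Ioo (-κ) κ).indicator (penalty p) (m - W (y, ε)) :=
          hG.comp hWc.measurable
        rw [lintegral_add_right _ hGW,
          ofReal_integral_eq_lintegral_ofReal (integrableOn_unitDisc_of_continuous (by fun_prop))
          (Eventually.of_forall fun y => hnn _)]
    _ ≤ ENNReal.ofReal (c - d) + ENNReal.ofReal d := by
        refine add_le_add (ENNReal.ofReal_le_ofReal ?_) (h3.trans ?_)
        · rw [hdef] at h1 ⊢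
          linarith
        · rw [← h4]
          exact mul_le_mul_right hκd.le 4
    _ = ENNReal.ofReal c := by
        have h0 : 0 ≤ ∫ y in unitDisc, |m₁ - y.1| ^ p :=
          integral_nonneg fun y => Real.rpow_nonneg (abs_nonneg _) _
        rw [← ENNReal.ofReal_add (by rw [hdef]; linarith) hd.le, sub_add_cancel]

/-! ### The unique extremum and its position -/

/-- A smooth function vanishing to first order is quadratically small. -/
theorem ContDiffOn.exists_abs_le_sq {g : ℝ → ℝ} {r : ℝ} (hr : 0 < r)
    (hg : ContDiffOn ℝ ∞ g (Ioo (-r) r)) (h0 : g 0 = 0) (h1 : HasDerivAt g 0 0) :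
    ∃ K, ∀ᶠ ε in 𝓝 (0 : ℝ), |g ε| ≤ K * ε ^ 2 := by
  have hJ0 : (0 : ℝ) ∈ Ioo (-r) r := ⟨by linarith, hr⟩
  obtain ⟨g₁, hg₁s, hg₁, hg₁0⟩ := ContDiffOn.exists_hadamard (E := ℝ) (N := univ)
    (f := fun q => g q.2) isOpen_univ isOpen_Ioo (convex_Ioo (-r) r) hJ0
    (hg.comp contDiffOn_snd fun q hq => hq.2)
  obtain ⟨g₂, hg₂s, hg₂, -⟩ := hg₁s.exists_hadamard isOpen_univ isOpen_Ioo
    (convex_Ioo (-r) r) hJ0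
  have hz : g₁ (0, 0) = 0 := (hg₁0 0 (mem_univ _)).unique h1
  have hc : ContinuousAt (fun ε : ℝ => |g₂ (0, ε)|) 0 := by
    have h2 : ContinuousAt g₂ (0, 0) :=
      hg₂s.continuousOn.continuousAt ((isOpen_univ.prod isOpen_Ioo).mem_nhds ⟨mem_univ _, hJ0⟩)
    exact (ContinuousAt.comp (f := fun ε : ℝ => ((0 : ℝ), ε)) h2 (by fun_prop)).abs
  refine ⟨|g₂ (0, 0)| + 1, ?_⟩
  filter_upwards [isOpen_Ioo.mem_nhds hJ0, hc.eventually_lt continuousAt_const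
    (lt_add_one |g₂ (0, 0)|)] with ε hε hlt
  have e1 := hg₁ 0 (mem_univ _) ε hε
  have e2 := hg₂ 0 (mem_univ _) ε hε
  simp only [h0] at e1
  rw [e1, e2, hz, zero_add, zero_add, ← mul_assoc, abs_mul, ← sq, abs_of_nonneg (sq_nonneg ε),
    mul_comm]
  exact mul_le_mul_of_nonneg_right hlt.le (sq_nonneg ε)

/-- The order-`p` energy of a small perturbation of the first coordinate has a unique extremum, and
the extremum is known up to second order. -/
theorem exists_unique_extremum {W : (ℝ × ℝ) × ℝ → ℝ} (hW : ContDiff ℝ ∞ W)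
    (hW0 : ∀ y, W (y, 0) = y.1) {α β γ : ℝ}
    (hW1 : ∀ y : ℝ × ℝ, HasDerivAt (fun ε => W (y, ε))
      (α * y.1 ^ 2 + β * (y.1 * y.2) + γ * y.2 ^ 2) 0) {p : ℝ} (hp : -1 < p) (hp0 : p ≠ 0) :
    ∃ K, ∀ᶠ ε in 𝓝 (0 : ℝ), ∃ m, |m - ε * (((p - 1) * α + γ) / (p + 2))| ≤ K * ε ^ 2 ∧
      ∀ m', m' ≠ m →
        (0 < p → ∫⁻ y in unitDisc, penalty p (m - W (y, ε))
          < ∫⁻ y in unitDisc, penalty p (m' - W (y, ε))) ∧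
        (p < 0 → ∫⁻ y in unitDisc, penalty p (m' - W (y, ε))
          < ∫⁻ y in unitDisc, penalty p (m - W (y, ε))) := by
  obtain ⟨δ, hδ, E, B, hE, hB, hI, hEB, hE0, hE1, hE2, hB1⟩ := exists_energy_expansion hW hW0 hW1 hp
  set J : Set ℝ := Ioo (-δ) δ with hJ
  have hO : IsOpen (J ×ˢ J) := isOpen_Ioo.prod isOpen_Ioo
  have h0 : (0 : ℝ) ∈ J := ⟨by linarith, hδ⟩
  have hp2 : 0 < p + 2 := by linarith
  set c : ℝ := ((p - 1) * α + γ) / (p + 2) with hc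
  -- This is the second m-derivative of p`E` at the origin. The factor p converts maximisation for p
  -- < 0 into minimisation and makes the derivative positive in both cases.
  set a : ℝ := p ^ 2 * (p + 2) * E (0, 0) with ha
  have ha0 : 0 < a := by positivity
  -- `p * E` is convex near `0`
  set G : ℝ × ℝ → ℝ := fun q => p * partialFst E q with hG
  have hGs : ContDiffOn ℝ ∞ G (J ×ˢ J) := contDiffOn_const.mul (hE.partialFst hO)
  have hF' : ∀ m ∈ J, ∀ ε ∈ J, HasDerivAt (fun m => p * E (m, ε)) (G (m, ε)) m :=
    fun m hm ε hε => (hE.hasDerivAt_partialFst hO ⟨hm, hε⟩).const_mul p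
  have hG' : ∀ m ∈ J, ∀ ε ∈ J, HasDerivAt (fun m => G (m, ε))
      (p * partialFst (partialFst E) (m, ε)) m :=
    fun m hm ε hε => ((hE.partialFst hO).hasDerivAt_partialFst hO ⟨hm, hε⟩).const_mul p
  have hcont2 : ContinuousAt (fun q => p * partialFst (partialFst E) q) (0, 0) :=
    ((contDiffOn_const.mul ((hE.partialFst hO).partialFst hO)).continuousOn).continuousAt
      (hO.mem_nhds ⟨h0, h0⟩)
  have hpos : ∀ᶠ q in 𝓝 ((0 : ℝ), (0 : ℝ)), a / 2 < p * partialFst (partialFst E) q := by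
    refine continuousAt_const.eventually_lt hcont2 ?_
    rw [hE2]
    have : p * (p * (p + 2) * E (0, 0)) = a := by rw [ha]; ring
    linarith
  obtain ⟨r, hr, hball⟩ := Metric.eventually_nhds_iff.1 hpos
  obtain ⟨m₁, hm₁0, hm₁⟩ := exists_between (show (0 : ℝ) < min (min δ r) 2 by positivity)
  have hm₁δ : m₁ < δ := hm₁.trans_le ((min_le_left _ _).trans (min_le_left _ _))
  have hm₁r : m₁ < r := hm₁.trans_le ((min_le_left _ _).trans (min_le_right _ _))
  have hm₁2 : m₁ ≤ 2 := hm₁.le.trans (min_le_right _ _)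
  have hsub : Icc (-m₁) m₁ ⊆ J := fun m hm => ⟨by linarith [hm.1], by linarith [hm.2]⟩
  have hconv : ∀ ε ∈ J, |ε| < r → ∀ m ∈ Icc (-m₁) m₁,
      a / 2 < p * partialFst (partialFst E) (m, ε) := fun ε _ hεr m hm => by
    refine hball ?_
    rw [Prod.dist_eq, max_lt_iff, Real.dist_0_eq_abs, Real.dist_0_eq_abs]
    exact ⟨(abs_le.2 hm).trans_lt hm₁r, hεr⟩
  have hslope : ∀ ε ∈ J, |ε| < r → ∀ x ∈ Icc (-m₁) m₁, ∀ y ∈ Icc (-m₁) m₁, x ≤ y →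
      a / 2 * (y - x) ≤ G (y, ε) - G (x, ε) := fun ε hε hεr => by
    refine (convex_Icc (-m₁) m₁).mul_sub_le_image_sub_of_le_deriv
      (fun x hx => (hG' x (hsub hx) ε hε).continuousAt.continuousWithinAt)
      (fun x hx => (hG' x (hsub (interior_subset hx)) ε hε).differentiableAt.differentiableWithinAt)
      (fun x hx => ?_)
    rw [(hG' x (hsub (interior_subset hx)) ε hε).deriv]
    exact (hconv ε hε hεr x (interior_subset hx)).le
  have hstrict : ∀ ε ∈ J, |ε| < r → StrictConvexOn ℝ (Icc (-m₁) m₁) fun m => p * E (m, ε) :=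
    fun ε hε hεr => by
      refine StrictMonoOn.strictConvexOn_of_deriv (convex_Icc _ _)
        (fun x hx => (hF' x (hsub hx) ε hε).continuousAt.continuousWithinAt) ?_
      intro x hx y hy hxy
      have hx' := interior_subset (s := Icc (-m₁) m₁) hx
      have hy' := interior_subset (s := Icc (-m₁) m₁) hy
      rw [(hF' x (hsub hx') ε hε).deriv, (hF' y (hsub hy') ε hε).deriv]
      have := hslope ε hε hεr x hx' y hy' hxy.le
      nlinarith
  -- the endpoint is worse than the centre
  have hm₁J : m₁ ∈ J := ⟨by linarith, hm₁δ⟩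
  have hend : p * E (0, 0) < p * E (m₁, 0) := by
    have hmono : StrictMonoOn (fun m => p * E (m, 0)) (Icc 0 m₁) := by
      have hs : Icc 0 m₁ ⊆ Icc (-m₁) m₁ := Icc_subset_Icc (by linarith) le_rfl
      refine strictMonoOn_of_deriv_pos (convex_Icc _ _)
        (fun x hx => (hF' x (hsub (hs hx)) 0 h0).continuousAt.continuousWithinAt) fun x hx => ?_
      rw [interior_Icc] at hx
      have hx' := hs (Ioo_subset_Icc_self hx)
      rw [(hF' x (hsub hx') 0 h0).deriv]
      have h1 := hslope 0 h0 (by simpa using hr) 0 ⟨by linarith, hm₁0.le⟩ x hx' hx.1.le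
      have h2 : G (0, 0) = 0 := by simp [hG, hE1]
      have h3 := mul_pos (half_pos ha0) hx.1
      linarith
    exact hmono ⟨le_rfl, hm₁0.le⟩ ⟨hm₁0.le, le_rfl⟩ hm₁0
  have hWm : Measurable fun y => W (y, 0) := (hW.continuous.comp (by fun_prop)).measurable
  have hi := integrable_abs_rpow_of_lintegral_penalty hWm (hI m₁ hm₁J 0 h0).1 (hI m₁ hm₁J 0 h0).2
  simp only [hW0] at hi
  have hEc : ContinuousAt (fun ε : ℝ => E (0, ε)) 0 :=
    ContinuousAt.comp (f := fun ε : ℝ => ((0 : ℝ), ε))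
      (hE.continuousOn.continuousAt (hO.mem_nhds ⟨h0, h0⟩)) (by fun_prop)
  have htail : ∀ᶠ ε in 𝓝 (0 : ℝ), ∀ m, m₁ ≤ |m| →
      (0 < p → ∫⁻ y in unitDisc, penalty p (0 - W (y, ε))
          < ∫⁻ y in unitDisc, penalty p (m - W (y, ε))) ∧
        (p < 0 → ∫⁻ y in unitDisc, penalty p (m - W (y, ε))
          < ∫⁻ y in unitDisc, penalty p (0 - W (y, ε))) := by
    rcases lt_or_gt_of_ne hp0 with hneg | hpos'
    · obtain ⟨d, hd1, hd2⟩ := exists_between (lt_of_mul_lt_mul_of_nonpos_left hend hneg.le)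
      filter_upwards [eventually_lintegral_penalty_le hW hW0 hp hneg hm₁0.le hm₁2 hi.1
        (by rw [hi.2]; exact hd1), continuousAt_const.eventually_lt hEc hd2,
        isOpen_Ioo.mem_nhds h0] with ε h1 h2 hε m hm
      refine ⟨fun h => absurd h hneg.not_gt, fun _ => (h1 m hm).trans_lt ?_⟩
      rw [(hI 0 h0 ε hε).2]
      exact (ENNReal.ofReal_lt_ofReal_iff (((hI m₁ hm₁J 0 h0).1.trans_lt hd1).trans h2)).2 h2
    · obtain ⟨d, hd1, hd2⟩ := exists_between (lt_of_mul_lt_mul_left hend hpos'.le)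
      filter_upwards [eventually_le_lintegral_penalty hW.continuous hW0 hpos' hm₁0.le hm₁2
        (by rw [hi.2]; exact hd2), hEc.eventually_lt continuousAt_const hd1,
        isOpen_Ioo.mem_nhds h0] with ε h1 h2 hε m hm
      refine ⟨fun _ => lt_of_lt_of_le ?_ (h1 m hm), fun h => absurd h hpos'.not_gt⟩
      rw [(hI 0 h0 ε hε).2]
      exact (ENNReal.ofReal_lt_ofReal_iff (hE0.trans hd1)).2 h2
  -- the derivative of the energy at the predicted position
  obtain ⟨K, hK⟩ : ∃ K, ∀ᶠ ε in 𝓝 (0 : ℝ), |G (ε * c, ε)| ≤ K * ε ^ 2 := by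
    have hGB : ∀ m ∈ J, ∀ ε ∈ J, G (m, ε) = G (m, 0) + ε * (p * partialFst B (m, ε)) := by
      intro m hm ε hε
      have h1 := ((hE.hasDerivAt_partialFst hO (m := m) (ε := 0) ⟨hm, h0⟩).add
        ((hB.hasDerivAt_partialFst hO (m := m) (ε := ε) ⟨hm, hε⟩).const_mul ε))
      have h2 := (hE.hasDerivAt_partialFst hO (m := m) (ε := ε) ⟨hm, hε⟩).unique
        (h1.congr_of_eventuallyEq
          (by filter_upwards [isOpen_Ioo.mem_nhds hm] with x hx using hEB x hx ε hε))
      simp only [hG, h2]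
      ring
    obtain ⟨s, hs, hsJ⟩ : ∃ s > 0, ∀ ε ∈ Ioo (-s) s, ε * c ∈ J ∧ ε ∈ J := by
      have hcc : ContinuousAt (fun ε : ℝ => ε * c) 0 := by fun_prop
      have h1 : ∀ᶠ ε in 𝓝 (0 : ℝ), ε * c ∈ J :=
        hcc (isOpen_Ioo.mem_nhds (by simpa using hδ))
      obtain ⟨s, hs, h⟩ := Metric.eventually_nhds_iff.1 (h1.and (isOpen_Ioo.mem_nhds h0))
      exact ⟨s, hs, fun ε hε => h (by rw [Real.dist_0_eq_abs]; exact abs_lt.2 hε)⟩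
    refine ContDiffOn.exists_abs_le_sq hs
      (hGs.comp (f := fun ε : ℝ => (ε * c, ε)) (by fun_prop) fun ε hε => hsJ ε hε)
      (by simp [hG, hE1]) ?_
    have hb : ContinuousAt (fun ε : ℝ => p * partialFst B (ε * c, ε)) 0 := by
      have h1 : ContinuousAt (partialFst B) ((0 : ℝ) * c, 0) := by
        rw [zero_mul]
        exact (hB.partialFst hO).continuousOn.continuousAt (hO.mem_nhds ⟨h0, h0⟩)
      exact continuousAt_const.mul
        (ContinuousAt.comp (f := fun ε : ℝ => (ε * c, ε)) h1 (by fun_prop))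
    have hd1 : HasDerivAt (fun ε : ℝ => G (ε * c, 0)) (a * c) 0 := by
      have h1 : HasDerivAt (fun m => G (m, 0)) a ((0 : ℝ) * c) := by
        rw [zero_mul]
        refine (hG' 0 h0 0 h0).congr_deriv ?_
        rw [hE2, ha]; ring
      have h2 : HasDerivAt (fun ε : ℝ => ε * c) c 0 := by
        simpa using (hasDerivAt_id (0 : ℝ)).mul_const c
      exact HasDerivAt.comp (h₂ := fun m => G (m, 0)) (h := fun ε : ℝ => ε * c) (0 : ℝ) h1 h2
    -- Because of the explicit factor ε, continuity of the other factor at 0 is enough.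
    have hd2 : HasDerivAt (fun ε : ℝ => ε * (p * partialFst B (ε * c, ε)))
        (p * partialFst B (0, 0)) 0 := by
      rw [hasDerivAt_iff_tendsto_slope]
      have h1 := hb.tendsto
      simp only [zero_mul] at h1
      refine (h1.mono_left nhdsWithin_le_nhds).congr' ?_
      filter_upwards [self_mem_nhdsWithin] with ε hε
      rw [slope_def_field]
      have : ε ≠ 0 := hε
      field_simp
      ring
    have hd3 := hd1.add hd2
    -- This cancellation is the equation that determines c.
    have hz : a * c + p * partialFst B (0, 0) = 0 := by
      rw [hB1, ha, hc]
      field_simp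
      ring
    rw [hz] at hd3
    refine hd3.congr_of_eventuallyEq ?_
    filter_upwards [Ioo_mem_nhds (neg_lt_zero.2 hs) hs] with ε hε
    exact hGB _ (hsJ ε hε).1 _ (hsJ ε hε).2
  have hcev : ∀ᶠ ε in 𝓝 (0 : ℝ), |ε * c| < m₁ := by
    have : ContinuousAt (fun ε : ℝ => |ε * c|) 0 := by fun_prop
    exact this.eventually_lt continuousAt_const (by simpa using hm₁0)
  have hrev : ∀ᶠ ε in 𝓝 (0 : ℝ), |ε| < r := by
    filter_upwards [Metric.ball_mem_nhds (0 : ℝ) hr] with ε hε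
    simpa using hε
  refine ⟨2 / a * K, ?_⟩
  filter_upwards [htail, hK, hcev, hrev, isOpen_Ioo.mem_nhds h0] with ε htail hK hcε hεr hε
  have hsc := hstrict ε hε hεr
  obtain ⟨m, hm, hmin⟩ := isCompact_Icc.exists_isMinOn (nonempty_Icc.2 (by linarith : -m₁ ≤ m₁))
    (f := fun m => p * E (m, ε))
    (fun x hx => (hF' x (hsub hx) ε hε).continuousAt.continuousWithinAt)
  have h0m : (0 : ℝ) ∈ Icc (-m₁) m₁ := ⟨by linarith, hm₁0.le⟩
  -- comparison of energies on the central interval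
  have hcmp : ∀ x ∈ Icc (-m₁) m₁, ∀ y ∈ Icc (-m₁) m₁, p * E (x, ε) < p * E (y, ε) →
      (0 < p → ∫⁻ w in unitDisc, penalty p (x - W (w, ε))
          < ∫⁻ w in unitDisc, penalty p (y - W (w, ε))) ∧
        (p < 0 → ∫⁻ w in unitDisc, penalty p (y - W (w, ε))
          < ∫⁻ w in unitDisc, penalty p (x - W (w, ε))) := by
    intro x hx y hy hxy
    have hEx := hI x (hsub hx) ε hε
    have hEy := hI y (hsub hy) ε hε
    rw [hEx.2, hEy.2]
    refine ⟨fun h => ?_, fun h => ?_⟩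
    · have h1 := lt_of_mul_lt_mul_left hxy h.le
      exact (ENNReal.ofReal_lt_ofReal_iff (hEx.1.trans_lt h1)).2 h1
    · have h1 := lt_of_mul_lt_mul_of_nonpos_left hxy h.le
      exact (ENNReal.ofReal_lt_ofReal_iff (hEy.1.trans_lt h1)).2 h1
  have hcmp' : ∀ x ∈ Icc (-m₁) m₁, ∀ y ∈ Icc (-m₁) m₁, p * E (x, ε) ≤ p * E (y, ε) →
      (0 < p → ∫⁻ w in unitDisc, penalty p (x - W (w, ε))
          ≤ ∫⁻ w in unitDisc, penalty p (y - W (w, ε))) ∧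
        (p < 0 → ∫⁻ w in unitDisc, penalty p (y - W (w, ε))
          ≤ ∫⁻ w in unitDisc, penalty p (x - W (w, ε))) := by
    intro x hx y hy hxy
    rw [(hI x (hsub hx) ε hε).2, (hI y (hsub hy) ε hε).2]
    exact ⟨fun h => ENNReal.ofReal_le_ofReal (le_of_mul_le_mul_left hxy h),
      fun h => ENNReal.ofReal_le_ofReal (by nlinarith)⟩
  have hm0 := hcmp' m hm 0 h0m (hmin h0m)
  -- A minimiser on the closed interval is no worse than 0, whereas the tail bound, which includes
  -- |m| = m₁, makes the endpoints strictly worse.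
  have hmint : |m| < m₁ := by
    by_contra! hge
    have h1 := htail m hge
    rcases lt_or_gt_of_ne hp0 with h | h
    · exact absurd (h1.2 h) (hm0.2 h).not_gt
    · exact absurd (h1.1 h) (hm0.1 h).not_gt
  have hGm : G (m, ε) = 0 := by
    have hloc : IsLocalMin (fun m => p * E (m, ε)) m :=
      hmin.isLocalMin (Icc_mem_nhds (abs_lt.1 hmint).1 (abs_lt.1 hmint).2)
    exact hloc.hasDerivAt_eq_zero (hF' m (hsub hm) ε hε)
  refine ⟨m, ?_, fun m' hm' => ?_⟩
  · have hcm : ε * c ∈ Icc (-m₁) m₁ := abs_le.1 hcε.le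
    -- `G` increases in m at rate at least a/2 and vanishes at the minimiser, so its quadratically
    -- small value at εc bounds the distance to the minimiser.
    have key : a / 2 * |m - ε * c| ≤ |G (ε * c, ε)| := by
      rcases le_total m (ε * c) with h | h
      · have := hslope ε hε hεr m hm _ hcm h
        rw [hGm, sub_zero] at this
        rw [abs_of_nonpos (sub_nonpos.2 h), neg_sub]
        exact this.trans (le_abs_self _)
      · have := hslope ε hε hεr _ hcm m hm h
        rw [hGm, zero_sub] at this
        rw [abs_of_nonneg (sub_nonneg.2 h)]
        exact this.trans (neg_le_abs _)
    have h2 := key.trans hK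
    have h3 : |m - ε * c| = 2 / a * (a / 2 * |m - ε * c|) := by field_simp
    rw [h3, mul_assoc]
    exact mul_le_mul_of_nonneg_left h2 (by positivity)
  · by_cases hin : |m'| < m₁
    · have hm'I : m' ∈ Icc (-m₁) m₁ := abs_le.1 hin.le
      refine hcmp m hm m' hm'I (lt_of_le_of_ne (hmin hm'I) fun heq => hm' ?_)
      refine hsc.eq_of_isMinOn (fun x hx => ?_) hmin hm'I hm
      have := hmin hx
      simp only [mem_ofPred_eq] at this ⊢
      linarith
    · have h1 := htail m' (not_lt.1 hin)
      exact ⟨fun h => (hm0.1 h).trans_lt (h1.1 h), fun h => (h1.2 h).trans_le (hm0.2 h)⟩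

/-! ### Taylor's formula and comparison principles for order means -/

/-- Differentiability of the derivative of `u` bounds the slope of the remainder along the segment t
↦ x + tv by c‖v‖²; the mean value inequality on [0,1] concludes. -/
theorem taylor_two_isLittleO {u : Plane → ℝ} (hu : ContDiff ℝ ∞ u) (x : Plane) :
    (fun v => u (x + v) - u x - fderiv ℝ u x v - 1 / 2 * hessianForm u x v)
      =o[𝓝 0] fun v => ‖v‖ ^ 2 := by
  rw [Asymptotics.isLittleO_iff]
  intro c hc
  have hd : DifferentiableAt ℝ (fderiv ℝ u) x :=
    (hu.fderiv_right (m := 1) (by norm_cast)).differentiable (by norm_num) x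
  have h1 := hasFDerivAt_iff_isLittleO_nhds_zero.1 hd.hasFDerivAt
  obtain ⟨δ, hδ, h2⟩ := Metric.eventually_nhds_iff.1 (Asymptotics.isLittleO_iff.1 h1 hc)
  refine Metric.eventually_nhds_iff.2 ⟨δ, hδ, fun v hv => ?_⟩
  rw [dist_zero_right] at hv
  set L := fderiv ℝ u x with hL
  set H := fderiv ℝ (fderiv ℝ u) x with hH
  have hder : ∀ t : ℝ, HasDerivAt
      (fun t : ℝ => u (x + t • v) - t * L v - t ^ 2 * (1 / 2 * H v v))
      (fderiv ℝ u (x + t • v) v - L v - t * H v v) t := by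
    intro t
    have hl : HasDerivAt (fun t : ℝ => x + t • v) v t := by
      simpa using ((hasDerivAt_id t).smul_const v).const_add x
    have h3 := ((hu.differentiable (by simp)) (x + t • v)).hasFDerivAt.comp_hasDerivAt t hl
    refine ((h3.sub ((hasDerivAt_id t).mul_const (L v))).sub
      (((hasDerivAt_id t).pow 2).mul_const (1 / 2 * H v v))).congr_deriv ?_
    simp
    ring
  have h4 := norm_image_sub_le_of_norm_deriv_le_segment_01' (C := c * ‖v‖ ^ 2)
    (fun t _ => (hder t).hasDerivWithinAt) fun t ht => by
      have ht1 : ‖t • v‖ ≤ ‖v‖ := by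
        rw [norm_smul, Real.norm_of_nonneg ht.1]
        exact mul_le_of_le_one_left (norm_nonneg v) ht.2.le
      have h5 := h2 (y := t • v) (by rw [dist_zero_right]; exact ht1.trans_lt hv)
      have h6 : fderiv ℝ u (x + t • v) v - L v - t * H v v
          = (fderiv ℝ u (x + t • v) - L - H (t • v)) v := by simp
      rw [h6]
      refine (ContinuousLinearMap.le_opNorm _ _).trans ?_
      calc _ ≤ c * ‖t • v‖ * ‖v‖ := by gcongr
        _ ≤ c * ‖v‖ * ‖v‖ := by gcongr
        _ = c * ‖v‖ ^ 2 := by ring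
  have h7 : ‖‖v‖ ^ 2‖ = ‖v‖ ^ 2 := by simp
  rw [h7]
  refine le_of_eq_of_le (congrArg norm ?_) h4
  simp only [hessianForm, ← hH, one_smul, zero_smul, add_zero]
  ring

theorem isProbabilityMeasure_discLaw {u : Plane → ℝ} (hu : Continuous u) (x : Plane) {ϱ : ℝ}
    (hϱ : 0 < ϱ) : IsProbabilityMeasure (discLaw u x ϱ) := by
  have := ProbabilityTheory.cond_isProbabilityMeasure_of_finite
    (μ := (volume : Measure Plane)) (s := Metric.closedBall x ϱ)
    (Metric.measure_closedBall_pos volume x hϱ).ne' (measure_closedBall_lt_top).ne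
  exact Measure.isProbabilityMeasure_map hu.aemeasurable

theorem ae_discLaw {u : Plane → ℝ} (hu : Continuous u) {x : Plane} {ϱ : ℝ}
    {s : Set ℝ} (hs : MeasurableSet s) (h : ∀ z ∈ Metric.closedBall x ϱ, u z ∈ s) :
    ∀ᵐ z ∂discLaw u x ϱ, z ∈ s := by
  refine (ae_map_iff hu.aemeasurable hs).2 ?_
  refine Measure.ae_smul_measure ?_ _
  filter_upwards [ae_restrict_mem Metric.isClosed_closedBall.measurableSet] with z hz using h z hz

theorem orderMeanEnergy_of_pos {p : ℝ} (hp : 0 < p) (ν : Measure ℝ) (μ : ℝ) :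
    orderMeanEnergy p ν μ = ((∫⁻ z, ENNReal.ofReal |μ - z| ^ p ∂ν : ℝ≥0∞) : EReal) := by
  simp [orderMeanEnergy, Real.sign_of_pos hp]

theorem orderMeanEnergy_of_neg {p : ℝ} (hp : p < 0) (ν : Measure ℝ) (μ : ℝ) :
    orderMeanEnergy p ν μ = -((∫⁻ z, ENNReal.ofReal |μ - z| ^ p ∂ν : ℝ≥0∞) : EReal) := by
  simp [orderMeanEnergy, Real.sign_of_neg hp]

theorem orderMeanEnergy_lt {p : ℝ} (hp0 : p ≠ 0) {ν : Measure ℝ} {μ m : ℝ}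
    (hpos : 0 < p → ∫⁻ z, ENNReal.ofReal |μ - z| ^ p ∂ν < ∫⁻ z, ENNReal.ofReal |m - z| ^ p ∂ν)
    (hneg : p < 0 → ∫⁻ z, ENNReal.ofReal |m - z| ^ p ∂ν < ∫⁻ z, ENNReal.ofReal |μ - z| ^ p ∂ν) :
    orderMeanEnergy p ν μ < orderMeanEnergy p ν m := by
  rcases hp0.lt_or_gt with h | h
  · rw [orderMeanEnergy_of_neg h, orderMeanEnergy_of_neg h, EReal.neg_lt_neg_iff,
      EReal.coe_ennreal_lt_coe_ennreal_iff]
    exact hneg h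
  · rw [orderMeanEnergy_of_pos h, orderMeanEnergy_of_pos h, EReal.coe_ennreal_lt_coe_ennreal_iff]
    exact hpos h

theorem orderMean_eq_singleton {p : ℝ} {ν : Measure ℝ} {μ : ℝ}
    (h : ∀ m, m ≠ μ → orderMeanEnergy p ν μ < orderMeanEnergy p ν m) : orderMean p ν = {μ} := by
  ext m
  refine ⟨fun hm => ?_, ?_⟩
  · by_contra hne
    exact (hm μ).not_gt (h m hne)
  · rintro rfl m'
    rcases eq_or_ne m' m with rfl | hne
    · exact le_rfl
    · exact (h m' hne).le

/-- A point almost surely strictly farther from the values than `b` has strictly larger signed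
energy. Strictness survives integration only if the smaller integral is finite: `M` ensures this for
p > 0, and `δ`, keeping μ off the pole, for p < 0. -/
theorem notMem_orderMean {p : ℝ} (hp0 : p ≠ 0) {ν : Measure ℝ} [IsProbabilityMeasure ν]
    {μ b δ M : ℝ} (hδ : 0 < δ) (h : ∀ᵐ z ∂ν, |b - z| < |μ - z| ∧ δ ≤ |μ - z| ∧ |b - z| ≤ M) :
    μ ∉ orderMean p ν := by
  have hmeas : ∀ m : ℝ, Measurable fun z : ℝ => ENNReal.ofReal |m - z| ^ p := by
    intro m; fun_prop
  refine fun hμ => (hμ b).not_gt (orderMeanEnergy_lt hp0 (fun hp => ?_) fun hp => ?_)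
  · refine lintegral_strict_mono (IsProbabilityMeasure.ne_zero ν) (hmeas μ).aemeasurable ?_ ?_
    · refine ((lintegral_mono_ae (g := fun _ => ENNReal.ofReal M ^ p) ?_).trans_lt ?_).ne
      · filter_upwards [h] with z hz
        exact ENNReal.rpow_le_rpow (ENNReal.ofReal_le_ofReal hz.2.2) hp.le
      · simpa using ENNReal.rpow_lt_top_of_nonneg hp.le ENNReal.ofReal_ne_top
    · filter_upwards [h] with z hz
      exact ENNReal.rpow_lt_rpow
        ((ENNReal.ofReal_lt_ofReal_iff (hδ.trans_le hz.2.1)).2 hz.1) hp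
  · refine lintegral_strict_mono (IsProbabilityMeasure.ne_zero ν) (hmeas b).aemeasurable ?_ ?_
    · refine ((lintegral_mono_ae (g := fun _ => ENNReal.ofReal δ ^ p) ?_).trans_lt ?_).ne
      · filter_upwards [h] with z hz
        rw [← neg_neg p, ENNReal.rpow_neg, ENNReal.rpow_neg (ENNReal.ofReal δ), ENNReal.inv_le_inv]
        exact ENNReal.rpow_le_rpow (ENNReal.ofReal_le_ofReal hz.2.1) (neg_pos.2 hp).le
      · simpa using (ENNReal.rpow_ne_top_of_nonneg' (by simpa using hδ)
          ENNReal.ofReal_ne_top).lt_top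
    · filter_upwards [h] with z hz
      rw [← neg_neg p, ENNReal.rpow_neg, ENNReal.rpow_neg (ENNReal.ofReal |b - z|),
        ENNReal.inv_lt_inv]
      exact ENNReal.rpow_lt_rpow
        ((ENNReal.ofReal_lt_ofReal_iff (hδ.trans_le hz.2.1)).2 hz.1) (neg_pos.2 hp)

theorem exists_abs_sub_le_of_continuous {u : Plane → ℝ} (hu : Continuous u) (x : Plane)
    (ϱ b : ℝ) : ∃ M, ∀ z ∈ Metric.closedBall x ϱ, |b - u z| ≤ M :=
  (isCompact_closedBall x ϱ).exists_bound_of_continuousOn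
    (f := fun z => b - u z) (by fun_prop)

/-- If μ were below `b`, then `b` would be closer than μ to every value on the disc, by exactly b -
μ, and would beat it. -/
theorem le_of_mem_discMean {p : ℝ} (hp0 : p ≠ 0) {u : Plane → ℝ} (hu : Continuous u) {x : Plane}
    {ϱ b : ℝ} (hϱ : 0 < ϱ) (hb : ∀ z ∈ Metric.closedBall x ϱ, b ≤ u z) {μ : ℝ}
    (hμ : μ ∈ discMean p u x ϱ) : b ≤ μ := by
  by_contra! hlt
  have := isProbabilityMeasure_discLaw hu x hϱ
  obtain ⟨M, hM⟩ := exists_abs_sub_le_of_continuous hu x ϱ b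
  refine notMem_orderMean hp0 (b := b) (M := M) (sub_pos.2 hlt) ?_ hμ
  filter_upwards [ae_discLaw hu (s := {z | b ≤ z ∧ |b - z| ≤ M}) (by measurability)
    fun z hz => ⟨hb z hz, hM z hz⟩] with z hz
  have h1 : b ≤ z := hz.1
  have h2 : |μ - z| = z - μ := by rw [abs_of_nonpos (by linarith)]; ring
  refine ⟨?_, by linarith, hz.2⟩
  rw [h2, abs_of_nonpos (by linarith)]
  linarith

theorem mem_discMean_le {p : ℝ} (hp0 : p ≠ 0) {u : Plane → ℝ} (hu : Continuous u) {x : Plane}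
    {ϱ b : ℝ} (hϱ : 0 < ϱ) (hb : ∀ z ∈ Metric.closedBall x ϱ, u z ≤ b) {μ : ℝ}
    (hμ : μ ∈ discMean p u x ϱ) : μ ≤ b := by
  by_contra! hlt
  have := isProbabilityMeasure_discLaw hu x hϱ
  obtain ⟨M, hM⟩ := exists_abs_sub_le_of_continuous hu x ϱ b
  refine notMem_orderMean hp0 (b := b) (M := M) (sub_pos.2 hlt) ?_ hμ
  filter_upwards [ae_discLaw hu (s := {z | z ≤ b ∧ |b - z| ≤ M}) (by measurability)
    fun z hz => ⟨hb z hz, hM z hz⟩] with z hz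
  have h1 : z ≤ b := hz.1
  have h2 : |μ - z| = μ - z := abs_of_nonneg (by linarith)
  refine ⟨?_, by linarith, hz.2⟩
  rw [h2, abs_of_nonneg (by linarith)]
  linarith

theorem exists_forall_closedBall {P : Plane → Prop} {x : Plane} (h : ∀ᶠ z in 𝓝 x, P z) :
    ∃ ϱ₀ : ℝ, 0 < ϱ₀ ∧ ∀ ϱ : ℝ, 0 < ϱ → ϱ < ϱ₀ → ∀ z ∈ Metric.closedBall x ϱ, P z := by
  obtain ⟨r, hr, h⟩ := Metric.eventually_nhds_iff.1 h
  exact ⟨r, hr, fun ϱ _ h1 z hz => h (lt_of_le_of_lt hz h1)⟩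

theorem eventually_abs_taylor_le {u : Plane → ℝ} (hu : ContDiff ℝ ∞ u) {x : Plane}
    (hx : gradient u x = 0) {c : ℝ} (hc : 0 < c) :
    ∀ᶠ z in 𝓝 x, |u z - u x - 1 / 2 * hessianForm u x (z - x)| ≤ c * ‖z - x‖ ^ 2 := by
  have h0 : fderiv ℝ u x = 0 := by
    simpa [gradient] using hx
  have h1 := Asymptotics.isLittleO_iff.1 (taylor_two_isLittleO hu x) hc
  have h2 : Tendsto (fun z => z - x) (𝓝 x) (𝓝 0) := by
    have : ContinuousAt (fun z => z - x) x := by fun_prop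
    simpa [ContinuousAt] using this
  filter_upwards [h2.eventually h1] with z hz
  simpa [h0] using hz

/-! ### Reduction of regular points to the unit disc -/

/-- The law of `u` on a disc in orthonormal coordinates. -/
theorem exists_lintegral_discLaw {u : Plane → ℝ} (hu : Continuous u) (x : Plane) {ϱ : ℝ}
    (hϱ : 0 < ϱ) {η ξ : Plane} (h : ∀ s v : ℝ, ‖s • η + v • ξ‖ ^ 2 = s ^ 2 + v ^ 2) :
    ∃ c : ℝ≥0∞, c ≠ 0 ∧ c ≠ ⊤ ∧ ∀ F : ℝ → ℝ≥0∞, Measurable F →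
      ∫⁻ z, F z ∂discLaw u x ϱ
        = c * ∫⁻ y in unitDisc, F (u (x + ϱ • (y.1 • η + y.2 • ξ))) := by
  let f : ℝ × ℝ →ₗ[ℝ] Plane :=
    { toFun := fun y => ϱ • (y.1 • η + y.2 • ξ)
      map_add' := fun a b => by simp only [Prod.fst_add, Prod.snd_add]; module
      map_smul' := fun a b => by
        simp only [Prod.smul_fst, Prod.smul_snd, RingHom.id_apply, smul_eq_mul]; module }
  have hf : Function.Injective f := by
    rw [injective_iff_map_eq_zero]
    intro y hy
    have h1 : y.1 • η + y.2 • ξ = 0 := by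
      have h2 : ϱ • (y.1 • η + y.2 • ξ) = 0 := hy
      exact (smul_eq_zero.1 h2).resolve_left hϱ.ne'
    have h2 := h y.1 y.2
    rw [h1] at h2
    simp only [norm_zero, ne_eq, OfNat.ofNat_ne_zero, not_false_eq_true, zero_pow] at h2
    ext
    · simp only [Prod.fst_zero]; nlinarith [sq_nonneg y.1, sq_nonneg y.2]
    · simp only [Prod.snd_zero]; nlinarith [sq_nonneg y.1, sq_nonneg y.2]
  let L : (ℝ × ℝ) ≃L[ℝ] Plane :=
    (LinearMap.linearEquivOfInjective f hf (by simp)).toContinuousLinearEquiv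
  have hL : ∀ y, L y = ϱ • (y.1 • η + y.2 • ξ) := fun y => rfl
  have := L.isAddHaarMeasure_map (volume : Measure (ℝ × ℝ))
  -- Uniqueness of Haar measure gives the constant; its value is irrelevant, because positive finite
  -- factors do not affect minimisers.
  obtain ⟨c, hc0, hct, hc⟩ : ∃ c : ℝ≥0∞, c ≠ 0 ∧ c ≠ ⊤ ∧
      Measure.map L (volume : Measure (ℝ × ℝ)) = c • (volume : Measure Plane) := by
    refine ⟨Measure.addHaarScalarFactor (Measure.map L (volume : Measure (ℝ × ℝ))) volume, ?_,
      ENNReal.coe_ne_top, Measure.isAddLeftInvariant_eq_smul _ _⟩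
    exact ENNReal.coe_ne_zero.2
      (Measure.addHaarScalarFactor_pos_of_isAddHaarMeasure _ _).ne'
  set V := volume (Metric.closedBall x ϱ) with hV
  have hV0 : V ≠ 0 := (Metric.measure_closedBall_pos volume x hϱ).ne'
  have hVt : V ≠ ⊤ := (measure_closedBall_lt_top).ne
  refine ⟨V⁻¹ * c⁻¹, by simp [hVt, hct], ENNReal.mul_ne_top (by simp [hV0]) (by simp [hc0]),
    fun F hF => ?_⟩
  have hmap : Measure.map (fun y => x + L y) (volume : Measure (ℝ × ℝ)) = c • volume := by
    have h1 := Measure.map_map (μ := (volume : Measure (ℝ × ℝ))) (g := fun z => x + z) (f := L)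
      (by fun_prop) L.continuous.measurable
    rw [Function.comp_def] at h1
    rw [← h1, hc, Measure.map_smul, (measurePreserving_add_left volume x).map_eq]
  have hpre : (fun y => x + L y) ⁻¹' Metric.closedBall x ϱ = unitDisc := by
    ext y
    have h1 : dist (x + L y) x = ϱ * ‖y.1 • η + y.2 • ξ‖ := by
      rw [dist_self_add_left, hL, norm_smul, Real.norm_of_nonneg hϱ.le]
    have h2 := h y.1 y.2
    rw [mem_preimage, Metric.mem_closedBall, h1, mul_le_iff_le_one_right hϱ]
    change _ ↔ y.1 ^ 2 + y.2 ^ 2 ≤ 1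
    rw [← h2, sq_le_one_iff₀ (norm_nonneg _)]
  have hint : ∫⁻ y in unitDisc, F (u (x + ϱ • (y.1 • η + y.2 • ξ)))
      = c * ∫⁻ z in Metric.closedBall x ϱ, F (u z) := by
    rw [← hpre]
    have := setLIntegral_map (μ := (volume : Measure (ℝ × ℝ))) (g := fun y => x + L y)
      (f := fun z => F (u z)) (s := Metric.closedBall x ϱ)
      Metric.isClosed_closedBall.measurableSet (hF.comp hu.measurable)
      (by have := L.continuous.measurable; fun_prop)
    simp only [← hL]
    rw [← this, hmap, Measure.restrict_smul, lintegral_smul_measure, smul_eq_mul]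
  rw [hint, discLaw, lintegral_map hF hu.measurable, ProbabilityTheory.cond,
    lintegral_smul_measure, smul_eq_mul, mul_assoc, ← mul_assoc c⁻¹,
    ENNReal.inv_mul_cancel hc0 hct, one_mul]

/-- Hadamard's lemma divides u(x + εw) - u(x) by ε while keeping joint smoothness, also at ε = 0. A
second application isolates the next coefficient, which Taylor's formula identifies with half the
Hessian form. -/
theorem exists_normalized_expansion {u : Plane → ℝ} (hu : ContDiff ℝ ∞ u) (x : Plane)
    {η ξ : Plane} {g : ℝ} (hg : 0 < g)
    (hgrad : ∀ s v : ℝ, fderiv ℝ u x (s • η + v • ξ) = g * s) :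
    ∃ W : (ℝ × ℝ) × ℝ → ℝ, ContDiff ℝ ∞ W ∧ (∀ y, W (y, 0) = y.1) ∧
      (∀ y : ℝ × ℝ, HasDerivAt (fun ε => W (y, ε))
        (hessianForm u x (y.1 • η + y.2 • ξ) / (2 * g)) 0) ∧
      ∀ y ε, u (x + ε • (y.1 • η + y.2 • ξ)) = u x + ε * g * W (y, ε) := by
  set f : (ℝ × ℝ) × ℝ → ℝ := fun q => u (x + q.2 • (q.1.1 • η + q.1.2 • ξ)) with hfdef
  have hf : ContDiff ℝ ∞ f := hu.comp (by fun_prop)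
  obtain ⟨f₁, hf₁, h1, h1'⟩ := ContDiffOn.exists_hadamard (f := f) isOpen_univ isOpen_univ
    convex_univ (mem_univ (0 : ℝ)) hf.contDiffOn
  obtain ⟨f₂, hf₂, h2, h2'⟩ := ContDiffOn.exists_hadamard (f := f₁) isOpen_univ isOpen_univ
    convex_univ (mem_univ (0 : ℝ)) hf₁
  simp only [univ_prod_univ, contDiffOn_univ] at hf₁ hf₂
  have hf₁0 : ∀ y : ℝ × ℝ, f₁ (y, 0) = g * y.1 := by
    intro y
    have hl : HasDerivAt (fun ε : ℝ => x + ε • (y.1 • η + y.2 • ξ)) (y.1 • η + y.2 • ξ) 0 := by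
      simpa using ((hasDerivAt_id (0 : ℝ)).smul_const (y.1 • η + y.2 • ξ)).const_add x
    have h3 := (hu.differentiable (by simp)
      (x + (0 : ℝ) • (y.1 • η + y.2 • ξ))).hasFDerivAt.comp_hasDerivAt (0 : ℝ) hl
    rw [(h1' y (mem_univ y)).unique h3, zero_smul, add_zero, hgrad]
  have hf₂0 : ∀ y : ℝ × ℝ, f₂ (y, 0) = 1 / 2 * hessianForm u x (y.1 • η + y.2 • ξ) := by
    intro y
    set w := y.1 • η + y.2 • ξ with hw
    have hlim : Tendsto (fun ε : ℝ => f₂ (y, ε)) (𝓝[≠] 0) (𝓝 (f₂ (y, 0))) :=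
      (hf₂.continuous.comp (by fun_prop : Continuous fun ε : ℝ => (y, ε))).continuousAt.tendsto
        |>.mono_left nhdsWithin_le_nhds
    refine tendsto_nhds_unique hlim ?_
    rw [tendsto_iff_norm_sub_tendsto_zero]
    have hsm : Tendsto (fun ε : ℝ => ε • w) (𝓝[≠] 0) (𝓝 0) := by
      have : Continuous fun ε : ℝ => ε • w := by fun_prop
      simpa using (this.tendsto 0).mono_left nhdsWithin_le_nhds
    have hT := (taylor_two_isLittleO hu x).comp_tendsto hsm
    have hT2 : (fun ε : ℝ => ε ^ 2 * (f₂ (y, ε) - 1 / 2 * hessianForm u x w))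
        =o[𝓝[≠] 0] fun ε : ℝ => ε ^ 2 := by
      refine (hT.congr_left fun ε => ?_).trans_isBigO ?_
      · have e1 := h1 y (mem_univ y) ε (mem_univ ε)
        have e2 := h2 y (mem_univ y) ε (mem_univ ε)
        have e3 : fderiv ℝ u x w = g * y.1 := hgrad _ _
        have e4 : f (y, ε) = u (x + ε • w) := rfl
        have e5 : f (y, 0) = u x := by simp [hfdef]
        rw [e4, e5, e2, hf₁0] at e1
        simp only [Function.comp_apply, e1, map_smul, e3, hessianForm, smul_eq_mul,
          smul_apply]
        ring
      · refine Asymptotics.IsBigO.of_bound (‖w‖ ^ 2) (Eventually.of_forall fun ε => ?_)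
        simp only [Function.comp_apply, norm_smul, norm_pow, norm_mul, norm_norm]
        exact le_of_eq (by ring)
    refine tendsto_zero_iff_norm_tendsto_zero.1 (hT2.tendsto_div_nhds_zero.congr' ?_)
    filter_upwards [self_mem_nhdsWithin] with ε hε
    have : ε ≠ 0 := hε
    field_simp
  refine ⟨fun q => g⁻¹ * f₁ q, contDiff_const.mul hf₁, fun y => ?_, fun y => ?_, fun y ε => ?_⟩
  · simp only [hf₁0]; field_simp
  · refine ((h2' y (mem_univ y)).const_mul g⁻¹).congr_deriv ?_
    rw [hf₂0]; field_simp
  · have e1 := h1 y (mem_univ y) ε (mem_univ ε)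
    have e5 : f (y, 0) = u x := by simp [hfdef]
    have e4 : f (y, ε) = u (x + ε • (y.1 • η + y.2 • ξ)) := rfl
    rw [← e4, e1, e5]; field_simp

theorem gradientDir_levelDir {u : Plane → ℝ} {x : Plane} (h : 0 < ‖gradient u x‖) :
    (∀ s v : ℝ, ‖s • gradientDir u x + v • levelDir u x‖ ^ 2 = s ^ 2 + v ^ 2) ∧
    ∀ s v : ℝ, fderiv ℝ u x (s • gradientDir u x + v • levelDir u x) = ‖gradient u x‖ * s := by
  have hn : gradientDir u x 0 ^ 2 + gradientDir u x 1 ^ 2 = 1 := by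
    have h1 : ‖gradientDir u x‖ = 1 := by
      rw [gradientDir, norm_smul, norm_inv, norm_norm, inv_mul_cancel₀ h.ne']
    have h2 := EuclideanSpace.real_norm_sq_eq (gradientDir u x)
    rw [h1, Fin.sum_univ_two] at h2
    linarith
  have hl0 : levelDir u x 0 = -(gradientDir u x 1) := rfl
  have hl1 : levelDir u x 1 = gradientDir u x 0 := rfl
  refine ⟨fun s v => ?_, fun s v => ?_⟩
  · rw [EuclideanSpace.real_norm_sq_eq, Fin.sum_univ_two]
    simp only [PiLp.add_apply, PiLp.smul_apply, smul_eq_mul, hl0, hl1]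
    linear_combination (s ^ 2 + v ^ 2) * hn
  · have h1 : ∀ w, fderiv ℝ u x w = inner ℝ (gradient u x) w := fun w => by
      simp [gradient]
    have h2 : gradient u x = ‖gradient u x‖ • gradientDir u x := by
      rw [gradientDir, smul_smul, mul_inv_cancel₀ h.ne', one_smul]
    have h3 : inner ℝ (gradientDir u x) (s • gradientDir u x + v • levelDir u x) = s := by
      rw [PiLp.inner_apply, Fin.sum_univ_two]
      simp only [PiLp.add_apply, PiLp.smul_apply, smul_eq_mul, hl0, hl1, RCLike.inner_apply,
        conj_trivial]
      linear_combination s * hn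
    conv_lhs => rw [h1, h2, real_inner_smul_left, h3]

/-- This is the p-homogeneity of the penaliser. It persists at the pole because the scale ϱg is
positive and finite. -/
theorem lintegral_discLaw_eq_penalty {u : Plane → ℝ} {x : Plane} {ϱ g p μ : ℝ} (hϱg : 0 < ϱ * g)
    {W : (ℝ × ℝ) × ℝ → ℝ} (hW : Continuous W) {c : ℝ≥0∞} {η ξ : Plane}
    (hc : ∀ F : ℝ → ℝ≥0∞, Measurable F → ∫⁻ z, F z ∂discLaw u x ϱ
        = c * ∫⁻ y in unitDisc, F (u (x + ϱ • (y.1 • η + y.2 • ξ))))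
    (hu : ∀ y : ℝ × ℝ, u (x + ϱ • (y.1 • η + y.2 • ξ)) = u x + ϱ * g * W (y, ϱ)) :
    ∫⁻ z, ENNReal.ofReal |μ - z| ^ p ∂discLaw u x ϱ
      = c * ENNReal.ofReal (ϱ * g) ^ p *
        ∫⁻ y in unitDisc, penalty p ((μ - u x) / (ϱ * g) - W (y, ϱ)) := by
  have hm : Measurable fun y : ℝ × ℝ => penalty p ((μ - u x) / (ϱ * g) - W (y, ϱ)) :=
    (measurable_penalty p).comp (by fun_prop)
  rw [hc _ (by fun_prop), mul_assoc, ← lintegral_const_mul _ hm]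
  congr 1
  refine lintegral_congr fun y => ?_
  have h1 : μ - u (x + ϱ • (y.1 • η + y.2 • ξ))
      = ϱ * g * ((μ - u x) / (ϱ * g) - W (y, ϱ)) := by
    rw [hu, mul_sub, mul_div_cancel₀ _ hϱg.ne']; ring
  rw [h1, abs_mul, abs_of_pos hϱg, ENNReal.ofReal_mul hϱg.le, penalty]
  by_cases h0 : ENNReal.ofReal |(μ - u x) / (ϱ * g) - W (y, ϱ)| = 0
  · have h2 : ENNReal.ofReal (ϱ * g) ≠ 0 := by simpa using hϱg
    rcases lt_trichotomy p 0 with hp | rfl | hp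
    · rw [h0, mul_zero, ENNReal.zero_rpow_of_neg hp, ENNReal.mul_top]
      exact (ENNReal.rpow_pos (pos_iff_ne_zero.2 h2) ENNReal.ofReal_ne_top).ne'
    · simp
    · rw [h0, mul_zero, ENNReal.zero_rpow_of_pos hp, mul_zero]
  · exact ENNReal.mul_rpow_of_ne_top ENNReal.ofReal_ne_top ENNReal.ofReal_ne_top p

theorem exists_discMean_eq_singleton {u : Plane → ℝ} (hu : ContDiff ℝ ∞ u) {x : Plane}
    (hx : 0 < ‖gradient u x‖) {p : ℝ} (hp : -1 < p) (hp0 : p ≠ 0) :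
    ∃ K ϱ₀ : ℝ, 0 < ϱ₀ ∧ ∀ ϱ : ℝ, 0 < ϱ → ϱ < ϱ₀ → ∃ μ : ℝ, discMean p u x ϱ = {μ} ∧
      |μ - u x - ϱ ^ 2 / (2 * (p + 2)) * smootherRHS p u x| ≤ K * ϱ ^ 3 := by
  obtain ⟨horth, hgrad⟩ := gradientDir_levelDir hx
  set g := ‖gradient u x‖ with hg
  set η := gradientDir u x with hη
  set ξ := levelDir u x with hξ
  obtain ⟨W, hW, hW0, hW1, hWu⟩ := exists_normalized_expansion hu x hx hgrad
  set H := fderiv ℝ (fderiv ℝ u) x with hH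
  obtain ⟨K, hK⟩ := exists_unique_extremum hW hW0 (α := H η η / (2 * g))
    (β := (H η ξ + H ξ η) / (2 * g)) (γ := H ξ ξ / (2 * g))
    (fun y => (hW1 y).congr_deriv (by
      simp only [hessianForm, ← hH, map_add, map_smul, add_apply,
        smul_apply, smul_eq_mul]
      ring)) hp hp0
  obtain ⟨ϱ₀, hϱ₀, hK⟩ := Metric.eventually_nhds_iff.1 hK
  refine ⟨g * K, ϱ₀, hϱ₀, fun ϱ h0 h1 => ?_⟩
  obtain ⟨m, hm, hmin⟩ := hK (y := ϱ) (by rwa [Real.dist_0_eq_abs, abs_of_pos h0])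
  have hϱg : 0 < ϱ * g := mul_pos h0 hx
  obtain ⟨c, hc0, hct, hc⟩ := exists_lintegral_discLaw hu.continuous x h0 horth
  have hI := fun μ => lintegral_discLaw_eq_penalty (p := p) (μ := μ) hϱg hW.continuous hc
    (fun y => hWu y ϱ)
  have hk0 : c * ENNReal.ofReal (ϱ * g) ^ p ≠ 0 :=
    mul_ne_zero hc0 (ENNReal.rpow_pos (by simpa using hϱg) ENNReal.ofReal_ne_top).ne'
  have hkt : c * ENNReal.ofReal (ϱ * g) ^ p ≠ ⊤ :=
    ENNReal.mul_ne_top hct (ENNReal.rpow_ne_top_of_nonneg' (by simpa using hϱg)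
      ENNReal.ofReal_ne_top)
  refine ⟨u x + ϱ * g * m, orderMean_eq_singleton fun m' hm' => ?_, ?_⟩
  · have e1 : (u x + ϱ * g * m - u x) / (ϱ * g) = m := by
      rw [add_sub_cancel_left, mul_div_cancel_left₀ _ hϱg.ne']
    have e2 : (m' - u x) / (ϱ * g) ≠ m := by
      rintro rfl
      rw [mul_div_cancel₀ _ hϱg.ne'] at hm'
      exact hm' (by ring)
    obtain ⟨hpos, hneg⟩ := hmin _ e2
    refine orderMeanEnergy_lt hp0 (fun h => ?_) fun h => ?_
    · rw [hI, hI, e1]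
      exact ENNReal.mul_lt_mul_right hk0 hkt (hpos h)
    · rw [hI, hI, e1]
      exact ENNReal.mul_lt_mul_right hk0 hkt (hneg h)
  · have hp2 : p + 2 ≠ 0 := by linarith
    -- Unscaling multiplies the O(ϱ²) error in m by ϱg, which gives the cubic remainder.
    have e : u x + ϱ * g * m - u x - ϱ ^ 2 / (2 * (p + 2)) * smootherRHS p u x
        = ϱ * g * (m - ϱ * (((p - 1) * (H η η / (2 * g)) + H ξ ξ / (2 * g)) / (p + 2))) := by
      simp only [smootherRHS, hessianForm, ← hη, ← hξ, ← hH]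
      have := hx.ne'
      field_simp
      ring
    rw [e, abs_mul, abs_of_pos hϱg]
    calc _ ≤ ϱ * g * (K * ϱ ^ 2) := by gcongr
      _ = _ := by ring

/-! ### Conversion to the stated rates and conclusion -/

/-- The stated exponents are at most 5/2 and 1/2, so for ϱ < 1 they are weaker than the available 3
and 1. The constant 2p+5 dominates both 1 and the factor 2p+4 from dividing by the time step. -/
theorem abs_le_mul_rpow_of_cubic {E F p ϱ K r : ℝ} (hp : -1 < p) (h0 : 0 < ϱ) (h1 : ϱ < 1)
    (hE : |E - ϱ ^ 2 / (2 * (p + 2)) * r| ≤ K * ϱ ^ 3) (hF : F = E / timeStep p ϱ) :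
    |E - ϱ ^ 2 / (2 * (p + 2)) * r| ≤ (2 * p + 5) * |K| * ϱ ^ ((min p 0 + 5) / 2) ∧
      |F - r| ≤ (2 * p + 5) * |K| * ϱ ^ ((min p 0 + 1) / 2) := by
  have hmin : min p 0 ≤ 0 := min_le_right _ _
  have hK : K ≤ |K| := le_abs_self K
  have hK0 : 0 ≤ |K| := abs_nonneg K
  have e3 : ϱ ^ 3 ≤ ϱ ^ ((min p 0 + 5) / 2) := by
    rw [← Real.rpow_natCast]
    exact Real.rpow_le_rpow_of_exponent_ge h0 h1.le (by push_cast; linarith)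
  have e1 : ϱ ≤ ϱ ^ ((min p 0 + 1) / 2) := by
    conv_lhs => rw [← Real.rpow_one ϱ]
    exact Real.rpow_le_rpow_of_exponent_ge h0 h1.le (by linarith)
  constructor
  · calc _ ≤ K * ϱ ^ 3 := hE
      _ ≤ |K| * ϱ ^ 3 := by gcongr
      _ ≤ |K| * ϱ ^ ((min p 0 + 5) / 2) := by gcongr
      _ ≤ (2 * p + 5) * |K| * ϱ ^ ((min p 0 + 5) / 2) := by
        gcongr
        exact le_mul_of_one_le_left hK0 (by linarith)
  · have hp2 : 0 < 2 * p + 4 := by linarith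
    have hτ : F - r = (2 * p + 4) / ϱ ^ 2 * (E - ϱ ^ 2 / (2 * (p + 2)) * r) := by
      rw [hF, timeStep]
      have : p + 2 ≠ 0 := by linarith
      have h2 : 2 * p + 4 = 2 * (p + 2) := by ring
      rw [h2]
      field_simp
    rw [hτ, abs_mul, abs_of_pos (by positivity)]
    calc _ ≤ (2 * p + 4) / ϱ ^ 2 * (K * ϱ ^ 3) := by gcongr
      _ = (2 * p + 4) * K * ϱ := by field_simp
      _ ≤ (2 * p + 4) * |K| * ϱ := by gcongr
      _ ≤ (2 * p + 5) * |K| * ϱ := by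
        gcongr
        linarith
      _ ≤ (2 * p + 5) * |K| * ϱ ^ ((min p 0 + 1) / 2) :=
        mul_le_mul_of_nonneg_left e1 (mul_nonneg (by linarith) hK0)

theorem neg_le_div_timeStep {p ϱ ε d : ℝ} (hp : -1 < p) (h0 : 0 < ϱ)
    (h : -(ε / (2 * p + 4) * ϱ ^ 2) ≤ d) : -ε ≤ d / timeStep p ϱ := by
  have hp2 : 0 < 2 * p + 4 := by linarith
  rw [timeStep, le_div_iff₀ (by positivity)]
  calc _ = -(ε / (2 * p + 4) * ϱ ^ 2) := by ring
    _ ≤ d := h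

end

theorem mainTheorem1 (u : Plane → ℝ) (hu : ContDiff ℝ ∞ u) (x₀ : Plane)
    (p : ℝ) (hp : -1 < p) (hp0 : p ≠ 0) :
    -- regular points
    (0 < ‖gradient u x₀‖ →
      ∃ C ϱ₀ : ℝ, 0 < ϱ₀ ∧ ∀ ϱ : ℝ, 0 < ϱ → ϱ < ϱ₀ →
        ∃ μ : ℝ, discMean p u x₀ ϱ = {μ} ∧
          |μ - u x₀ - ϱ ^ 2 / (2 * (p + 2)) * smootherRHS p u x₀|
            ≤ C * ϱ ^ ((min p 0 + 5) / 2) ∧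
          |(μ - u x₀) / timeStep p ϱ - smootherRHS p u x₀|
            ≤ C * ϱ ^ ((min p 0 + 1) / 2)) ∧
    -- local minima and maxima
    (IsLocalMin u x₀ →
      ∃ ϱ₀ : ℝ, 0 < ϱ₀ ∧ ∀ ϱ : ℝ, 0 < ϱ → ϱ < ϱ₀ →
        ∀ μ ∈ discMean p u x₀ ϱ, 0 ≤ μ - u x₀) ∧
    (IsLocalMax u x₀ →
      ∃ ϱ₀ : ℝ, 0 < ϱ₀ ∧ ∀ ϱ : ℝ, 0 < ϱ → ϱ < ϱ₀ →
        ∀ μ ∈ discMean p u x₀ ϱ, μ - u x₀ ≤ 0) ∧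
    -- critical points with semidefinite Hessian
    (gradient u x₀ = 0 → (∀ v : Plane, 0 ≤ hessianForm u x₀ v) →
      ∀ ε : ℝ, 0 < ε → ∃ ϱ₀ : ℝ, 0 < ϱ₀ ∧ ∀ ϱ : ℝ, 0 < ϱ → ϱ < ϱ₀ →
        ∀ μ ∈ discMean p u x₀ ϱ, -ε ≤ (μ - u x₀) / timeStep p ϱ) ∧
    (gradient u x₀ = 0 → (∀ v : Plane, hessianForm u x₀ v ≤ 0) →
      ∀ ε : ℝ, 0 < ε → ∃ ϱ₀ : ℝ, 0 < ϱ₀ ∧ ∀ ϱ : ℝ, 0 < ϱ → ϱ < ϱ₀ →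
        ∀ μ ∈ discMean p u x₀ ϱ, (μ - u x₀) / timeStep p ϱ ≤ ε) := by
  have hcont := hu.continuous
  refine ⟨fun hx => ?_, fun h => ?_, fun h => ?_, fun hx hH ε hε => ?_, fun hx hH ε hε => ?_⟩
  · obtain ⟨K, ϱ₀, hϱ₀, hK⟩ := exists_discMean_eq_singleton hu hx hp hp0
    refine ⟨(2 * p + 5) * |K|, min ϱ₀ 1, lt_min hϱ₀ one_pos, fun ϱ h0 h1 => ?_⟩
    obtain ⟨μ, hμ, hb⟩ := hK ϱ h0 (h1.trans_le (min_le_left _ _))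
    exact ⟨μ, hμ, abs_le_mul_rpow_of_cubic hp h0 (h1.trans_le (min_le_right _ _)) hb rfl⟩
  · obtain ⟨ϱ₀, hϱ₀, hb⟩ := exists_forall_closedBall h
    exact ⟨ϱ₀, hϱ₀, fun ϱ h0 h1 μ hμ =>
      sub_nonneg.2 (le_of_mem_discMean hp0 hcont h0 (hb ϱ h0 h1) hμ)⟩
  · obtain ⟨ϱ₀, hϱ₀, hb⟩ := exists_forall_closedBall h
    exact ⟨ϱ₀, hϱ₀, fun ϱ h0 h1 μ hμ =>
      sub_nonpos.2 (mem_discMean_le hp0 hcont h0 (hb ϱ h0 h1) hμ)⟩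
  · have hc : 0 < ε / (2 * p + 4) := div_pos hε (by linarith)
    obtain ⟨ϱ₀, hϱ₀, hb⟩ := exists_forall_closedBall (eventually_abs_taylor_le hu hx hc)
    refine ⟨ϱ₀, hϱ₀, fun ϱ h0 h1 μ hμ => neg_le_div_timeStep hp h0 ?_⟩
    -- The subtracted term is ε times the time step: the Taylor remainder on the disc was made this
    -- small, and the semidefinite Hessian term only helps.
    have := le_of_mem_discMean hp0 hcont (b := u x₀ - ε / (2 * p + 4) * ϱ ^ 2) h0
      (fun z hz => by
        have h2 := (abs_le.1 (hb ϱ h0 h1 z hz)).1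
        have h3 : ε / (2 * p + 4) * ‖z - x₀‖ ^ 2 ≤ ε / (2 * p + 4) * ϱ ^ 2 := by
          gcongr
          exact mem_closedBall_iff_norm.1 hz
        linarith [hH (z - x₀)]) hμ
    linarith
  · have hc : 0 < ε / (2 * p + 4) := div_pos hε (by linarith)
    obtain ⟨ϱ₀, hϱ₀, hb⟩ := exists_forall_closedBall (eventually_abs_taylor_le hu hx hc)
    refine ⟨ϱ₀, hϱ₀, fun ϱ h0 h1 μ hμ => ?_⟩
    rw [← neg_le_neg_iff, ← neg_div]
    refine neg_le_div_timeStep hp h0 ?_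
    have := mem_discMean_le hp0 hcont (b := u x₀ + ε / (2 * p + 4) * ϱ ^ 2) h0
      (fun z hz => by
        have h2 := (abs_le.1 (hb ϱ h0 h1 z hz)).2
        have h3 : ε / (2 * p + 4) * ‖z - x₀‖ ^ 2 ≤ ε / (2 * p + 4) * ϱ ^ 2 := by
          gcongr
          exact mem_closedBall_iff_norm.1 hz
        linarith [hH (z - x₀)]) hμ
    linarith
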